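/- Let $R$ be a (unital, associative) ring with Jacobson radical $J$ such that $R/J$ is finite and $J$ is finitely generated as a left ideal. Let $M$ be a finitely generated projective left $R$-module. Let $I\subseteq J$ be a two-sided ideal of $R$ that is invertible, i.e. $I\otimes_R-$ is an auto-equivalence of the category of left $R$-modules, and suppose that all finite colength submodules of $M/IM$ are isomorphic to each other. Fix Artin--Wedderburn decompositions $$R/J\simeq\prod_{i\in\mathcal S}\mathrm M_{r_i}(\mathbb F_{q_i}),\qquad M/JM\simeq\bigoplus_{i\in\mathcal S}S_i^{\oplus m_i},\qquad S_i=\mathbb F_{q_i}^{\oplus r_i},$$ where $r_i\ge1$ and $m_i\ge 0$; thus $(S_i)_{i\in\mathcal S}$ represents the finitely many isomorphism classes of simple left $R$-modules. For a left $R$-module $N$ of finite length put $[N]=\prod_{i}z_i^{\mu_i(N)}$, where $\mu_i(N)$ is the multiplicity of $S_i$ in a composition series of $N$; so $z_i=[S_i]$. Let $\mathrm{Dir}=\mathbb C[[z_i]]_{i\in\mathcal S}$, with formal (coefficientwise, $\mathbb C$ discrete) convergence. The Bushnell--Reiner zeta function of $M$ is $$Z(M;z)=\sum_X[M/X]\in\mathrm{Dir},$$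 summed over all finite colength submodules $X$ of $M$. The proliferation of $M/IM$ by $I\otimes-$ is $$\mathrm{Prolif}(M/IM,I\otimes-)=\sum_{P\in\mathcal P}\ \prod_{j=0}^\infty\ \sum_{X}\langle P,P_{j+1}/X\rangle_j,$$ $$\langle P,B\rangle_j=|\mathrm{Hom}_R(P_j,B)|^{-1}\prod_{k=0}^j|\mathrm{Hom}_R(P_{j-k},I^k\otimes_R B)|\,[I^k\otimes_R B],$$ where $\mathcal P$ is the set of sequences $P=(P_j)_{j\ge0}$ of isomorphism classes of modules such that each $P_j$ is the isomorphism class of $Y_j$ for some chain $Y_0\subseteq Y_1\subseteq\cdots$ of finite colength submodules of $M/IM$ with $Y_j=M/IM$ for all large $j$, and where the inner sum is over all finite colength submodules $X$ of $P_{j+1}$ with $X\simeq P_j$. Then there is a (unique) permutation $\sigma$ of $\mathcal S$ with $I\otimes_R S_i\simeq S_{\sigma(i)}$ for all $i$, all the sums and products above and below converge in $\mathrm{Dir}$, and $$Z(M;z)=\mathrm{Prolif}(M/IM,I\otimes-)=\prod_{n=0}^\infty\prod_{i\in\mathcal S}\prod_{j=0}^{m_i-1}\Bigl(1-q_i^{\,j-m_i}\prod_{k=0}^n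 w_{\sigma^k(i)}\Bigr)^{-1},\qquad w_i=q_i^{m_i}z_i.$$ -/

import Mathlib

universe u v w

noncomputable section

namespace LiftedHey

open CategoryTheory
open scoped TensorProduct

/-! ### Simple modules, Grothendieck monoid and the Dirichlet algebra -/

/-- Two maximal left ideals are identified when the simple modules they define are isomorphic. -/
def simpleSetoid (R : Type u) [Ring R] : Setoid {m : Ideal R // m.IsMaximal} where
  r m m' := Nonempty ((R ⧸ m.1) ≃ₗ[R] (R ⧸ m'.1))
  iseqv := ⟨fun _ => ⟨.refl _ _⟩, fun ⟨e⟩ => ⟨e.symm⟩, fun ⟨e⟩ ⟨f⟩ => ⟨e.trans f⟩⟩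

/-- The set `𝒮(R)` of isomorphism classes of simple left `R`-modules. Every simple module is
isomorphic to `R ⧸ m` for a maximal left ideal `m`. -/
def SimpleClass (R : Type u) [Ring R] : Type u := Quotient (simpleSetoid R)

/-- The isomorphism class of a simple module. -/
def simpleClass (R : Type u) [Ring R] (S : Type v) [AddCommGroup S] [Module R S]
    (h : IsSimpleModule R S) : SimpleClass R :=
  Quotient.mk (simpleSetoid R)
    ⟨(isSimpleModule_iff_quot_maximal.mp h).choose,
      (isSimpleModule_iff_quot_maximal.mp h).choose_spec.1⟩

/-- The product (written additively, as an exponent vector) in the free commutative monoid on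
`𝒮(R)` of the classes of the factors of a composition series. -/
def seriesClass {R : Type u} [Ring R] {N : Type v} [AddCommGroup N] [Module R N]
    (s : CompositionSeries (Submodule R N)) : SimpleClass R →₀ ℕ :=
  ∑ j : Fin s.length, Finsupp.single
    (simpleClass R (s j.succ ⧸ (s j.castSucc).comap (s j.succ).subtype)
      ((covBy_iff_quot_is_simple (s.step j).le).mp (s.step j))) 1

open Classical in
/-- The class `[N]` of a finite length module `N` in the free commutative monoid `G(R)` on `𝒮(R)`
(written additively). It is computed from any composition series of `N`; the value `0` for modules
that are not of finite length is a dummy. -/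
def grothClass (R : Type u) [Ring R] (N : Type v) [AddCommGroup N] [Module R N] :
    SimpleClass R →₀ ℕ :=
  if h : ∃ s : CompositionSeries (Submodule R N), s.head = ⊥ ∧ s.last = ⊤ then
    seriesClass h.choose
  else 0

/-- The Dirichlet algebra `Dir(R)`: formal complex combinations of elements of `G(R)`. -/
abbrev Dir (R : Type u) [Ring R] : Type u := MvPowerSeries (SimpleClass R) ℂ

/-- The topology of formal convergence on `Dir(R)`: coefficientwise convergence, where the field of
coefficients `ℂ` is discrete. -/
instance dirTopology (R : Type u) [Ring R] : TopologicalSpace (Dir R) :=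
  @MvPowerSeries.WithPiTopology.instTopologicalSpace (SimpleClass R) ℂ ⊥

/-- The class `[N]`, as an element of `Dir(R)`. -/
def dirClass (R : Type u) [Ring R] (N : Type v) [AddCommGroup N] [Module R N] : Dir R :=
  MvPowerSeries.monomial (grothClass R N) (1 : ℂ)

/-- Submodules of finite colength. -/
def FiniteColength {R : Type u} [Ring R] {N : Type v} [AddCommGroup N] [Module R N]
    (X : Submodule R N) : Prop :=
  IsFiniteLength R (N ⧸ X)

/-- The term `[M/X]` of the Bushnell-Reiner zeta function. -/
def zetaTerm (R : Type u) [Ring R] (M : Type v) [AddCommGroup M] [Module R M]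
    (X : {X : Submodule R M // FiniteColength X}) : Dir R :=
  dirClass R (M ⧸ X.1)

/-- The Bushnell-Reiner zeta function `Z(M) = ∑_X [M/X]`, summed over all submodules `X` of finite
colength. -/
def brZeta (R : Type u) [Ring R] (M : Type v) [AddCommGroup M] [Module R M] : Dir R :=
  ∑' X, zetaTerm R M X

/-! ### Tensoring with a two-sided ideal -/

section Tensor

variable {R : Type u} [Ring R] (I : Ideal R) [I.IsTwoSided]

/-- The relations `x r ⊗ n = x ⊗ r n` defining `I ⊗_R N` as a quotient of `I ⊗_ℤ N`. -/
def balancedRel (N : Type v) [AddCommGroup N] [Module R N] : Submodule R (I ⊗[ℤ] N) :=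
  Submodule.span R {t | ∃ (x : I) (r : R) (n : N),
    t = (⟨x.1 * r, I.mul_mem_right r x.2⟩ : I) ⊗ₜ[ℤ] n - x ⊗ₜ[ℤ] (r • n)}

/-- The left `R`-module `I ⊗_R N`. -/
abbrev IdealTensor (N : Type v) [AddCommGroup N] [Module R N] : Type (max u v) :=
  (I ⊗[ℤ] N) ⧸ balancedRel I N

/-- The map `I ⊗_ℤ N → I ⊗_ℤ N'` induced by `f : N → N'`. -/
def preTensorMap {N : Type v} [AddCommGroup N] [Module R N] {N' : Type w} [AddCommGroup N']
    [Module R N'] (f : N →ₗ[R] N') : (I ⊗[ℤ] N) →ₗ[R] (I ⊗[ℤ] N') :=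
  TensorProduct.AlgebraTensorModule.map LinearMap.id f.toAddMonoidHom.toIntLinearMap

theorem balancedRel_le_comap {N : Type v} [AddCommGroup N] [Module R N] {N' : Type w}
    [AddCommGroup N'] [Module R N'] (f : N →ₗ[R] N') :
    balancedRel I N ≤ (balancedRel I N').comap (preTensorMap I f) := by
  refine Submodule.span_le.mpr ?_
  rintro _ ⟨x, r, n, rfl⟩
  refine Submodule.subset_span ⟨x, r, f n, ?_⟩
  simp [preTensorMap]

/-- The map `I ⊗_R N → I ⊗_R N'` induced by `f : N → N'`. -/
def idealTensorMap {N : Type v} [AddCommGroup N] [Module R N] {N' : Type w} [AddCommGroup N']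
    [Module R N'] (f : N →ₗ[R] N') : IdealTensor I N →ₗ[R] IdealTensor I N' :=
  Submodule.mapQ _ _ (preTensorMap I f) (balancedRel_le_comap I f)

/-- The endofunctor `I ⊗_R -` of the category of left `R`-modules. -/
def idealTensorFunctor : ModuleCat.{u} R ⥤ ModuleCat.{u} R where
  obj N := ModuleCat.of R (IdealTensor I N)
  map f := ModuleCat.ofHom (idealTensorMap I f.hom)
  map_id N := by
    ext : 1
    refine Submodule.linearMap_qext _ (LinearMap.ext fun t => ?_)
    refine congrArg (Submodule.mkQ (balancedRel I N)) (?_ : preTensorMap I LinearMap.id t = t)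
    induction t using TensorProduct.induction_on with
    | zero => simp
    | tmul x n => simp [preTensorMap]
    | add a b ha hb => rw [map_add, ha, hb]
  map_comp {N N' N''} f g := by
    ext : 1
    refine Submodule.linearMap_qext _ (LinearMap.ext fun t => ?_)
    refine congrArg (Submodule.mkQ (balancedRel I N''))
      (?_ : preTensorMap I (g.hom ∘ₗ f.hom) t = preTensorMap I g.hom (preTensorMap I f.hom t))
    induction t using TensorProduct.induction_on with
    | zero => simp
    | tmul x n => simp [preTensorMap]
    | add a b ha hb => rw [map_add, ha, hb, map_add, map_add]

/-- A two-sided ideal `I` is invertible if `I ⊗_R -` is an auto-equivalence of the category of left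
`R`-modules. -/
def IsInvertibleIdeal : Prop := (idealTensorFunctor I).IsEquivalence

end Tensor

/-! ### The proliferation -/

/-- Chains `Y 0 ⊆ Y 1 ⊆ ⋯` of finite colength submodules of `N` that eventually stabilise
to `N`. -/
structure ColengthChain (R : Type u) [Ring R] (N : Type v) [AddCommGroup N] [Module R N] where
  Y : ℕ → Submodule R N
  mono : Monotone Y
  finiteColength : ∀ j, FiniteColength (Y j)
  stabilises : ∃ n, ∀ j, n ≤ j → Y j = ⊤

/-- Entrywise isomorphism of chains. -/
def chainSetoid (R : Type u) [Ring R] (N : Type v) [AddCommGroup N] [Module R N] :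
    Setoid (ColengthChain R N) where
  r Y Y' := ∀ j, Nonempty (Y.Y j ≃ₗ[R] Y'.Y j)
  iseqv := ⟨fun _ _ => ⟨.refl _ _⟩, fun h j => ⟨(h j).some.symm⟩,
    fun h h' j => ⟨(h j).some.trans (h' j).some⟩⟩

/-- The set `𝒫` of sequences of isomorphism classes `([Y 0], [Y 1], …)` arising from chains. -/
def ChainClass (R : Type u) [Ring R] (N : Type v) [AddCommGroup N] [Module R N] : Type v :=
  Quotient (chainSetoid R N)

/-- The element
`⟨P, B⟩_j = |Hom(P_j, B)|⁻¹ ∏_{k=0}^j |Hom(P_{j-k}, I^k ⊗ B)| [I^k ⊗ B]`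
of `Dir(R)`, for the sequence `P` of modules underlying a chain. -/
def bracket {R : Type u} [Ring R] (I : Ideal R) [I.IsTwoSided] {N : Type v} [AddCommGroup N]
    [Module R N] (P : ℕ → Submodule R N) (j : ℕ) (B : Type w) [AddCommGroup B] [Module R B] :
    Dir R :=
  MvPowerSeries.C ((Nat.card (P j →ₗ[R] B) : ℂ)⁻¹) *
    ∏ k ∈ Finset.range (j + 1),
      MvPowerSeries.C (Nat.card (P (j - k) →ₗ[R] IdealTensor (I ^ k) B) : ℂ) *
        dirClass R (IdealTensor (I ^ k) B)

/-- The terms of the partial zeta function `Z(P_{j+1}, P_j; ⟨P, -⟩_j)`: it is the sum of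
`⟨P, P_{j+1}/X⟩_j` over all finite colength submodules `X` of `P_{j+1}` isomorphic to `P_j`. -/
def partialTerm {R : Type u} [Ring R] (I : Ideal R) [I.IsTwoSided] {N : Type v} [AddCommGroup N]
    [Module R N] (P : ℕ → Submodule R N) (j : ℕ)
    (X : {X : Submodule R (P (j + 1)) // FiniteColength X ∧ Nonempty (X ≃ₗ[R] P j)}) : Dir R :=
  bracket I P j (P (j + 1) ⧸ X.1)

/-- `HasProlif I N z` means that the sum of infinite products
`Prolif(N; I ⊗ -) = ∑_{P ∈ 𝒫} ∏_{j=0}^∞ Z(P_{j+1}, P_j; ⟨P, -⟩_j)`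
converges in `Dir(R)`, with value `z`. Here `f P` is the infinite product for `P`, computed from any
chain representing `P`, and `g j` is its `j`-th factor. -/
def HasProlif {R : Type u} [Ring R] (I : Ideal R) [I.IsTwoSided] (N : Type v) [AddCommGroup N]
    [Module R N] (z : Dir R) : Prop :=
  ∃ f : ChainClass R N → Dir R,
    (∀ Y : ColengthChain R N, ∃ g : ℕ → Dir R,
      (∀ j, HasSum (partialTerm I Y.Y j) (g j)) ∧
        HasProd g (f (Quotient.mk (chainSetoid R N) Y))) ∧
    HasSum f z

/-! ### Artin-Wedderburn data -/

/-- For a ring isomorphism `R/J ≃ ∏ i, M_{r i}(K i)`, the simple left `R`-module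
`S i = (K i)^{r i}` of column vectors. -/
def ColumnModule {R : Type u} [Ring R] {ι : Type v} {K : ι → Type w} [∀ i, Field (K i)]
    {r : ι → ℕ}
    (_e : (R ⧸ Ring.jacobson R) ≃+* ((i : ι) → Matrix (Fin (r i)) (Fin (r i)) (K i)))
    (i : ι) : Type w :=
  Fin (r i) → K i

section Column

variable {R : Type u} [Ring R] {ι : Type v} {K : ι → Type w} [∀ i, Field (K i)] {r : ι → ℕ}
  (e : (R ⧸ Ring.jacobson R) ≃+* ((i : ι) → Matrix (Fin (r i)) (Fin (r i)) (K i))) (i : ι)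

instance : AddCommGroup (ColumnModule e i) := inferInstanceAs (AddCommGroup (Fin (r i) → K i))

/-- `a : R` acts on column vectors through the `i`-th matrix component of its image in `R/J`. -/
instance : Module R (ColumnModule e i) where
  smul a x := Matrix.mulVec (e (Ideal.Quotient.mk (Ring.jacobson R) a) i) x
  one_smul x := by
    change Matrix.mulVec (e (Ideal.Quotient.mk (Ring.jacobson R) 1) i) x = x
    rw [map_one, map_one]; exact Matrix.one_mulVec x
  mul_smul a b x := by
    change Matrix.mulVec (e (Ideal.Quotient.mk (Ring.jacobson R) (a * b)) i) x =
      Matrix.mulVec (e (Ideal.Quotient.mk (Ring.jacobson R) a) i)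
        (Matrix.mulVec (e (Ideal.Quotient.mk (Ring.jacobson R) b) i) x)
    rw [map_mul, map_mul]; exact (Matrix.mulVec_mulVec x _ _).symm
  smul_zero a := Matrix.mulVec_zero _
  smul_add a x y := Matrix.mulVec_add _ x y
  add_smul a b x := by
    change Matrix.mulVec (e (Ideal.Quotient.mk (Ring.jacobson R) (a + b)) i) x =
      Matrix.mulVec (e (Ideal.Quotient.mk (Ring.jacobson R) a) i) x +
        Matrix.mulVec (e (Ideal.Quotient.mk (Ring.jacobson R) b) i) x
    rw [map_add, map_add]; exact Matrix.add_mulVec _ _ x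
  zero_smul x := by
    change Matrix.mulVec (e (Ideal.Quotient.mk (Ring.jacobson R) 0) i) x = 0
    rw [map_zero, map_zero]; exact Matrix.zero_mulVec x

/-- The variable `z i = [S i]` of `Dir(R)`. -/
def zVar : Dir R := dirClass R (ColumnModule e i)

/-- `w i = (q i)^{m i} z i`, where `q i = |K i|`. -/
def wVar (m : ι → ℕ) : Dir R := MvPowerSeries.C ((Nat.card (K i) : ℂ) ^ m i) * zVar e i

end Column

end LiftedHey

end

namespace LiftedHey

open CategoryTheory
open scoped TensorProduct

/-! ### Additivity of the class of a module of finite length -/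

section Groth

variable {R : Type u} [Ring R]

/-! Write `a^[N] = ∏ a_i ^ μ_i(N)` for weights `a_i` in `Dir R` (`wpow`). The zeta function is
deformed to the sum `Z(a, b)` of `a^[M/X] * b^[M/(X + IM)]` over all `X` of finite colength
(`pairZeta`). It equals `Z(M)` for `a = z`, `b = 1`, and it satisfies a recursion that splits off
one weighted zeta function of `M/IM`.

The recursion (`pairZeta_eq_mul`) comes from parametrising the submodules `X`. Since `I ⊗ -` is an
equivalence and `M` is projective, `W ↦ IW` is an order isomorphism onto the submodules of `IM`, so
`X ∩ IM = IW` for a unique `W ⊇ X`. Put `K = W ∩ IM` and `Y = X + K`. Then `W/K` is the image of `W`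
in `M/IM`, hence isomorphic to `M/IM`, and so is its submodule `Y/K`. For fixed `W` and `Y`, the
possible `X` are the complements of `K/IW` in `Y/IW`. One exists because `M` is projective and `I`
kills `Y/IW`, so their number is `|Hom(Y/K, K/IW)| = |Hom(M, K/IW)| = h^[K/IW]` with `h_i = q_i ^
m_i`. Finally `[K/IW]` is eliminated through `[K/IW] + [M/W] = [IM/IW] + [M/(W + IM)]`, where
`[IM/IW]` is `[M/W]` permuted by `σ`. Summing over `Y` gives the zeta function of `M/IM` with
weights `ab`. Summing over `W` gives `Z(a', b')` with `a' = h⁻¹ (ha)∘σ` and `b' = hab`.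

On iteration the order of `b` grows without bound. By Nakayama `X + IM = M` only for `X = M`, so the
remainder tends to `1` and `Z(M)` is an infinite product (`hasProd_wZeta`). Each factor is evaluated
by Hey's formula (`wZeta_mul_prod`): Möbius inversion over the submodules between `J C` and `C`,
together with the `q`-binomial identity `sum_heyTerm`.

All finite colength submodules of `M/IM` being isomorphic, the proliferation has a single sequence
`P`, and its `j`-th bracket is exactly the `j`-th weight (`bracket_eq_wpow`). Its infinite product
is therefore the same one. -/

theorem simpleClass_eq_iff {S : Type v} [AddCommGroup S] [Module R S] (h : IsSimpleModule R S)
    {S' : Type w} [AddCommGroup S'] [Module R S'] (h' : IsSimpleModule R S') :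
    simpleClass R S h = simpleClass R S' h' ↔ Nonempty (S ≃ₗ[R] S') := by
  obtain ⟨f⟩ := (isSimpleModule_iff_quot_maximal.mp h).choose_spec.2
  obtain ⟨f'⟩ := (isSimpleModule_iff_quot_maximal.mp h').choose_spec.2
  refine Quotient.eq.trans ?_
  exact ⟨fun ⟨g⟩ => ⟨(f.trans g).trans f'.symm⟩, fun ⟨g⟩ => ⟨(f.symm.trans g).trans f'⟩⟩

variable {N : Type v} [AddCommGroup N] [Module R N]

open Classical in
/-- The class of the quotient `B / A` if it is simple, and `0` otherwise. -/
noncomputable def stepClass (A B : Submodule R N) : SimpleClass R →₀ ℕ :=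
  if h : A ⋖ B then Finsupp.single
    (simpleClass R (B ⧸ A.comap B.subtype) ((covBy_iff_quot_is_simple h.le).mp h)) 1 else 0

theorem stepClass_of_covBy {A B : Submodule R N} (h : A ⋖ B) :
    stepClass A B = Finsupp.single
      (simpleClass R (B ⧸ A.comap B.subtype) ((covBy_iff_quot_is_simple h.le).mp h)) 1 :=
  dif_pos h

theorem seriesClass_eq_sum_stepClass (s : CompositionSeries (Submodule R N)) :
    seriesClass s = ∑ j : Fin s.length, stepClass (s j.castSucc) (s j.succ) :=
  Finset.sum_congr rfl fun j _ => (stepClass_of_covBy (s.step j)).symm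

theorem stepClass_eq_of_equiv {N' : Type w} [AddCommGroup N'] [Module R N']
    {A B : Submodule R N} {A' B' : Submodule R N'} (h : A ⋖ B) (h' : A' ⋖ B')
    (e : (B ⧸ A.comap B.subtype) ≃ₗ[R] (B' ⧸ A'.comap B'.subtype)) :
    stepClass A B = stepClass A' B' := by
  rw [stepClass_of_covBy h, stepClass_of_covBy h', (simpleClass_eq_iff _ _).mpr ⟨e⟩]

theorem seriesClass_eq_of_equivalent {s t : CompositionSeries (Submodule R N)}
    (h : s.Equivalent t) : seriesClass s = seriesClass t := by
  obtain ⟨f, hf⟩ := h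
  rw [seriesClass_eq_sum_stepClass, seriesClass_eq_sum_stepClass]
  refine Fintype.sum_equiv f _ _ fun j => ?_
  refine stepClass_eq_of_equiv (s.step j) (t.step (f j)) (Nonempty.some ?_)
  -- `JordanHolderLattice.Iso` implies every equivalence relation on pairs that obeys the second
  -- isomorphism theorem; isomorphism of the subquotients is such a relation.
  refine JordanHolderLattice.Iso.rel
    (fun x y : Submodule R N × Submodule R N => Nonempty
      ((x.2 ⧸ x.1.comap x.2.subtype) ≃ₗ[R] (y.2 ⧸ y.1.comap y.2.subtype)))
    ⟨.refl _ _⟩ (fun ⟨e⟩ => ⟨e.symm⟩) (fun ⟨e⟩ ⟨f⟩ => ⟨e.trans f⟩) ?_ (hf j)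
  intro x y _
  refine ⟨?_⟩
  dsimp only
  rw [sup_comm, inf_comm]
  refine ((Submodule.quotEquivOfEq _ _ ?_).trans
    (LinearMap.quotientInfEquivSupQuotient y x)).symm
  simp

theorem grothClass_eq_seriesClass (s : CompositionSeries (Submodule R N)) (hh : s.head = ⊥)
    (hl : s.last = ⊤) : grothClass R N = seriesClass s := by
  have h : ∃ s : CompositionSeries (Submodule R N), s.head = ⊥ ∧ s.last = ⊤ := ⟨s, hh, hl⟩
  rw [grothClass, dif_pos h]
  exact seriesClass_eq_of_equivalent (CompositionSeries.jordan_holder _ _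
    (h.choose_spec.1.trans hh.symm) (h.choose_spec.2.trans hl.symm))

/-- Common source of the two transports needed for additivity: images under injections and preimages
under surjections both preserve subquotients. -/
theorem exists_series_map {N' : Type w} [AddCommGroup N'] [Module R N']
    (φ : Submodule R N → Submodule R N') (hφ : Monotone φ)
    (hq : ∀ A B : Submodule R N, A ≤ B → Nonempty ((B ⧸ A.comap B.subtype) ≃ₗ[R]
      (φ B ⧸ (φ A).comap (φ B).subtype))) (s : CompositionSeries (Submodule R N)) :
    ∃ t : CompositionSeries (Submodule R N'), t.head = φ s.head ∧ t.last = φ s.last ∧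
      seriesClass t = seriesClass s := by
  have hcov : ∀ {A B : Submodule R N}, A ⋖ B → φ A ⋖ φ B := fun {A B} h => by
    rw [covBy_iff_quot_is_simple (hφ h.le)]
    exact ((hq A B h.le).some.isSimpleModule_iff).mp ((covBy_iff_quot_is_simple h.le).mp h)
  let t : CompositionSeries (Submodule R N') :=
    ⟨s.length, fun i => φ (s i), fun i => hcov (s.step i)⟩
  refine ⟨t, rfl, rfl, ?_⟩
  rw [seriesClass_eq_sum_stepClass, seriesClass_eq_sum_stepClass]
  exact Finset.sum_congr rfl fun j _ =>
    (stepClass_eq_of_equiv (s.step j) (t.step j) (hq _ _ (s.step j).le).some).symm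

theorem exists_series_map_of_injective {N' : Type w} [AddCommGroup N'] [Module R N']
    {f : N →ₗ[R] N'} (hf : Function.Injective f) (s : CompositionSeries (Submodule R N)) :
    ∃ t : CompositionSeries (Submodule R N'), t.head = s.head.map f ∧ t.last = s.last.map f ∧
      seriesClass t = seriesClass s := by
  refine exists_series_map (Submodule.map f) (fun _ _ => Submodule.map_mono) (fun A B h => ?_) s
  refine ⟨Submodule.Quotient.equiv _ _ (Submodule.equivMapOfInjective f hf B) ?_⟩
  ext ⟨y, hy⟩
  simp only [Submodule.mem_map, Submodule.mem_comap, Submodule.subtype_apply]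
  constructor
  · rintro ⟨x, hx, hxy⟩
    exact ⟨x, hx, congrArg Subtype.val hxy⟩
  · rintro ⟨x, hx, rfl⟩
    exact ⟨⟨x, h hx⟩, hx, rfl⟩

theorem exists_series_comap_of_surjective {N' : Type w} [AddCommGroup N'] [Module R N']
    {f : N' →ₗ[R] N} (hf : Function.Surjective f) (s : CompositionSeries (Submodule R N)) :
    ∃ t : CompositionSeries (Submodule R N'), t.head = s.head.comap f ∧
      t.last = s.last.comap f ∧ seriesClass t = seriesClass s := by
  refine exists_series_map (Submodule.comap f) (fun _ _ => Submodule.comap_mono)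
    (fun A B h => ?_) s
  let g : B.comap f →ₗ[R] (B ⧸ A.comap B.subtype) :=
    (Submodule.mkQ _).comp (f.restrict (p := B.comap f) (q := B) fun _ hx => hx)
  have hg : Function.Surjective g := by
    refine (Submodule.mkQ_surjective _).comp ?_
    rintro ⟨y, hy⟩
    obtain ⟨x, rfl⟩ := hf y
    exact ⟨⟨x, hy⟩, rfl⟩
  refine ⟨((Submodule.quotEquivOfEq _ _ ?_).trans (g.quotKerEquivOfSurjective hg)).symm⟩
  ext ⟨y, hy⟩
  simp [g]

theorem seriesClass_smash (s t : CompositionSeries (Submodule R N)) (h : s.last = t.head) :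
    seriesClass (s.smash t h) = seriesClass s + seriesClass t := by
  simp only [seriesClass_eq_sum_stepClass]
  refine (Fin.sum_univ_add (a := s.length) (b := t.length) _).trans ?_
  congr 1
  · exact Finset.sum_congr rfl fun j _ => congrArg₂ stepClass (RelSeries.smash_castAdd h j)
      (RelSeries.smash_succ_castAdd h j)
  · exact Finset.sum_congr rfl fun j _ => congrArg₂ stepClass (RelSeries.smash_natAdd h j)
      (RelSeries.smash_succ_natAdd h j)

theorem grothClass_congr {N' : Type w} [AddCommGroup N'] [Module R N'] (e : N ≃ₗ[R] N')
    (hN : IsFiniteLength R N) : grothClass R N = grothClass R N' := by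
  obtain ⟨s, hs, hs'⟩ := isFiniteLength_iff_exists_compositionSeries.mp hN
  obtain ⟨t, ht, ht', hst⟩ := exists_series_map_of_injective (f := (e : N →ₗ[R] N')) e.injective s
  rw [grothClass_eq_seriesClass s hs hs', grothClass_eq_seriesClass t _ _, hst]
  · rw [ht, hs, Submodule.map_bot]
  · rw [ht', hs', Submodule.map_top, LinearMap.range_eq_top]
    exact e.surjective

/-- A series of `p`, pushed into `N`, is continued by the preimage of a series of `N ⧸ p`; by
Jordan–Hölder the class may be read off this particular series. -/
theorem grothClass_eq_add (p : Submodule R N) (hN : IsFiniteLength R N) :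
    grothClass R N = grothClass R p + grothClass R (N ⧸ p) := by
  have hp : IsFiniteLength R p := hN.of_injective p.injective_subtype
  have hq : IsFiniteLength R (N ⧸ p) := hN.of_surjective p.mkQ_surjective
  obtain ⟨s, hs, hs'⟩ := isFiniteLength_iff_exists_compositionSeries.mp hp
  obtain ⟨t, ht, ht'⟩ := isFiniteLength_iff_exists_compositionSeries.mp hq
  obtain ⟨s', hsh, hsl, hsc⟩ := exists_series_map_of_injective p.injective_subtype s
  obtain ⟨t', hth, htl, htc⟩ := exists_series_comap_of_surjective p.mkQ_surjective t
  have h1 : s'.last = t'.head := by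
    rw [hsl, hth, hs', ht, Submodule.map_top, Submodule.range_subtype, Submodule.comap_bot,
      Submodule.ker_mkQ]
  rw [grothClass_eq_seriesClass s hs hs', grothClass_eq_seriesClass t ht ht',
    grothClass_eq_seriesClass (s'.smash t' h1) _ _, seriesClass_smash, hsc, htc]
  · rw [RelSeries.head_smash, hsh, hs, Submodule.map_bot]
  · rw [RelSeries.last_smash, htl, ht', Submodule.comap_top]

theorem grothClass_simple (h : IsSimpleModule R N) :
    grothClass R N = Finsupp.single (simpleClass R N h) 1 := by
  let s : CompositionSeries (Submodule R N) :=
    ⟨1, ![⊥, ⊤], fun i => by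
      have : i = 0 := Subsingleton.elim _ _
      subst this
      exact bot_covBy_top⟩
  rw [grothClass_eq_seriesClass s rfl rfl, seriesClass_eq_sum_stepClass]
  change ∑ j : Fin 1, _ = _
  rw [Fin.sum_univ_one, stepClass_of_covBy (s.step 0)]
  congr 1
  rw [simpleClass_eq_iff]
  refine ⟨(Submodule.quotEquivOfEqBot _ ?_).trans Submodule.topEquiv⟩
  change Submodule.comap (Submodule.subtype ⊤) (⊥ : Submodule R N) = ⊥
  rw [Submodule.comap_bot, Submodule.ker_subtype]

theorem grothClass_of_subsingleton [Subsingleton N] : grothClass R N = 0 := by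
  have h := grothClass_eq_add (R := R) (N := N) ⊥ .of_subsingleton
  have h1 := grothClass_congr (R := R) (Submodule.quotEquivOfEqBot (⊥ : Submodule R N) rfl)
    .of_subsingleton
  have h2 := grothClass_congr (R := R) (LinearEquiv.ofTop (⊥ : Submodule R N)
    (Subsingleton.elim _ _)) .of_subsingleton
  rw [h1, h2] at h
  simpa using h

theorem grothClass_of_exact {A B C : Type*} [AddCommGroup A] [Module R A] [AddCommGroup B]
    [Module R B] [AddCommGroup C] [Module R C] {f : A →ₗ[R] B} {g : B →ₗ[R] C}
    (hf : Function.Injective f) (hg : Function.Surjective g) (h : Function.Exact f g)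
    (hB : IsFiniteLength R B) : grothClass R B = grothClass R A + grothClass R C := by
  have e : (B ⧸ LinearMap.range f) ≃ₗ[R] C :=
    (Submodule.quotEquivOfEq _ _ h.linearMap_ker_eq.symm).trans (g.quotKerEquivOfSurjective hg)
  rw [grothClass_eq_add (LinearMap.range f) hB,
    grothClass_congr (LinearEquiv.ofInjective f hf) (hB.of_injective hf),
    grothClass_congr e (hB.of_surjective (Submodule.mkQ_surjective _))]

/-- The subquotient `B / A` attached to submodules `A` and `B`. -/
abbrev SubQuot (A B : Submodule R N) : Type v := B ⧸ A.comap B.subtype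

/-- The class of the subquotient `B / A`. -/
noncomputable def relClass (A B : Submodule R N) : SimpleClass R →₀ ℕ := grothClass R (SubQuot A B)

/-- The inclusion `B / A → C / A` for `B ≤ C`. -/
def subQuotInclusion (A : Submodule R N) {B C : Submodule R N} (h : B ≤ C) :
    SubQuot A B →ₗ[R] SubQuot A C :=
  Submodule.mapQ _ _ (Submodule.inclusion h) fun _ hx => hx

/-- The projection `C / A → C / B` for `A ≤ B`. -/
def subQuotFactor {A B : Submodule R N} (h : A ≤ B) (C : Submodule R N) :
    SubQuot A C →ₗ[R] SubQuot B C :=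
  Submodule.factor (Submodule.comap_mono h)

theorem subQuotInclusion_injective (A : Submodule R N) {B C : Submodule R N} (h : B ≤ C) :
    Function.Injective (subQuotInclusion A h) := by
  rw [injective_iff_map_eq_zero]
  intro x hx
  obtain ⟨x, rfl⟩ := Submodule.mkQ_surjective _ x
  exact (Submodule.Quotient.mk_eq_zero _).mpr ((Submodule.Quotient.mk_eq_zero _).mp hx :)

theorem subQuotFactor_surjective {A B : Submodule R N} (h : A ≤ B) (C : Submodule R N) :
    Function.Surjective (subQuotFactor h C) :=
  Submodule.factor_surjective (Submodule.comap_mono h)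

theorem subQuot_exact {A B C : Submodule R N} (hAB : A ≤ B) (hBC : B ≤ C) :
    Function.Exact (subQuotInclusion A hBC) (subQuotFactor hAB C) := by
  intro y
  obtain ⟨⟨y, hy⟩, rfl⟩ := Submodule.mkQ_surjective _ y
  have h1 : subQuotFactor hAB C (Submodule.mkQ _ ⟨y, hy⟩) =
    (Submodule.mkQ _ ⟨y, hy⟩ : SubQuot B C) := rfl
  rw [h1, Submodule.mkQ_apply, Submodule.Quotient.mk_eq_zero]
  constructor
  · intro h
    exact ⟨Submodule.Quotient.mk ⟨y, h⟩, rfl⟩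
  · rintro ⟨x, hx⟩
    obtain ⟨⟨x, hxB⟩, rfl⟩ := Submodule.mkQ_surjective _ x
    have h2 : Submodule.mkQ (A.comap C.subtype) ⟨x, hBC hxB⟩ = Submodule.mkQ _ ⟨y, hy⟩ := hx
    rw [Submodule.mkQ_apply, Submodule.mkQ_apply, Submodule.Quotient.eq] at h2
    have h3 : x - y ∈ A := h2
    have := B.sub_mem hxB (hAB h3)
    simpa using this

theorem relClass_add {A B C : Submodule R N} (hAB : A ≤ B) (hBC : B ≤ C)
    (h : IsFiniteLength R (SubQuot A C)) : relClass A C = relClass A B + relClass B C :=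
  grothClass_of_exact (subQuotInclusion_injective A hBC) (subQuotFactor_surjective hAB C)
    (subQuot_exact hAB hBC) h

/-- The second isomorphism theorem for subquotients. -/
noncomputable def subQuotInfEquivSup (A B : Submodule R N) :
    SubQuot (A ⊓ B) B ≃ₗ[R] SubQuot A (A ⊔ B) :=
  (Submodule.quotEquivOfEq _ _ (by simp)).trans
    ((LinearMap.quotientInfEquivSupQuotient B A).trans
      (Submodule.Quotient.equiv _ _ (LinearEquiv.ofEq _ _ (sup_comm B A)) (by
        ext ⟨y, hy⟩
        simp only [Submodule.mem_map, Submodule.mem_comap]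
        constructor
        · rintro ⟨x, hx, hxy⟩
          have : (x : N) = y := congrArg Subtype.val hxy
          simpa [← this] using hx
        · intro h
          exact ⟨⟨y, sup_comm A B ▸ hy⟩, h, rfl⟩)))

/-- `N / A` as a subquotient. -/
def subQuotTopEquiv (A : Submodule R N) : SubQuot A ⊤ ≃ₗ[R] (N ⧸ A) :=
  Submodule.Quotient.equiv _ _ Submodule.topEquiv (by
    ext y
    simp only [Submodule.mem_map, Submodule.mem_comap]
    exact ⟨fun ⟨x, hx, hxy⟩ => hxy ▸ hx, fun h => ⟨⟨y, trivial⟩, h, rfl⟩⟩)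

end Groth

/-! ### The functor `L ⊗_R -` -/

section IdealTensor

variable {R : Type u} [Ring R] (L : Ideal R) [L.IsTwoSided]
variable {A : Type v} [AddCommGroup A] [Module R A] {B : Type w} [AddCommGroup B] [Module R B]

/-- The pure tensor `x ⊗ a` in `L ⊗_R A`. -/
def idealTmul (x : L) (a : A) : IdealTensor L A := Submodule.Quotient.mk (x ⊗ₜ[ℤ] a)

theorem idealTmul_add (x : L) (a b : A) :
    idealTmul L x (a + b) = idealTmul L x a + idealTmul L x b := by
  simp only [idealTmul, TensorProduct.tmul_add, Submodule.Quotient.mk_add]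

theorem add_idealTmul (x y : L) (a : A) :
    idealTmul L (x + y) a = idealTmul L x a + idealTmul L y a := by
  simp only [idealTmul, TensorProduct.add_tmul, Submodule.Quotient.mk_add]

theorem idealTmul_zero (x : L) : idealTmul L x (0 : A) = 0 := by
  simp only [idealTmul, TensorProduct.tmul_zero, Submodule.Quotient.mk_zero]

theorem zero_idealTmul (a : A) : idealTmul L 0 a = 0 := by
  simp only [idealTmul, TensorProduct.zero_tmul, Submodule.Quotient.mk_zero]

theorem idealTmul_smul (x : L) (r : R) (a : A) :
    idealTmul L x (r • a) = idealTmul L ⟨x.1 * r, L.mul_mem_right r x.2⟩ a := by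
  refine Eq.symm ((Submodule.Quotient.eq _).mpr (Submodule.subset_span ⟨x, r, a, rfl⟩))

theorem smul_idealTmul (r : R) (x : L) (a : A) : r • idealTmul L x a = idealTmul L (r • x) a := rfl

theorem idealTensor_induction {motive : IdealTensor L A → Prop} (zero : motive 0)
    (tmul : ∀ x a, motive (idealTmul L x a)) (add : ∀ s t, motive s → motive t → motive (s + t))
    (t : IdealTensor L A) : motive t := by
  obtain ⟨t, rfl⟩ := Submodule.mkQ_surjective _ t
  induction t using TensorProduct.induction_on with
  | zero => simpa using zero
  | tmul x a => exact tmul x a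
  | add s t hs ht => rw [map_add]; exact add _ _ hs ht

@[simp]
theorem idealTensorMap_idealTmul (f : A →ₗ[R] B) (x : L) (a : A) :
    idealTensorMap L f (idealTmul L x a) = idealTmul L x (f a) := rfl

/-- The linear map on `L ⊗_R A` given by a balanced biadditive map. -/
def idealTensorLift (b : L → A →+ B) (h_add : ∀ x y a, b (x + y) a = b x a + b y a)
    (h_smul : ∀ (r : R) x a, b (r • x) a = r • b x a)
    (h_bal : ∀ x (r : R) a, b ⟨x.1 * r, L.mul_mem_right r x.2⟩ a = b x (r • a)) :
    IdealTensor L A →ₗ[R] B :=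
  Submodule.liftQ _ (TensorProduct.AlgebraTensorModule.lift
    { toFun := fun x => (b x).toIntLinearMap
      map_add' := fun x y => LinearMap.ext (h_add x y)
      map_smul' := fun r x => LinearMap.ext (h_smul r x) }) (by
    refine Submodule.span_le.mpr ?_
    rintro _ ⟨x, r, a, rfl⟩
    simp [h_bal])

@[simp]
theorem idealTensorLift_idealTmul (b : L → A →+ B) (h_add h_smul h_bal) (x : L) (a : A) :
    idealTensorLift L b h_add h_smul h_bal (idealTmul L x a) = b x a := rfl

variable (A) in
/-- The multiplication map `L ⊗_R A → A`. -/
def idealMul : IdealTensor L A →ₗ[R] A :=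
  idealTensorLift L (fun x => DistribSMul.toAddMonoidHom A x.1)
    (fun x y a => add_smul x.1 y.1 a) (fun r x a => mul_smul r x.1 a)
    (fun x r a => mul_smul x.1 r a)

@[simp]
theorem idealMul_idealTmul (x : L) (a : A) : idealMul L A (idealTmul L x a) = x.1 • a := rfl

theorem idealTensorMap_id : idealTensorMap L (LinearMap.id : A →ₗ[R] A) = LinearMap.id := by
  refine LinearMap.ext fun t => ?_
  induction t using idealTensor_induction with
  | zero => simp
  | tmul x a => simp
  | add s t hs ht => rw [map_add, map_add, hs, ht]

theorem idealTensorMap_comp_apply {C : Type*} [AddCommGroup C] [Module R C] (g : B →ₗ[R] C)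
    (f : A →ₗ[R] B) (t : IdealTensor L A) :
    idealTensorMap L (g ∘ₗ f) t = idealTensorMap L g (idealTensorMap L f t) := by
  induction t using idealTensor_induction with
  | zero => simp
  | tmul x a => simp
  | add s t hs ht => simp only [map_add, hs, ht]

theorem idealTensorMap_zero_apply (t : IdealTensor L A) :
    idealTensorMap L (0 : A →ₗ[R] B) t = 0 := by
  induction t using idealTensor_induction with
  | zero => simp
  | tmul x a => simp [idealTmul_zero]
  | add s t hs ht => rw [map_add, hs, ht, add_zero]

theorem idealMul_idealTensorMap (f : A →ₗ[R] B) (t : IdealTensor L A) :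
    idealMul L B (idealTensorMap L f t) = f (idealMul L A t) := by
  induction t using idealTensor_induction with
  | zero => simp
  | tmul x a => simp
  | add s t hs ht => simp only [map_add, hs, ht]

/-- An isomorphism `A ≃ B` induces `L ⊗_R A ≃ L ⊗_R B`. -/
def idealTensorCongr (e : A ≃ₗ[R] B) : IdealTensor L A ≃ₗ[R] IdealTensor L B :=
  LinearEquiv.ofLinearMap (idealTensorMap L e.toLinearMap) (idealTensorMap L e.symm.toLinearMap)
    (LinearMap.ext fun t => by
      rw [LinearMap.comp_apply, ← idealTensorMap_comp_apply]; simp [idealTensorMap_id])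
    (LinearMap.ext fun t => by
      rw [LinearMap.comp_apply, ← idealTensorMap_comp_apply]; simp [idealTensorMap_id])

theorem idealTensorMap_surjective {f : A →ₗ[R] B} (hf : Function.Surjective f) :
    Function.Surjective (idealTensorMap L f) := by
  intro t
  induction t using idealTensor_induction with
  | zero => exact ⟨0, map_zero _⟩
  | tmul x b =>
    obtain ⟨a, rfl⟩ := hf b
    exact ⟨idealTmul L x a, rfl⟩
  | add s t hs ht =>
    obtain ⟨s, rfl⟩ := hs
    obtain ⟨t, rfl⟩ := ht
    exact ⟨s + t, map_add _ _ _⟩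

theorem map_range_idealTensorMap (f : A →ₗ[R] B) :
    (LinearMap.range (idealTensorMap L f)).map (idealMul L B) = L • LinearMap.range f := by
  apply le_antisymm
  · rintro _ ⟨_, ⟨t, rfl⟩, rfl⟩
    induction t using idealTensor_induction with
    | zero => simp
    | tmul x a => exact Submodule.smul_mem_smul x.2 ⟨a, rfl⟩
    | add s t hs ht => rw [map_add, map_add]; exact Submodule.add_mem _ hs ht
  · refine Submodule.smul_le.mpr ?_
    rintro x hx _ ⟨a, rfl⟩
    exact ⟨_, ⟨idealTmul L ⟨x, hx⟩ a, rfl⟩, rfl⟩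

theorem range_idealMul : LinearMap.range (idealMul L A) = L • (⊤ : Submodule R A) := by
  have h := map_range_idealTensorMap L (LinearMap.id : A →ₗ[R] A)
  rwa [idealTensorMap_id, LinearMap.range_id, LinearMap.range_id, Submodule.map_top] at h

theorem map_range_idealMul (A' : Submodule R A) :
    (LinearMap.range (idealMul L A')).map A'.subtype = L • A' := by
  rw [range_idealMul, Submodule.map_smul'', Submodule.map_top, Submodule.range_subtype]

/-- Multiplication induces `L ⊗_R (A / C) → A / L C`. -/
def idealMulQuot (C : Submodule R A) : IdealTensor L (A ⧸ C) →ₗ[R] (A ⧸ L • C) :=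
  idealTensorLift L (fun x => QuotientAddGroup.lift C.toAddSubgroup
      ((L • C).mkQ.toAddMonoidHom.comp (DistribSMul.toAddMonoidHom A x.1)) (fun c hc =>
        (Submodule.Quotient.mk_eq_zero _).mpr (Submodule.smul_mem_smul x.2 hc)))
    (fun x y a => by
      obtain ⟨a, rfl⟩ := Submodule.mkQ_surjective _ a
      exact congrArg (L • C).mkQ (add_smul x.1 y.1 a))
    (fun r x a => by
      obtain ⟨a, rfl⟩ := Submodule.mkQ_surjective _ a
      exact congrArg (L • C).mkQ (mul_smul r x.1 a))
    (fun x r a => by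
      obtain ⟨a, rfl⟩ := Submodule.mkQ_surjective _ a
      exact congrArg (L • C).mkQ (mul_smul x.1 r a))

theorem idealMulQuot_mkQ (C : Submodule R A) (t : IdealTensor L A) :
    idealMulQuot L C (idealTensorMap L C.mkQ t) = (L • C).mkQ (idealMul L A t) := by
  induction t using idealTensor_induction with
  | zero => simp
  | tmul x a => rfl
  | add s t hs ht => simp only [map_add, hs, ht]

/-- If the product of `t` lies in `L • C`, it is also the product of an element coming from `L ⊗ C`.
Injectivity identifies the two elements, and `L ⊗ C` dies in `L ⊗ (A / C)`. -/
theorem ker_idealTensorMap_mkQ (h : Function.Injective (idealMul L A)) (C : Submodule R A) :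
    LinearMap.ker (idealTensorMap L C.mkQ) = (L • C).comap (idealMul L A) := by
  ext t
  rw [LinearMap.mem_ker, Submodule.mem_comap]
  constructor
  · intro ht
    have := idealMulQuot_mkQ L C t
    rw [ht, map_zero] at this
    exact (Submodule.Quotient.mk_eq_zero _).mp this.symm
  · intro ht
    have h1 := map_range_idealTensorMap L C.subtype
    rw [Submodule.range_subtype] at h1
    rw [← h1] at ht
    obtain ⟨_, ⟨s, rfl⟩, hs⟩ := ht
    rw [← h hs, ← idealTensorMap_comp_apply]
    have : C.mkQ ∘ₗ C.subtype = 0 := by ext x; simp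
    rw [this, idealTensorMap_zero_apply]

/-- If `L ⊗_R A → A` is injective, then `L ⊗_R (A / C) ≃ L A / L C`. -/
noncomputable def idealTensorSubQuot {P : Type v} [AddCommGroup P] [Module R P]
    (C A : Submodule R P) (hCA : C ≤ A) (h : Function.Injective (idealMul L A)) :
    IdealTensor L (SubQuot C A) ≃ₗ[R] SubQuot (L • C) (L • A) := by
  let g0 : IdealTensor L A →ₗ[R] (L • A : Submodule R P) :=
    (A.subtype ∘ₗ idealMul L A).codRestrict (L • A) fun t => by
      rw [← map_range_idealMul]
      exact ⟨_, ⟨t, rfl⟩, rfl⟩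
  have hg0 : Function.Surjective g0 := by
    rintro ⟨y, hy⟩
    have hy' := hy
    rw [← map_range_idealMul] at hy'
    obtain ⟨_, ⟨t, rfl⟩, ht⟩ := hy'
    exact ⟨t, Subtype.ext ht⟩
  let g : IdealTensor L A →ₗ[R] SubQuot (L • C) (L • A) := Submodule.mkQ _ ∘ₗ g0
  have hg : Function.Surjective g := (Submodule.mkQ_surjective _).comp hg0
  have hf := idealTensorMap_surjective L (Submodule.mkQ_surjective (C.comap A.subtype))
  -- Both sides are quotients of `L ⊗ A`, so it remains to compare two kernels.
  refine ((LinearMap.quotKerEquivOfSurjective _ hf).symm.trans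
    (Submodule.quotEquivOfEq _ _ ?_)).trans (LinearMap.quotKerEquivOfSurjective g hg)
  rw [ker_idealTensorMap_mkQ L h]
  ext t
  rw [LinearMap.mem_ker, Submodule.mem_comap]
  change _ ↔ Submodule.mkQ _ (g0 t) = 0
  rw [Submodule.mkQ_apply, Submodule.Quotient.mk_eq_zero]
  change _ ↔ A.subtype (idealMul L A t) ∈ L • C
  have h2 : L • C = (L • C.comap A.subtype).map A.subtype := by
    rw [Submodule.map_smul'', Submodule.map_comap_subtype, inf_eq_right.mpr hCA]
  rw [h2, Submodule.mem_map]
  constructor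
  · exact fun h => ⟨_, h, rfl⟩
  · rintro ⟨y, hy, hyt⟩
    rwa [← A.injective_subtype hyt]

/-- The direct sum of copies of `L` surjects onto `L ⊗ (κ →₀ R)` through `ψ`, and after
multiplication `ψ` becomes the coordinatewise inclusion, which is injective. -/
theorem idealMul_injective_of_free (κ : Type v) : Function.Injective (idealMul L (κ →₀ R)) := by
  let ψ : (κ →₀ L) →+ IdealTensor L (κ →₀ R) :=
    Finsupp.liftAddHom fun k =>
      { toFun := fun x => idealTmul L x (Finsupp.single k 1)
        map_zero' := zero_idealTmul L _
        map_add' := fun x y => add_idealTmul L x y _ }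
  have hψ : ∀ t, ∃ f, ψ f = t := by
    intro t
    induction t using idealTensor_induction with
    | zero => exact ⟨0, map_zero _⟩
    | tmul x a =>
      induction a using Finsupp.induction_linear with
      | zero => exact ⟨0, by rw [map_zero, idealTmul_zero]⟩
      | add f g hf hg =>
        obtain ⟨f', hf⟩ := hf
        obtain ⟨g', hg⟩ := hg
        exact ⟨f' + g', by rw [map_add, hf, hg, idealTmul_add]⟩
      | single k r =>
        refine ⟨Finsupp.single k ⟨x.1 * r, L.mul_mem_right r x.2⟩, ?_⟩
        have : Finsupp.single k r = r • Finsupp.single k (1 : R) := by simp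
        rw [this, idealTmul_smul]
        exact Finsupp.liftAddHom_apply_single _ _ _
    | add s t hs ht =>
      obtain ⟨s', hs⟩ := hs
      obtain ⟨t', ht⟩ := ht
      exact ⟨s' + t', by rw [map_add, hs, ht]⟩
  have hmul : ∀ f : κ →₀ L, idealMul L (κ →₀ R) (ψ f) = f.mapRange Subtype.val rfl := by
    intro f
    induction f using Finsupp.induction_linear with
    | zero => simp
    | add f g hf hg =>
      rw [map_add, map_add, hf, hg, Finsupp.mapRange_add fun _ _ => rfl]
    | single k x =>
      have : ψ (Finsupp.single k x) = idealTmul L x (Finsupp.single k 1) :=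
        Finsupp.liftAddHom_apply_single _ _ _
      rw [this]
      simp
  rw [injective_iff_map_eq_zero]
  intro t ht
  obtain ⟨f, rfl⟩ := hψ t
  rw [hmul] at ht
  have : f = 0 := by
    ext k
    simpa using DFunLike.congr_fun ht k
  rw [this, map_zero]

/-- A projective module is a retract of a free one, and multiplication is natural. -/
theorem idealMul_injective_of_projective [Module.Projective R A] :
    Function.Injective (idealMul L A) := by
  obtain ⟨s, hs⟩ := Module.projective_def'.mp (inferInstance : Module.Projective R A)
  rw [injective_iff_map_eq_zero]
  intro t ht
  have h1 : idealTensorMap L s t = 0 := by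
    apply idealMul_injective_of_free L A
    rw [idealMul_idealTensorMap, ht, map_zero, map_zero]
  have h2 := idealTensorMap_comp_apply L (Finsupp.linearCombination R id) s t
  rwa [h1, map_zero, hs, idealTensorMap_id] at h2

end IdealTensor

/-! ### Invertible ideals -/

section Invertible

variable {R : Type u} [Ring R] {I : Ideal R} [I.IsTwoSided] (hI : IsInvertibleIdeal I)
variable {A B : Type u} [AddCommGroup A] [Module R A] [AddCommGroup B] [Module R B]

/-- Every module is a quotient of a free module. -/
theorem exists_quotient_equiv (A : Type u) [AddCommGroup A] [Module R A] :
    ∃ Q : Submodule R (A →₀ R), Nonempty (((A →₀ R) ⧸ Q) ≃ₗ[R] A) :=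
  ⟨_, ⟨LinearMap.quotKerEquivOfSurjective (Finsupp.linearCombination R id)
    (Finsupp.linearCombination_id_surjective R A)⟩⟩

/-- A submodule `N` of `A ≃ P / Q` corresponds to a submodule of `P` containing `Q`. -/
theorem exists_subQuot_equiv {P : Type u} [AddCommGroup P] [Module R P] {Q : Submodule R P}
    (e : (P ⧸ Q) ≃ₗ[R] A) (N : Submodule R A) :
    ∃ W : Submodule R P, Q ≤ W ∧ Nonempty (SubQuot Q W ≃ₗ[R] N) ∧
      Nonempty (SubQuot W ⊤ ≃ₗ[R] (A ⧸ N)) := by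
  let f : P →ₗ[R] A := e.toLinearMap ∘ₗ Q.mkQ
  have hf : Function.Surjective f := e.surjective.comp Q.mkQ_surjective
  have hk : LinearMap.ker f = Q := by
    rw [LinearMap.ker_comp, LinearEquiv.ker, Submodule.comap_bot, Submodule.ker_mkQ]
  refine ⟨N.comap f, ?_, ⟨?_⟩, ⟨?_⟩⟩
  · rw [← hk]
    exact LinearMap.ker_le_comap f
  · let g : N.comap f →ₗ[R] N := f.restrict fun _ hx => hx
    have hg : Function.Surjective g := by
      rintro ⟨y, hy⟩
      obtain ⟨x, rfl⟩ := hf y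
      exact ⟨⟨x, hy⟩, rfl⟩
    refine (Submodule.quotEquivOfEq _ _ ?_).trans (g.quotKerEquivOfSurjective hg)
    ext ⟨y, hy⟩
    rw [Submodule.mem_comap, LinearMap.mem_ker, ← hk, LinearMap.mem_ker]
    exact (Subtype.ext_iff (a1 := g ⟨y, hy⟩) (a2 := 0)).symm
  · refine (subQuotTopEquiv _).trans ((Submodule.quotEquivOfEq _ _ ?_).trans
      ((N.mkQ ∘ₗ f).quotKerEquivOfSurjective (N.mkQ_surjective.comp hf)))
    rw [LinearMap.ker_comp, Submodule.ker_mkQ]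

include hI

theorem idealTensorMap_injective {f : A →ₗ[R] B} (hf : Function.Injective f) :
    Function.Injective (idealTensorMap I f) := by
  have : (idealTensorFunctor I).IsEquivalence := hI
  have : Mono (ModuleCat.ofHom f) := (ModuleCat.mono_iff_injective _).mpr hf
  exact (ModuleCat.mono_iff_injective _).mp
    (inferInstance : Mono ((idealTensorFunctor I).map (ModuleCat.ofHom f)))

/-- Faithfulness: the identity and the zero map of `A` have the same image under the functor. -/
theorem subsingleton_of_idealTensor (h : Subsingleton (IdealTensor I A)) : Subsingleton A := by
  have : (idealTensorFunctor I).IsEquivalence := hI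
  have h1 : (idealTensorFunctor I).map (𝟙 (ModuleCat.of R A)) =
      (idealTensorFunctor I).map (ModuleCat.ofHom 0) := by
    ext t
    exact @Subsingleton.elim _ h _ _
  have h2 := (idealTensorFunctor I).map_injective h1
  refine subsingleton_of_forall_eq 0 fun a => ?_
  exact congrArg (fun f : ModuleCat.of R A ⟶ ModuleCat.of R A => f.hom a) h2

theorem nonempty_equiv_of_idealTensor (e : IdealTensor I A ≃ₗ[R] IdealTensor I B) :
    Nonempty (A ≃ₗ[R] B) := by
  have : (idealTensorFunctor I).IsEquivalence := hI
  exact ⟨((idealTensorFunctor I).preimageIso (X := ModuleCat.of R A) (Y := ModuleCat.of R B)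
    (LinearEquiv.toModuleIso e)).toLinearEquiv⟩

/-- Essential surjectivity writes `Z` as `I ⊗ X`, and fullness makes its inclusion the image of a
map `X → A`; `W` is the range of that map. -/
theorem exists_range_idealTensorMap (Z : Submodule R (IdealTensor I A)) :
    ∃ W : Submodule R A, I • W = Z.map (idealMul I A) := by
  have : (idealTensorFunctor I).IsEquivalence := hI
  let F := idealTensorFunctor I
  let X := F.objPreimage (ModuleCat.of R Z)
  let i : F.obj X ≅ ModuleCat.of R Z := F.objObjPreimageIso _
  let j : ModuleCat.of R Z ⟶ F.obj (ModuleCat.of R A) := ModuleCat.ofHom Z.subtype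
  let g : X ⟶ ModuleCat.of R A := F.preimage (i.hom ≫ j)
  have hg : ∀ t, idealTensorMap I g.hom t = Z.subtype (i.toLinearEquiv t) := fun t =>
    congrArg (fun f : F.obj X ⟶ F.obj (ModuleCat.of R A) => f.hom t) (F.map_preimage (i.hom ≫ j))
  refine ⟨LinearMap.range g.hom, ?_⟩
  rw [← map_range_idealTensorMap]
  congr 1
  ext y
  constructor
  · rintro ⟨t, rfl⟩
    rw [hg]
    exact (i.toLinearEquiv t).2
  · intro hy
    obtain ⟨t, ht⟩ := i.toLinearEquiv.surjective ⟨y, hy⟩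
    exact ⟨t, (hg t).trans (congrArg Subtype.val ht)⟩

theorem exists_smul_eq {Z : Submodule R A} (hZ : Z ≤ I • ⊤) : ∃ W : Submodule R A, I • W = Z := by
  obtain ⟨W, hW⟩ := exists_range_idealTensorMap hI (Z.comap (idealMul I A))
  refine ⟨W, hW.trans ?_⟩
  rw [Submodule.map_comap_eq, range_idealMul, inf_eq_right.mpr hZ]

/-- `I ⊗ W → I ⊗ A` is injective as an equivalence preserves monomorphisms, and `I ⊗ A → A` is
injective by projectivity. Thus `idealTensorSubQuot` applies to all subquotients of a projective
module. -/
theorem idealMul_injective [Module.Projective R A] (W : Submodule R A) :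
    Function.Injective (idealMul I W) := by
  have h : W.subtype ∘ idealMul I W = idealMul I A ∘ idealTensorMap I W.subtype :=
    funext fun t => (idealMul_idealTensorMap I W.subtype t).symm
  refine Function.Injective.of_comp (f := W.subtype) ?_
  rw [h]
  exact (idealMul_injective_of_projective I).comp (idealTensorMap_injective hI W.injective_subtype)

/-- If `IV ≤ IW`, then `I ⊗ ((V + W) / W) ≃ I(V + W) / IW` vanishes, hence so does `(V + W) / W`.
With `exists_smul_eq`, this makes `W ↦ IW` an order isomorphism onto the submodules of `IA`. -/
theorem smul_le_smul_iff [Module.Projective R A] {V W : Submodule R A} :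
    I • V ≤ I • W ↔ V ≤ W := by
  refine ⟨fun h => ?_, fun h => Submodule.smul_mono le_rfl h⟩
  have h1 : I • (V ⊔ W) = I • W := by rw [Submodule.smul_sup, sup_eq_right.mpr h]
  have h2 : Subsingleton (SubQuot (I • W) (I • (V ⊔ W))) := by
    rw [h1, Submodule.Quotient.subsingleton_iff, Submodule.comap_subtype_self]
  have h3 := subsingleton_of_idealTensor hI ((idealTensorSubQuot I W (V ⊔ W) le_sup_right
    (idealMul_injective hI _)).toEquiv.subsingleton)
  rw [Submodule.Quotient.subsingleton_iff, Submodule.comap_subtype_eq_top] at h3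
  exact le_sup_left.trans h3

theorem smul_covBy_smul [Module.Projective R A] {V W : Submodule R A} (h : V ⋖ W) :
    I • V ⋖ I • W := by
  refine ⟨lt_of_le_not_ge (Submodule.smul_mono le_rfl h.le) fun h' =>
    h.lt.not_ge ((smul_le_smul_iff hI).mp h'), fun Z hVZ hZW => ?_⟩
  obtain ⟨Y, rfl⟩ := exists_smul_eq hI (hZW.le.trans (Submodule.smul_mono le_rfl le_top))
  have := fun V W : Submodule R A => smul_le_smul_iff hI (V := V) (W := W)
  rw [lt_iff_le_not_ge, this, this] at hVZ hZW
  exact h.2 (lt_iff_le_not_ge.mpr hVZ) (lt_iff_le_not_ge.mpr hZW)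

/-- A free presentation `A ≃ F / Q` turns simplicity into `Q ⋖ F`, which the order isomorphism
carries to `IQ ⋖ IF`. -/
theorem idealTensor_isSimpleModule [h : IsSimpleModule R A] :
    IsSimpleModule R (IdealTensor I A) := by
  obtain ⟨Q, ⟨e⟩⟩ := exists_quotient_equiv (R := R) A
  have hQ : IsSimpleModule R (SubQuot Q ⊤) :=
    ((subQuotTopEquiv Q).trans e).isSimpleModule_iff.mpr h
  have h1 := smul_covBy_smul hI ((covBy_iff_quot_is_simple le_top).mpr hQ)
  rw [covBy_iff_quot_is_simple h1.le] at h1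
  exact ((idealTensorCongr I ((subQuotTopEquiv Q).trans e).symm).trans (idealTensorSubQuot I Q ⊤
    le_top (idealMul_injective hI _))).isSimpleModule_iff.mpr h1

end Invertible

/-! ### Column modules represent the simple modules -/

section Column

variable {R : Type u} [Ring R] {ι : Type v} {K : ι → Type w} [∀ i, Field (K i)] {r : ι → ℕ}
  (e : (R ⧸ Ring.jacobson R) ≃+* ((i : ι) → Matrix (Fin (r i)) (Fin (r i)) (K i)))

theorem exists_lift (f : (i : ι) → Matrix (Fin (r i)) (Fin (r i)) (K i)) :
    ∃ a : R, e (Ideal.Quotient.mk _ a) = f := by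
  obtain ⟨a, ha⟩ := Ideal.Quotient.mk_surjective (e.symm f)
  exact ⟨a, by rw [ha, e.apply_symm_apply]⟩

/-- Column vectors as elements of `ColumnModule e i`. -/
def colEquiv (i : ι) : (Fin (r i) → K i) ≃+ ColumnModule e i := AddEquiv.refl _

theorem smul_colEquiv (i : ι) (a : R) (x : Fin (r i) → K i) :
    a • colEquiv e i x = colEquiv e i (Matrix.mulVec (e (Ideal.Quotient.mk _ a) i) x) := rfl

theorem jacobson_smul_eq_zero {S : Type*} [AddCommGroup S] [Module R S] [IsSemisimpleModule R S]
    {a : R} (ha : a ∈ Ring.jacobson R) (x : S) : a • x = 0 :=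
  Module.mem_annihilator.mp (IsSemisimpleModule.jacobson_le_annihilator R S ha) x

/-- The radical kills semisimple modules, so identities between matrices may be checked on arbitrary
lifts to `R`. -/
theorem smul_eq_of_lift_eq {S : Type*} [AddCommGroup S] [Module R S] [IsSemisimpleModule R S]
    {a b : R} (h : e (Ideal.Quotient.mk _ a) = e (Ideal.Quotient.mk _ b)) (x : S) :
    a • x = b • x := by
  rw [← sub_eq_zero, ← sub_smul]
  exact jacobson_smul_eq_zero (Ideal.Quotient.eq.mp (e.injective h)) x

theorem column_nontrivial (hr : ∀ i, 0 < r i) (i : ι) : Nontrivial (ColumnModule e i) :=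
  have : Nonempty (Fin (r i)) := ⟨⟨0, hr i⟩⟩
  (colEquiv e i).symm.toEquiv.nontrivial

theorem column_isSimpleModule (hr : ∀ i, 0 < r i) (i : ι) :
    IsSimpleModule R (ColumnModule e i) := by
  classical
  rw [isSimpleModule_iff_toSpanSingleton_surjective]
  refine ⟨column_nontrivial e hr i, fun x hx y => ?_⟩
  obtain ⟨x, rfl⟩ := (colEquiv e i).surjective x
  obtain ⟨y, rfl⟩ := (colEquiv e i).surjective y
  obtain ⟨k, hk⟩ : ∃ k : Fin (r i), x k ≠ 0 :=
    Function.ne_iff.mp (fun h => hx (by rw [h]; exact map_zero _))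
  -- The rank one matrix `y (x_k)⁻¹ e_kᵀ` sends `x` to `y`.
  obtain ⟨a, ha⟩ := exists_lift e (Pi.single i (Matrix.vecMulVec y (Pi.single k (x k)⁻¹)))
  refine ⟨a, ?_⟩
  rw [LinearMap.toSpanSingleton_apply, smul_colEquiv, ha, Pi.single_eq_same,
    Matrix.vecMulVec_mulVec, single_dotProduct, inv_mul_cancel₀ hk]
  simp

/-- A lift of the central idempotent of the `i`-th factor is the identity on the `i`-th column
module and zero on the others. -/
theorem column_injective (hr : ∀ i, 0 < r i) {i j : ι}
    (f : ColumnModule e i ≃ₗ[R] ColumnModule e j) : i = j := by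
  classical
  by_contra hij
  obtain ⟨a, ha⟩ := exists_lift e (Pi.single i 1)
  have := column_nontrivial e hr i
  obtain ⟨x, hx⟩ := exists_ne (0 : ColumnModule e i)
  apply hx
  apply f.injective
  have h1 : a • x = x := by
    obtain ⟨x, rfl⟩ := (colEquiv e i).surjective x
    rw [smul_colEquiv, ha, Pi.single_eq_same, Matrix.one_mulVec]
  rw [← h1, map_smul, map_zero]
  obtain ⟨y, hy⟩ := (colEquiv e j).surjective (f x)
  rw [← hy, smul_colEquiv, ha, Pi.single_eq_of_ne' hij, Matrix.zero_mulVec, map_zero]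

theorem exists_column_equiv [Fintype ι] {S : Type*} [AddCommGroup S] [Module R S]
    [IsSimpleModule R S] (hr : ∀ i, 0 < r i) : ∃ i, Nonempty (ColumnModule e i ≃ₗ[R] S) := by
  classical
  have := IsSimpleModule.nontrivial R S
  obtain ⟨x, hx⟩ := exists_ne (0 : S)
  choose l hl using exists_lift e
  let E (i : ι) (k : Fin (r i)) (v : Fin (r i) → K i) :
      (i : ι) → Matrix (Fin (r i)) (Fin (r i)) (K i) :=
    Pi.single i (Matrix.vecMulVec v (Pi.single k 1))
  -- The diagonal matrix units sum to `1`, so one of them does not kill `x`.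
  obtain ⟨i, k, hik⟩ : ∃ i, ∃ k : Fin (r i), l (E i k (Pi.single k 1)) • x ≠ 0 := by
    by_contra! h
    apply hx
    have h1 : (1 : R) • x = (∑ i, ∑ k, l (E i k (Pi.single k 1))) • x := by
      apply smul_eq_of_lift_eq e
      simp only [map_one, map_sum, hl]
      symm
      ext i : 1
      rw [Finset.sum_apply, Finset.sum_eq_single i]
      · simp only [E, Finset.sum_apply, Pi.single_eq_same]
        ext a b
        simp [Matrix.sum_apply, Matrix.vecMulVec_apply, Matrix.one_apply, Pi.single_apply]
      · intro j _ hj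
        simp [E, Finset.sum_apply, Pi.single_eq_of_ne' hj]
      · simp
    rw [← one_smul R x, h1]
    simp [Finset.sum_smul, h]
  generalize hy : l (E i k (Pi.single k 1)) • x = y at hik
  -- The column `v` acts through the matrix with `k`-th column `v` and zeros elsewhere. Left
  -- multiplication on such matrices is the action on `v`, whence linearity; Schur's lemma does the
  -- rest.
  let φ : ColumnModule e i →ₗ[R] S :=
    { toFun := fun v => l (E i k ((colEquiv e i).symm v)) • y
      map_add' := fun v w => by
        rw [← add_smul]
        apply smul_eq_of_lift_eq e
        rw [map_add (Ideal.Quotient.mk _), map_add e, hl, hl, hl, map_add (colEquiv e i).symm]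
        simp only [E]
        rw [← Pi.single_add, ← Matrix.add_vecMulVec]
      map_smul' := fun a v => by
        obtain ⟨v, rfl⟩ := (colEquiv e i).surjective v
        rw [RingHom.id_apply, ← mul_smul]
        apply smul_eq_of_lift_eq e
        rw [map_mul, map_mul, hl, hl, smul_colEquiv, AddEquiv.symm_apply_apply,
          AddEquiv.symm_apply_apply]
        ext j : 1
        by_cases hj : j = i
        · subst hj
          simp [E, Matrix.mul_vecMulVec]
        · simp [E, Pi.single_eq_of_ne hj] }
  have hφ : φ ≠ 0 := by
    intro h
    apply hik
    have h1 : φ (colEquiv e i (Pi.single k 1)) = y := by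
      change l (E i k ((colEquiv e i).symm (colEquiv e i (Pi.single k 1)))) • y = y
      rw [AddEquiv.symm_apply_apply, ← hy, ← mul_smul]
      apply smul_eq_of_lift_eq e
      rw [map_mul, map_mul, hl, ← Pi.single_mul, Matrix.vecMulVec_mul_vecMulVec]
      simp [E]
    rw [← h1, h, LinearMap.zero_apply]
  have := column_isSimpleModule e hr i
  exact ⟨i, ⟨LinearEquiv.ofBijective φ (LinearMap.bijective_of_ne_zero hφ)⟩⟩

/-- Since `v = (v e_kᵀ) e_k`, an endomorphism `f` sends `v` to `(v e_kᵀ) f(e_k) = f(e_k)_k v`, so it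
is a scalar. -/
theorem card_column_end (hr : ∀ i, 0 < r i) (i : ι) :
    Nat.card (ColumnModule e i →ₗ[R] ColumnModule e i) = Nat.card (K i) := by
  classical
  let k : Fin (r i) := ⟨0, hr i⟩
  let φ (c : K i) : ColumnModule e i →ₗ[R] ColumnModule e i :=
    { toFun := fun v => colEquiv e i (c • (colEquiv e i).symm v)
      map_add' := fun v w => by rw [map_add, smul_add, map_add]
      map_smul' := fun a v => by
        obtain ⟨v, rfl⟩ := (colEquiv e i).surjective v
        rw [RingHom.id_apply, smul_colEquiv, AddEquiv.symm_apply_apply,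
          AddEquiv.symm_apply_apply, smul_colEquiv, Matrix.mulVec_smul] }
  have hφ : ∀ c v, φ c (colEquiv e i v) = colEquiv e i (c • v) := fun _ _ => rfl
  refine (Nat.card_congr (Equiv.ofBijective φ ⟨fun c d h => ?_, fun f => ?_⟩)).symm
  · have h1 := LinearMap.congr_fun h (colEquiv e i (Pi.single k 1))
    rw [hφ, hφ] at h1
    simpa using congrFun ((colEquiv e i).injective h1) k
  · obtain ⟨y, hy⟩ := (colEquiv e i).surjective (f (colEquiv e i (Pi.single k 1)))
    refine ⟨y k, LinearMap.ext fun v => ?_⟩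
    obtain ⟨v, rfl⟩ := (colEquiv e i).surjective v
    obtain ⟨a, ha⟩ := exists_lift e (Pi.single i (Matrix.vecMulVec v (Pi.single k 1)))
    have h1 : a • colEquiv e i (Pi.single k 1) = colEquiv e i v := by
      rw [smul_colEquiv, ha, Pi.single_eq_same, Matrix.vecMulVec_mulVec]
      simp
    rw [hφ, ← h1, f.map_smul, ← hy, smul_colEquiv, ha, Pi.single_eq_same, Matrix.vecMulVec_mulVec]
    simp

/-- The class of the `i`-th column module. -/
noncomputable def colClass (hr : ∀ i, 0 < r i) (i : ι) : SimpleClass R :=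
  simpleClass R (ColumnModule e i) (column_isSimpleModule e hr i)

theorem colClass_bijective [Fintype ι] (hr : ∀ i, 0 < r i) :
    Function.Bijective (colClass e hr) := by
  refine ⟨fun i j h => ?_, fun c => ?_⟩
  · obtain ⟨f⟩ := (simpleClass_eq_iff _ _).mp h
    exact column_injective e hr f
  · obtain ⟨m, rfl⟩ := Quotient.exists_rep c
    have hm : IsSimpleModule R (R ⧸ m.1) := isSimpleModule_iff_isCoatom.mpr m.2.out
    obtain ⟨i, ⟨f⟩⟩ := exists_column_equiv e (S := R ⧸ m.1) hr
    refine ⟨i, ((simpleClass_eq_iff _ hm).mpr ⟨f⟩).trans ?_⟩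
    refine Quotient.eq.mpr ?_
    exact ⟨((isSimpleModule_iff_quot_maximal.mp hm).choose_spec.2.some).symm⟩

/-- The multiplicity of the `i`-th simple module as a composition factor of `B`. -/
noncomputable def mult (hr : ∀ i, 0 < r i) (B : Type*) [AddCommGroup B] [Module R B] (i : ι) : ℕ :=
  grothClass R B (colClass e hr i)

theorem isFiniteLength_of_finite (B : Type*) [AddCommGroup B] [Module R B] [Finite B] :
    IsFiniteLength R B :=
  isFiniteLength_iff_isNoetherian_isArtinian.mpr ⟨inferInstance, inferInstance⟩

theorem column_finite [∀ i, Finite (K i)] (i : ι) : Finite (ColumnModule e i) :=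
  inferInstanceAs (Finite (Fin (r i) → K i))

include e in
theorem finite_of_isFiniteLength [Fintype ι] [∀ i, Finite (K i)] (hr : ∀ i, 0 < r i) {B : Type*}
    [AddCommGroup B] [Module R B] (h : IsFiniteLength R B) : Finite B := by
  induction h with
  | of_subsingleton => infer_instance
  | @of_simple_quotient B _ _ N _ _ ih =>
    obtain ⟨i, ⟨f⟩⟩ := exists_column_equiv e (S := B ⧸ N) hr
    have := column_finite e i
    have : Finite (B ⧸ N) := Finite.of_equiv _ f.toEquiv
    have : Finite (B ⧸ N.toAddSubgroup) := this
    have : Finite N.toAddSubgroup := ih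
    exact Finite.of_equiv _ (AddSubgroup.addGroupEquivQuotientProdAddSubgroup
      (s := N.toAddSubgroup)).symm

/-! ### Multiplicities of the simple modules -/

section mult

variable (hr : ∀ i, 0 < r i)

theorem mult_congr {B C : Type*} [AddCommGroup B] [Module R B] [AddCommGroup C] [Module R C]
    [Finite B] (f : B ≃ₗ[R] C) : mult e hr B = mult e hr C := by
  ext i
  rw [mult, mult, grothClass_congr f (isFiniteLength_of_finite B)]

theorem mult_eq_add {B : Type*} [AddCommGroup B] [Module R B] [Finite B] (N : Submodule R B) :
    mult e hr B = mult e hr N + mult e hr (B ⧸ N) := by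
  ext i
  simp only [mult, Pi.add_apply]
  rw [grothClass_eq_add N (isFiniteLength_of_finite B), Finsupp.add_apply]

theorem mult_of_subsingleton {B : Type*} [AddCommGroup B] [Module R B] [Subsingleton B] :
    mult e hr B = 0 := by
  ext i
  rw [mult, grothClass_of_subsingleton]
  rfl

open Classical in
theorem mult_of_equiv_column {B : Type*} [AddCommGroup B] [Module R B] {i : ι}
    (f : ColumnModule e i ≃ₗ[R] B) : mult e hr B = Pi.single i 1 := by
  have hs := column_isSimpleModule e hr i
  have hB : IsSimpleModule R B := f.isSimpleModule_iff.mp hs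
  ext j
  rw [mult, grothClass_simple hB, (simpleClass_eq_iff hB hs).mpr ⟨f.symm⟩, Finsupp.single_apply,
    Pi.single_apply]
  refine if_congr ⟨fun h => ?_, fun h => ?_⟩ rfl rfl
  · obtain ⟨g⟩ := (simpleClass_eq_iff _ _).mp h
    exact (column_injective e hr g).symm
  · rw [h]
    rfl

theorem relClass_colClass {P : Type*} [AddCommGroup P] [Module R P] (A B : Submodule R P) (i : ι) :
    relClass A B (colClass e hr i) = mult e hr (SubQuot A B) i := rfl

theorem mult_subQuot_add {P : Type*} [AddCommGroup P] [Module R P] {A B C : Submodule R P}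
    (hAB : A ≤ B) (hBC : B ≤ C) [Finite (SubQuot A C)] :
    mult e hr (SubQuot A C) = mult e hr (SubQuot A B) + mult e hr (SubQuot B C) := by
  ext i
  rw [← relClass_colClass, relClass_add hAB hBC (isFiniteLength_of_finite _)]
  rfl

theorem mult_eq_zero_iff [Fintype ι] {B : Type*} [AddCommGroup B] [Module R B] [Finite B] :
    mult e hr B = 0 ↔ Subsingleton B := by
  refine ⟨fun h => ?_, fun _ => mult_of_subsingleton e hr⟩
  by_contra hB
  have hB' : Nontrivial B := not_subsingleton_iff_nontrivial.mp hB
  obtain ⟨N, hN, -⟩ := (eq_top_or_exists_le_coatom (⊥ : Submodule R B)).resolve_left bot_ne_top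
  have := isSimpleModule_iff_isCoatom.mpr hN
  obtain ⟨i, ⟨f⟩⟩ := exists_column_equiv e (S := B ⧸ N) hr
  have h1 := congrFun (mult_eq_add e hr N) i
  rw [h, mult_of_equiv_column e hr f] at h1
  simp at h1

/-- No finiteness is needed: without a composition series the default class `0` makes both sides
`1`. -/
theorem dirClass_eq_prod [Fintype ι] (B : Type*) [AddCommGroup B] [Module R B] :
    dirClass R B = ∏ i, zVar e i ^ mult e hr B i := by
  classical
  have hz : ∀ i, zVar e i = MvPowerSeries.monomial (Finsupp.single (colClass e hr i) 1) (1 : ℂ) := by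
    intro i
    rw [zVar, dirClass, grothClass_simple (column_isSimpleModule e hr i)]
    rfl
  have key : ∀ s : Finset ι, ∏ i ∈ s, zVar e i ^ mult e hr B i = MvPowerSeries.monomial
      (∑ i ∈ s, mult e hr B i • Finsupp.single (colClass e hr i) 1) (1 : ℂ) := by
    intro s
    induction s using Finset.induction_on with
    | empty => simp
    | insert i s hi ih =>
      rw [Finset.prod_insert hi, Finset.sum_insert hi, ih, hz, MvPowerSeries.monomial_pow,
        MvPowerSeries.monomial_mul_monomial, one_pow, one_mul]
  have hg : ∑ i, mult e hr B i • Finsupp.single (colClass e hr i) 1 = grothClass R B := by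
    refine Finsupp.ext fun c => ?_
    obtain ⟨j, rfl⟩ := (colClass_bijective e hr).2 c
    simp [Finsupp.single_apply, (colClass_bijective e hr).1.eq_iff, mult]
  rw [key, dirClass, hg]

end mult

end Column

/-! ### Counting homomorphisms -/

section HomCount

variable {R : Type u} [Ring R]

theorem card_hom_congr {A A' B B' : Type*} [AddCommGroup A] [Module R A] [AddCommGroup A']
    [Module R A'] [AddCommGroup B] [Module R B] [AddCommGroup B'] [Module R B'] (f : A ≃ₗ[R] A')
    (g : B ≃ₗ[R] B') : Nat.card (A →ₗ[R] B) = Nat.card (A' →ₗ[R] B') :=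
  Nat.card_congr (f.arrowCongrAddEquiv g).toEquiv

theorem card_hom_quotient {A C : Type*} [AddCommGroup A] [Module R A] [AddCommGroup C] [Module R C]
    (N : Submodule R A) (h : ∀ f : A →ₗ[R] C, N ≤ LinearMap.ker f) :
    Nat.card ((A ⧸ N) →ₗ[R] C) = Nat.card (A →ₗ[R] C) :=
  Nat.card_congr
    { toFun := fun f => f ∘ₗ N.mkQ
      invFun := fun f => N.liftQ f (h f)
      left_inv := fun _ => Submodule.linearMap_qext _ (Submodule.liftQ_mkQ _ _ _)
      right_inv := fun _ => Submodule.liftQ_mkQ _ _ _ }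

theorem card_hom_projective_eq_mul {P B : Type*} [AddCommGroup P] [Module R P]
    [Module.Projective R P] [AddCommGroup B] [Module R B] (N : Submodule R B) :
    Nat.card (P →ₗ[R] B) = Nat.card (P →ₗ[R] N) * Nat.card (P →ₗ[R] (B ⧸ N)) := by
  let φ : (P →ₗ[R] B) →+ (P →ₗ[R] (B ⧸ N)) :=
    { toFun := fun f => N.mkQ ∘ₗ f
      map_zero' := LinearMap.comp_zero _
      map_add' := fun f g => LinearMap.comp_add _ _ _ }
  have hφ : Function.Surjective φ := fun g =>
    Module.projective_lifting_property N.mkQ g N.mkQ_surjective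
  have hmem : ∀ f : P →ₗ[R] B, f ∈ φ.ker ↔ ∀ x, f x ∈ N := fun f => by
    rw [AddMonoidHom.mem_ker]
    change N.mkQ ∘ₗ f = 0 ↔ _
    simp [LinearMap.ext_iff]
  have h1 : Nat.card φ.ker = Nat.card (P →ₗ[R] N) := Nat.card_congr
    { toFun := fun f => f.1.codRestrict N ((hmem f.1).mp f.2)
      invFun := fun f => ⟨N.subtype ∘ₗ f, (hmem _).mpr fun x => (f x).2⟩
      left_inv := fun _ => rfl
      right_inv := fun _ => rfl }
  rw [AddSubgroup.card_eq_card_quotient_mul_card_addSubgroup φ.ker, h1, mul_comm,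
    Nat.card_congr (QuotientAddGroup.quotientKerEquivOfSurjective φ hφ).toEquiv]

theorem card_hom_semisimple_eq_mul {V S : Type*} [AddCommGroup V] [Module R V]
    [IsSemisimpleModule R V] [AddCommGroup S] [Module R S] (N : Submodule R V) :
    Nat.card (V →ₗ[R] S) = Nat.card (N →ₗ[R] S) * Nat.card ((V ⧸ N) →ₗ[R] S) := by
  obtain ⟨C, hC⟩ := exists_isCompl N
  rw [card_hom_congr (Submodule.quotientEquivOfIsCompl N C hC) (LinearEquiv.refl R S),
    card_hom_congr (Submodule.prodEquivOfIsCompl N C hC).symm (LinearEquiv.refl R S),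
    ← Nat.card_prod]
  exact Nat.card_congr (LinearMap.coprodEquiv ℕ).toEquiv.symm

variable {ι : Type v} [Fintype ι] {K : ι → Type w} [∀ i, Field (K i)] [∀ i, Finite (K i)]
  {r : ι → ℕ} (hr : ∀ i, 0 < r i)
  (e : (R ⧸ Ring.jacobson R) ≃+* ((i : ι) → Matrix (Fin (r i)) (Fin (r i)) (K i)))

omit [Fintype ι] [∀ i, Finite (K i)] in
include hr in
theorem card_column_hom [DecidableEq ι] (i j : ι) :
    Nat.card (ColumnModule e j →ₗ[R] ColumnModule e i) = if j = i then Nat.card (K i) else 1 := by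
  have hi := column_isSimpleModule e hr i
  have hj := column_isSimpleModule e hr j
  split_ifs with h
  · subst h
    exact card_column_end e hr j
  · have : Subsingleton (ColumnModule e j →ₗ[R] ColumnModule e i) := by
      refine subsingleton_of_forall_eq 0 fun f => ?_
      by_contra hf
      exact h (column_injective e hr (LinearEquiv.ofBijective f (LinearMap.bijective_of_ne_zero hf)))
    exact Nat.card_of_subsingleton 0

theorem card_hom_column {V : Type*} [AddCommGroup V] [Module R V] [IsSemisimpleModule R V]
    [Finite V] (i : ι) :
    Nat.card (V →ₗ[R] ColumnModule e i) = Nat.card (K i) ^ mult e hr V i := by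
  classical
  have hfl := isFiniteLength_of_finite (R := R) V
  rename_i hss hfin
  clear hfin
  revert hss
  induction hfl with
  | of_subsingleton =>
    intro _
    rw [mult_of_subsingleton, Pi.zero_apply, pow_zero]
    exact Nat.card_of_subsingleton 0
  | @of_simple_quotient V _ _ N _ hN ih =>
    intro _
    have : Finite V := finite_of_isFiniteLength e hr (.of_simple_quotient hN)
    obtain ⟨j, ⟨f⟩⟩ := exists_column_equiv e (S := V ⧸ N) hr
    rw [card_hom_semisimple_eq_mul N, ih, mult_eq_add e hr N, Pi.add_apply, pow_add,
      mult_of_equiv_column e hr f, card_hom_congr f.symm (LinearEquiv.refl R _),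
      card_column_hom hr, Pi.single_apply]
    congr 1
    by_cases h : j = i
    · simp [h]
    · simp [h, Ne.symm h]

theorem jacobson_smul_top_le_ker {A S : Type*} [AddCommGroup A] [Module R A] [AddCommGroup S]
    [Module R S] [IsSemisimpleModule R S] (f : A →ₗ[R] S) :
    Ring.jacobson R • (⊤ : Submodule R A) ≤ LinearMap.ker f := by
  refine Submodule.smul_le.mpr fun a ha x _ => ?_
  rw [LinearMap.mem_ker, map_smul]
  exact jacobson_smul_eq_zero ha _

/-- `Hom(P, -)` is exact, so the count is multiplicative along a composition series of `B`; maps to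
a simple module factor through `P / JP`. For `P = M` this is the source of the weights `q_i ^ m_i`.
-/
theorem card_hom_projective {P : Type*} [AddCommGroup P] [Module R P] [Module.Projective R P]
    [IsSemisimpleModule R (P ⧸ Ring.jacobson R • (⊤ : Submodule R P))]
    [Finite (P ⧸ Ring.jacobson R • (⊤ : Submodule R P))] (B : Type*) [AddCommGroup B] [Module R B]
    [Finite B] :
    Nat.card (P →ₗ[R] B) = ∏ i, (Nat.card (K i) ^
      mult e hr (P ⧸ Ring.jacobson R • (⊤ : Submodule R P)) i) ^ mult e hr B i := by
  classical
  have hfl := isFiniteLength_of_finite (R := R) B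
  rename_i hfin
  clear hfin
  induction hfl with
  | @of_subsingleton B _ _ _ =>
    rw [mult_of_subsingleton e hr (B := B)]
    simp
  | @of_simple_quotient B _ _ N _ hN ih =>
    have : Finite B := finite_of_isFiniteLength e hr (.of_simple_quotient hN)
    obtain ⟨j, ⟨f⟩⟩ := exists_column_equiv e (S := B ⧸ N) hr
    have hj := column_isSimpleModule e hr j
    rw [card_hom_projective_eq_mul N, ih, mult_eq_add e hr N,
      mult_of_equiv_column e hr f, card_hom_congr (LinearEquiv.refl R _) f.symm,
      ← card_hom_quotient (Ring.jacobson R • (⊤ : Submodule R P)) jacobson_smul_top_le_ker,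
      card_hom_column hr]
    simp only [Pi.add_apply, pow_add, Finset.prod_mul_distrib]
    congr 1
    rw [Finset.prod_eq_single j]
    · simp
    · intro i _ hi
      simp [hi]
    · simp

/-- The multiplicity is the exponent of `q_j` in the number of homomorphisms to the `j`-th column
module; it is determined because `q_j > 1`. -/
theorem mult_pi_column (m : ι → ℕ) :
    mult e hr ((i : ι) → Fin (m i) → ColumnModule e i) = m := by
  classical
  have hs := column_isSimpleModule e hr
  have hf := column_finite e
  ext j
  have h := card_hom_column hr e (V := (i : ι) → Fin (m i) → ColumnModule e i) j
  rw [← Nat.card_congr (LinearMap.lsum R (fun i => Fin (m i) → ColumnModule e i) ℕ).toEquiv,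
    Nat.card_pi] at h
  have h2 : ∀ i, Nat.card ((Fin (m i) → ColumnModule e i) →ₗ[R] ColumnModule e j) =
      if i = j then Nat.card (K j) ^ m j else 1 := by
    intro i
    rw [← Nat.card_congr (LinearMap.lsum R (fun _ : Fin (m i) => ColumnModule e i) ℕ).toEquiv,
      Nat.card_pi]
    simp only [card_column_hom hr, Finset.prod_const, Finset.card_univ, Fintype.card_fin]
    split_ifs with h
    · rw [h]
    · simp
  simp only [h2] at h
  rw [Finset.prod_ite_eq' Finset.univ j, if_pos (Finset.mem_univ j)] at h
  exact (Nat.pow_right_injective (Finite.one_lt_card (α := K j)) h).symm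

end HomCount

/-! ### The permutation of the simple modules induced by an invertible ideal -/

section Perm

variable {R : Type u} [Ring R]
variable {ι : Type v} [Fintype ι] {K : ι → Type w} [∀ i, Field (K i)] [∀ i, Finite (K i)]
  {r : ι → ℕ} (hr : ∀ i, 0 < r i)
  (e : (R ⧸ Ring.jacobson R) ≃+* ((i : ι) → Matrix (Fin (r i)) (Fin (r i)) (K i)))

theorem finite_of_ker_of_range {A B : Type*} [AddCommGroup A] [Module R A] [AddCommGroup B]
    [Module R B] (f : A →ₗ[R] B) [Finite B] (h : Finite (LinearMap.ker f)) : Finite A := by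
  have h1 : Finite (A ⧸ LinearMap.ker f) := Finite.of_equiv _ f.quotKerEquivRange.symm.toEquiv
  have h1' : Finite (A ⧸ (LinearMap.ker f).toAddSubgroup) := h1
  have h2 : Finite (LinearMap.ker f).toAddSubgroup := h
  exact Finite.of_equiv _ (AddSubgroup.addGroupEquivQuotientProdAddSubgroup
    (s := (LinearMap.ker f).toAddSubgroup)).symm

theorem finite_subQuot_trans {P : Type*} [AddCommGroup P] [Module R P] {A B C : Submodule R P}
    (hAB : A ≤ B) (hBC : B ≤ C) [Finite (SubQuot A B)] [Finite (SubQuot B C)] :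
    Finite (SubQuot A C) := by
  refine finite_of_ker_of_range (subQuotFactor hAB C) ?_
  rw [(subQuot_exact hAB hBC).linearMap_ker_eq]
  exact Finite.of_surjective _ (subQuotInclusion A hBC).surjective_rangeRestrict

theorem idealMul_top_injective {P : Type*} [AddCommGroup P] [Module R P] [Module.Projective R P]
    (L : Ideal R) [L.IsTwoSided] : Function.Injective (idealMul L (⊤ : Submodule R P)) :=
  have := Module.Projective.of_equiv (Submodule.topEquiv (R := R) (M := P)).symm
  idealMul_injective_of_projective L

variable {I : Ideal R} [I.IsTwoSided] (hI : IsInvertibleIdeal I)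
include hI

omit [∀ i, Finite (K i)] in
include hr in
theorem exists_perm : ∃ σ : Equiv.Perm ι, ∀ i,
    Nonempty (IdealTensor I (ColumnModule e i) ≃ₗ[R] ColumnModule e (σ i)) := by
  -- The column modules live in the universe of `K`, while invertibility concerns modules in the
  -- universe of `R`; quotients of `R` represent them there.
  have h1 : ∀ i, ∃ m : Ideal R, IsSimpleModule R (R ⧸ m) ∧
      Nonempty (ColumnModule e i ≃ₗ[R] (R ⧸ m)) := fun i => by
    obtain ⟨m, hm, he⟩ := isSimpleModule_iff_quot_maximal.mp (column_isSimpleModule e hr i)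
    exact ⟨m, isSimpleModule_iff_isCoatom.mpr hm.out, he⟩
  choose m hm hf using h1
  have h2 : ∀ i, ∃ j, Nonempty (ColumnModule e j ≃ₗ[R] IdealTensor I (R ⧸ m i)) := fun i =>
    have := idealTensor_isSimpleModule hI (A := R ⧸ m i)
    exists_column_equiv e hr
  choose s hs using h2
  have hinj : Function.Injective s := fun i j hij => by
    obtain ⟨gi⟩ := hs i
    obtain ⟨gj⟩ := hs j
    rw [hij] at gi
    obtain ⟨g⟩ := nonempty_equiv_of_idealTensor hI (gi.symm.trans gj)
    exact column_injective e hr (((hf i).some.trans g).trans (hf j).some.symm)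
  refine ⟨Equiv.ofBijective s (Finite.injective_iff_bijective.mp hinj), fun i => ?_⟩
  exact ⟨(idealTensorCongr I (hf i).some).trans (hs i).some.symm⟩

variable {σ : Equiv.Perm ι}
  (hσ : ∀ i, Nonempty (IdealTensor I (ColumnModule e i) ≃ₗ[R] ColumnModule e (σ i)))
include hσ

theorem mult_idealTensor (B : Type u) [AddCommGroup B] [Module R B] [Finite B] :
    Finite (IdealTensor I B) ∧ ∀ i, mult e hr (IdealTensor I B) (σ i) = mult e hr B i := by
  classical
  have hfl := isFiniteLength_of_finite (R := R) B
  rename_i hfin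
  clear hfin
  induction hfl with
  | @of_subsingleton B _ _ _ =>
    have : Subsingleton (IdealTensor I B) := by
      refine subsingleton_of_forall_eq 0 fun t => ?_
      induction t using idealTensor_induction with
      | zero => rfl
      | tmul x a => rw [Subsingleton.elim a 0, idealTmul_zero]
      | add s t hs ht => rw [hs, ht, add_zero]
    exact ⟨inferInstance, fun i => by rw [mult_of_subsingleton, mult_of_subsingleton]; rfl⟩
  | @of_simple_quotient B _ _ N _ hN ih =>
    have : Finite B := finite_of_isFiniteLength e hr (.of_simple_quotient hN)
    obtain ⟨j, ⟨f⟩⟩ := exists_column_equiv e (S := B ⧸ N) hr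
    -- A free presentation turns `N ≤ B` into a chain `Q ≤ W ≤ F`. The tensor products become
    -- subquotients of `IQ ≤ IW ≤ IF`, so additivity applies.
    obtain ⟨Q, ⟨g⟩⟩ := exists_quotient_equiv (R := R) B
    obtain ⟨W, hQW, ⟨g1⟩, ⟨g2⟩⟩ := exists_subQuot_equiv g N
    let h0 := (idealTensorCongr I ((subQuotTopEquiv Q).trans g).symm).trans
      (idealTensorSubQuot I Q ⊤ le_top (idealMul_injective hI _))
    let h1 := (idealTensorCongr I g1.symm).trans
      (idealTensorSubQuot I Q W hQW (idealMul_injective hI _))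
    let h2 := ((hσ j).some.symm.trans (idealTensorCongr I (f.trans g2.symm))).trans
      (idealTensorSubQuot I W ⊤ le_top (idealMul_injective hI _))
    have hQW' : I • Q ≤ I • W := Submodule.smul_mono le_rfl hQW
    have hWT' : I • W ≤ I • ⊤ := Submodule.smul_mono le_rfl le_top
    have := column_finite e (σ j)
    have := ih.1
    have : Finite (SubQuot (I • Q) (I • W)) := Finite.of_equiv _ h1.toEquiv
    have : Finite (SubQuot (I • W) (I • ⊤)) := Finite.of_equiv _ h2.toEquiv
    have : Finite (SubQuot (I • Q) (I • ⊤)) := finite_subQuot_trans hQW' hWT'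
    refine ⟨Finite.of_equiv _ h0.symm.toEquiv, fun i => ?_⟩
    rw [← mult_congr e hr h0.symm, mult_subQuot_add e hr hQW' hWT', ← mult_congr e hr h1,
      mult_of_equiv_column e hr h2, mult_eq_add e hr N, Pi.add_apply, Pi.add_apply, ih.2,
      mult_of_equiv_column e hr f]
    congr 1
    by_cases h : i = j
    · simp [h]
    · simp [h]

-- For `B ≃ F / Q` with `F` free, both sides are `I ^ (k + 1) F / I ^ (k + 1) Q`.
omit hσ in
theorem exists_pow_idealTensor_equiv (B : Type u) [AddCommGroup B] [Module R B] (k : ℕ) :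
    Nonempty (IdealTensor (I ^ (k + 1)) B ≃ₗ[R] IdealTensor I (IdealTensor (I ^ k) B)) := by
  obtain ⟨Q, ⟨g⟩⟩ := exists_quotient_equiv (R := R) B
  have h : ∀ k, Nonempty (IdealTensor (I ^ k) B ≃ₗ[R] SubQuot (I ^ k • Q) (I ^ k • ⊤)) := fun k =>
    ⟨(idealTensorCongr _ ((subQuotTopEquiv Q).trans g).symm).trans
      (idealTensorSubQuot _ Q ⊤ le_top (idealMul_top_injective _))⟩
  obtain ⟨h1⟩ := h k
  obtain ⟨h2⟩ := h (k + 1)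
  have h3 := idealTensorSubQuot I (I ^ k • Q) (I ^ k • ⊤) (Submodule.smul_mono le_rfl le_top)
    (idealMul_injective hI _)
  rw [← Submodule.mul_smul, ← Submodule.mul_smul, ← Ideal.IsTwoSided.pow_succ] at h3
  exact ⟨(h2.trans h3.symm).trans (idealTensorCongr I h1.symm)⟩

omit hI hσ in
theorem exists_zero_pow_idealTensor_equiv (B : Type u) [AddCommGroup B] [Module R B] :
    Nonempty (IdealTensor (I ^ 0) B ≃ₗ[R] B) := by
  obtain ⟨Q, ⟨g⟩⟩ := exists_quotient_equiv (R := R) B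
  have h : IdealTensor (I ^ 0) B ≃ₗ[R] SubQuot (I ^ 0 • Q) (I ^ 0 • ⊤) :=
    (idealTensorCongr _ ((subQuotTopEquiv Q).trans g).symm).trans
      (idealTensorSubQuot _ Q ⊤ le_top (idealMul_top_injective _))
  have hz : ∀ Q : Submodule R (B →₀ R), I ^ 0 • Q = Q := fun Q => by
    rw [Submodule.pow_zero, Ideal.one_eq_top, Submodule.top_smul]
  rw [hz, hz] at h
  exact ⟨(h.trans (subQuotTopEquiv Q)).trans g⟩

theorem mult_pow_idealTensor (B : Type u) [AddCommGroup B] [Module R B] [Finite B] (k : ℕ) :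
    Finite (IdealTensor (I ^ k) B) ∧
      ∀ i, mult e hr (IdealTensor (I ^ k) B) ((σ ^ k) i) = mult e hr B i := by
  induction k with
  | zero =>
    obtain ⟨f⟩ := exists_zero_pow_idealTensor_equiv (I := I) B
    exact ⟨Finite.of_equiv _ f.symm.toEquiv, fun i => by rw [mult_congr e hr f.symm]; rfl⟩
  | succ k ih =>
    obtain ⟨f⟩ := exists_pow_idealTensor_equiv hI B k
    have := ih.1
    have h := mult_idealTensor hr e hI hσ (IdealTensor (I ^ k) B)
    have := h.1
    exact ⟨Finite.of_equiv _ f.symm.toEquiv, fun i => by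
      rw [← mult_congr e hr f.symm, pow_succ', Equiv.Perm.mul_apply, h.2, ih.2]⟩

-- For `x ∈ I` and `y ∈ I ^ k`, the product `x y` lies in `I * I ^ k = I ^ k * I`. It can thus be
-- rewritten with the factor from `I` on the right, which moves across the tensor sign and kills
-- `b`.
omit hI hσ in
theorem smul_pow_idealTensor_eq_zero {B : Type*} [AddCommGroup B] [Module R B]
    (hB : ∀ x ∈ I, ∀ b : B, x • b = 0) (k : ℕ) {x : R} (hx : x ∈ I)
    (t : IdealTensor (I ^ k) B) : x • t = 0 := by
  induction t using idealTensor_induction with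
  | zero => simp
  | add s t hs ht => rw [smul_add, hs, ht, add_zero]
  | tmul y b =>
    have key : ∀ z ∈ I ^ k * I, ∃ h : z ∈ I ^ k, idealTmul (I ^ k) ⟨z, h⟩ b = 0 := by
      intro z hz
      induction hz using Submodule.mul_induction_on' with
      | mem_mul_mem y hy x hx =>
        refine ⟨Ideal.mul_mem_right _ _ hy, ?_⟩
        rw [← idealTmul_smul (I ^ k) ⟨y, hy⟩ x b, hB x hx, idealTmul_zero]
      | add y hy z hz h1 h2 =>
        obtain ⟨h1, h1'⟩ := h1
        obtain ⟨h2, h2'⟩ := h2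
        refine ⟨add_mem h1 h2, ?_⟩
        have := add_idealTmul (I ^ k) ⟨y, h1⟩ ⟨z, h2⟩ b
        rw [h1', h2', add_zero] at this
        exact this
    rw [smul_idealTmul]
    obtain ⟨_, h⟩ := key (x * y.1) (by
      rw [← Submodule.pow_succ, Ideal.IsTwoSided.pow_succ]
      exact Ideal.mul_mem_mul hx y.2)
    exact h

end Perm

instance finite_quotient {R : Type*} [Ring R] {B : Type*} [AddCommGroup B] [Module R B] [Finite B]
    (N : Submodule R B) : Finite (B ⧸ N) :=
  Finite.of_surjective _ N.mkQ_surjective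

/-! ### Counting relative complements -/

section Complements

variable {R : Type u} [Ring R] {A : Type v} [AddCommGroup A] [Module R A] {L K Y : Submodule R A}

theorem subQuotFactor_mk {B : Submodule R A} (h : L ≤ K) (x : B) :
    subQuotFactor h B (Submodule.Quotient.mk x) = Submodule.Quotient.mk x := rfl

theorem subQuot_mk_eq_zero {B C : Submodule R A} (x : C) :
    (Submodule.Quotient.mk x : SubQuot B C) = 0 ↔ (x : A) ∈ B :=
  Submodule.Quotient.mk_eq_zero _

/-- The submodule attached to a section of `Y / L → Y / K`. -/
def sectionSubmodule (s : SubQuot K Y →ₗ[R] SubQuot L Y) : Submodule R A :=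
  ((LinearMap.range s).comap (Submodule.mkQ _)).map Y.subtype

theorem mem_sectionSubmodule {s : SubQuot K Y →ₗ[R] SubQuot L Y} {x : A} :
    x ∈ sectionSubmodule s ↔ ∃ (h : x ∈ Y) (c : SubQuot K Y), s c = Submodule.Quotient.mk ⟨x, h⟩ := by
  constructor
  · rintro ⟨⟨x, h⟩, ⟨c, hc⟩, rfl⟩
    exact ⟨h, c, hc⟩
  · rintro ⟨h, c, hc⟩
    exact ⟨⟨x, h⟩, ⟨c, hc⟩, rfl⟩

/-- Such `X` are the sections of `Y / L → Y / K`. Given one section `s₀`, these form a torsor under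
homomorphisms to the kernel `K / L`. -/
theorem card_relative_complements (hLK : L ≤ K) (hKY : K ≤ Y)
    (s₀ : SubQuot K Y →ₗ[R] SubQuot L Y) (hs₀ : ∀ c, subQuotFactor hLK Y (s₀ c) = c) :
    Nat.card {X : Submodule R A // X ⊓ K = L ∧ X ⊔ K = Y} =
      Nat.card (SubQuot K Y →ₗ[R] SubQuot L K) := by
  let Sec := {s : SubQuot K Y →ₗ[R] SubQuot L Y // ∀ c, subQuotFactor hLK Y (s c) = c}
  have hX : ∀ s : Sec, sectionSubmodule s.1 ⊓ K = L ∧ sectionSubmodule s.1 ⊔ K = Y := by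
    rintro ⟨s, hs⟩
    constructor
    · ext x
      rw [Submodule.mem_inf, mem_sectionSubmodule]
      constructor
      · rintro ⟨⟨hx, c, hc⟩, hxK⟩
        have h1 := hs c
        rw [hc, subQuotFactor_mk, (subQuot_mk_eq_zero _).mpr hxK] at h1
        rw [← h1, map_zero] at hc
        exact (subQuot_mk_eq_zero _).mp hc.symm
      · intro hx
        exact ⟨⟨hKY (hLK hx), 0, by rw [map_zero]; exact ((subQuot_mk_eq_zero _).mpr hx).symm⟩,
          hLK hx⟩
    · apply le_antisymm
      · refine sup_le (fun x hx => ?_) hKY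
        exact (mem_sectionSubmodule.mp hx).1
      · intro y hy
        obtain ⟨x, hx⟩ := Submodule.Quotient.mk_surjective _ (s (Submodule.Quotient.mk ⟨y, hy⟩))
        have h1 := hs (Submodule.Quotient.mk ⟨y, hy⟩)
        rw [← hx, subQuotFactor_mk, eq_comm, Submodule.Quotient.eq] at h1
        have h2 : x.1 ∈ sectionSubmodule s := mem_sectionSubmodule.mpr ⟨x.2, _, hx.symm⟩
        have h3 : y - x.1 ∈ K := h1
        have := Submodule.add_mem_sup h2 h3
        rwa [add_sub_cancel] at this
  let Φ : Sec → {X : Submodule R A // X ⊓ K = L ∧ X ⊔ K = Y} := fun s => ⟨_, hX s⟩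
  have hΦ : Function.Bijective Φ := by
    constructor
    · rintro ⟨s, hs⟩ ⟨s', hs'⟩ h
      have h0 : sectionSubmodule s = sectionSubmodule s' := congrArg Subtype.val h
      refine Subtype.ext (LinearMap.ext fun c => ?_)
      change s c = s' c
      obtain ⟨x, hx⟩ := Submodule.Quotient.mk_surjective _ (s c)
      have h1 : x.1 ∈ sectionSubmodule s := mem_sectionSubmodule.mpr ⟨x.2, _, hx.symm⟩
      rw [h0, mem_sectionSubmodule] at h1
      obtain ⟨_, c', hc'⟩ := h1
      have hcc : c = c' := by rw [← hs c, ← hs' c', ← hx, hc']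
      rw [← hx, hcc, hc']
    · rintro ⟨X, hXL, hXY⟩
      have hLX : L ≤ X := hXL ▸ inf_le_left
      have hXY' : X ≤ Y := hXY ▸ le_sup_left
      let g : SubQuot L X →ₗ[R] SubQuot K Y := subQuotFactor hLK Y ∘ₗ subQuotInclusion L hXY'
      have hgm : ∀ x : X, g (Submodule.Quotient.mk x) =
        Submodule.Quotient.mk ⟨x.1, hXY' x.2⟩ := fun x => rfl
      have hg : Function.Bijective g := by
        constructor
        · rw [injective_iff_map_eq_zero]
          intro c hc
          obtain ⟨x, rfl⟩ := Submodule.Quotient.mk_surjective _ c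
          rw [hgm, subQuot_mk_eq_zero] at hc
          rw [subQuot_mk_eq_zero, ← hXL]
          exact ⟨x.2, hc⟩
        · intro c
          obtain ⟨⟨y, hy⟩, rfl⟩ := Submodule.Quotient.mk_surjective _ c
          have hy' := hy
          rw [← hXY, Submodule.mem_sup] at hy'
          obtain ⟨x, hx, k, hk, rfl⟩ := hy'
          refine ⟨Submodule.Quotient.mk ⟨x, hx⟩, ?_⟩
          rw [hgm, Submodule.Quotient.eq]
          change x - (x + k) ∈ K
          simpa using hk
      let G := LinearEquiv.ofBijective g hg
      refine ⟨⟨subQuotInclusion L hXY' ∘ₗ G.symm.toLinearMap, fun c => G.apply_symm_apply c⟩, ?_⟩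
      refine Subtype.ext ?_
      ext x
      change x ∈ sectionSubmodule _ ↔ x ∈ X
      rw [mem_sectionSubmodule]
      constructor
      · rintro ⟨hx, c, hc⟩
        obtain ⟨y, hy⟩ := Submodule.Quotient.mk_surjective _ (G.symm c)
        have h1 : subQuotInclusion L hXY' (G.symm c) = Submodule.Quotient.mk ⟨x, hx⟩ := hc
        rw [← hy] at h1
        have h2 := (Submodule.Quotient.eq _).mp h1.symm
        have h3 : x - y.1 ∈ L := h2
        simpa using X.add_mem (hLX h3) y.2
      · intro hx
        refine ⟨hXY' hx, G (Submodule.Quotient.mk ⟨x, hx⟩), ?_⟩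
        change subQuotInclusion L hXY' (G.symm (G _)) = _
        rw [G.symm_apply_apply]
        rfl
  rw [← Nat.card_congr (Equiv.ofBijective Φ hΦ)]
  have hex := subQuot_exact hLK hKY
  -- Translation of `s₀` by homomorphisms into the kernel.
  let Ψ : (SubQuot K Y →ₗ[R] SubQuot L K) → Sec := fun f =>
    ⟨s₀ + subQuotInclusion L hKY ∘ₗ f, fun c => by
      rw [LinearMap.add_apply, map_add, hs₀, LinearMap.comp_apply, hex.apply_apply_eq_zero,
        add_zero]⟩
  refine (Nat.card_congr (Equiv.ofBijective Ψ ⟨fun f f' h => ?_, fun s => ?_⟩)).symm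
  · have h0 := congrArg Subtype.val h
    have h1 : subQuotInclusion L hKY ∘ₗ f = subQuotInclusion L hKY ∘ₗ f' := add_left_cancel h0
    exact LinearMap.ext fun c => subQuotInclusion_injective L hKY (LinearMap.congr_fun h1 c)
  · have h1 : ∀ c, (s.1 - s₀) c ∈ LinearMap.range (subQuotInclusion L hKY) := fun c => by
      rw [← hex.linearMap_ker_eq, LinearMap.mem_ker, LinearMap.sub_apply, map_sub, s.2, hs₀,
        sub_self]
    let E := LinearEquiv.ofInjective _ (subQuotInclusion_injective L hKY)
    refine ⟨E.symm.toLinearMap ∘ₗ (s.1 - s₀).codRestrict _ h1, Subtype.ext ?_⟩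
    refine LinearMap.ext fun c => ?_
    change s₀ c + (E (E.symm ⟨(s.1 - s₀) c, h1 c⟩) : SubQuot L Y) = s.1 c
    rw [E.apply_symm_apply]
    simp

end Complements

/-! ### Semisimple modules -/

section Hey

variable {R : Type u} [Ring R]
variable {ι : Type v} [Fintype ι] {K : ι → Type w} [∀ i, Field (K i)] [∀ i, Finite (K i)]
  {r : ι → ℕ} (hr : ∀ i, 0 < r i)
  (e : (R ⧸ Ring.jacobson R) ≃+* ((i : ι) → Matrix (Fin (r i)) (Fin (r i)) (K i)))
  {D : Type*} [CommRing D]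

/-- The term of the inverse zeta function attached to a semisimple quotient of class `c`. -/
noncomputable def heyTerm (K : ι → Type w) (a : ι → D) (c : ι → ℕ) : D :=
  ∏ i, (-a i) ^ c i * (Nat.card (K i) : D) ^ (c i).choose 2

omit [∀ i, Field (K i)] [∀ i, Finite (K i)] in
theorem heyTerm_add_single [DecidableEq ι] (a : ι → D) (c : ι → ℕ) (i : ι) :
    heyTerm K a (c + Pi.single i 1) = heyTerm K a c * (-a i * (Nat.card (K i) : D) ^ c i) := by
  rw [heyTerm, heyTerm, ← Finset.mul_prod_erase _ _ (Finset.mem_univ i),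
    ← Finset.mul_prod_erase (a := i) Finset.univ (fun i => (-a i) ^ c i * _) (Finset.mem_univ i)]
  have h : ∏ x ∈ Finset.univ.erase i, (-a x) ^ (c + Pi.single i 1 : ι → ℕ) x *
      (Nat.card (K x) : D) ^ ((c + Pi.single i 1 : ι → ℕ) x).choose 2 =
      ∏ x ∈ Finset.univ.erase i, (-a x) ^ c x * (Nat.card (K x) : D) ^ (c x).choose 2 := by
    refine Finset.prod_congr rfl fun j hj => ?_
    simp [Finset.ne_of_mem_erase hj]
  rw [h]
  simp only [Pi.add_apply, Pi.single_eq_same]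
  rw [Nat.choose_succ_succ' (c i) 1, Nat.choose_one_right]
  ring

-- A `q`-binomial theorem for several simple types, by induction on `U`: removing a simple submodule
-- `S` of type `i` splits off the last factor `1 - q_i ^ μ_i(U/S) * a_i`. At `a = 1` the terms act
-- as Möbius values, because the product vanishes unless `U = 0`.
open Classical in
theorem sum_heyTerm (a : ι → D) (U : Type*) [AddCommGroup U] [Module R U] [IsSemisimpleModule R U]
    [Finite U] [Fintype (Submodule R U)] :
    ∑ Y : Submodule R U, heyTerm K a (mult e hr (U ⧸ Y)) =
      ∏ i, ∏ j ∈ Finset.range (mult e hr U i), (1 - (Nat.card (K i) : D) ^ j * a i) := by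
  induction hn : Nat.card U using Nat.strong_induction_on generalizing U with
  | _ n ih =>
  subst hn
  rcases subsingleton_or_nontrivial U with hU | hU
  · have : ∀ Y : Submodule R U, heyTerm K a (mult e hr (U ⧸ Y)) = 1 := fun Y => by
      have : Subsingleton (U ⧸ Y) := Y.mkQ_surjective.subsingleton
      rw [mult_of_subsingleton]
      simp [heyTerm]
    rw [mult_of_subsingleton]
    simp [this]
  · obtain ⟨S, hS, -⟩ := (eq_bot_or_exists_atom_le (⊤ : Submodule R U)).resolve_left top_ne_bot
    have hSs : IsSimpleModule R S := isSimpleModule_iff_isAtom.mpr hS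
    obtain ⟨i, ⟨f⟩⟩ := exists_column_equiv e (S := S) hr
    have : Fintype (Submodule R (U ⧸ S)) := Fintype.ofFinite _
    have hcard : Nat.card (U ⧸ S) < Nat.card U := by
      have := IsSimpleModule.nontrivial R S
      rw [Submodule.card_eq_card_quotient_mul_card S]
      exact lt_mul_of_one_lt_left Nat.card_pos Finite.one_lt_card
    have gS : SubQuot ⊥ S ≃ₗ[R] S := Submodule.quotEquivOfEqBot _ (by
      rw [Submodule.comap_bot, Submodule.ker_subtype])
    have hih := ih _ hcard (U ⧸ S) rfl
    have hmU : mult e hr U = mult e hr (U ⧸ S) + Pi.single i 1 := by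
      rw [mult_eq_add e hr S, mult_of_equiv_column e hr f, add_comm]
    have hrhs : ∏ i, ∏ j ∈ Finset.range (mult e hr U i), (1 - (Nat.card (K i) : D) ^ j * a i) =
        (∏ i, ∏ j ∈ Finset.range (mult e hr (U ⧸ S) i), (1 - (Nat.card (K i) : D) ^ j * a i)) *
          (1 - (Nat.card (K i) : D) ^ (mult e hr (U ⧸ S) i) * a i) := by
      rw [← Finset.mul_prod_erase _ _ (Finset.mem_univ i), ← Finset.mul_prod_erase (a := i)
        Finset.univ (fun i => ∏ j ∈ Finset.range (mult e hr (U ⧸ S) i), _) (Finset.mem_univ i), hmU]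
      have h : ∏ x ∈ Finset.univ.erase i, ∏ j ∈ Finset.range
          ((mult e hr (U ⧸ S) + Pi.single i 1 : ι → ℕ) x), (1 - (Nat.card (K x) : D) ^ j * a x) =
          ∏ x ∈ Finset.univ.erase i, ∏ j ∈ Finset.range (mult e hr (U ⧸ S) x),
            (1 - (Nat.card (K x) : D) ^ j * a x) := by
        refine Finset.prod_congr rfl fun j hj => ?_
        simp [Finset.ne_of_mem_erase hj]
      rw [h]
      simp only [Pi.add_apply, Pi.single_eq_same, Finset.prod_range_succ]
      ring
    -- The submodules `Y` are grouped by their image `Z` in `U / S`. With `Y'` the preimage of `Z`,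
    -- either `Y = Y'` or `Y` is a complement of `S` in `Y'`.
    rw [hrhs, ← hih, Finset.sum_mul, ← Finset.sum_fiberwise (Finset.univ : Finset (Submodule R U))
      (fun Y => Y.map S.mkQ)]
    refine Finset.sum_congr rfl fun Z _ => ?_
    set Y' := Z.comap S.mkQ with hY'
    have hSY' : S ≤ Y' := by
      rw [hY']
      exact (Submodule.ker_mkQ S).symm.le.trans (LinearMap.ker_le_comap _)
    have hmap : ∀ Y : Submodule R U, Y.map S.mkQ = Z ↔ Y ⊔ S = Y' := fun Y => by
      rw [hY']
      constructor
      · rintro rfl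
        rw [Submodule.comap_map_mkQ, sup_comm]
      · intro h
        have h2 := congrArg (Submodule.map S.mkQ) h
        rw [Submodule.map_sup, Submodule.map_comap_eq_of_surjective S.mkQ_surjective,
          Submodule.mkQ_map_self, sup_bot_eq] at h2
        exact h2
    have hsplit : (Finset.univ.filter fun Y : Submodule R U => Y.map S.mkQ = Z) =
        insert Y' (Finset.univ.filter fun Y : Submodule R U => Y ⊓ S = ⊥ ∧ Y ⊔ S = Y') := by
      ext Y
      simp only [Finset.mem_filter, Finset.mem_univ, true_and, Finset.mem_insert, hmap]
      constructor
      · intro h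
        rcases hS.le_iff.mp (inf_le_right : Y ⊓ S ≤ S) with h1 | h1
        · exact Or.inr ⟨h1, h⟩
        · rw [sup_eq_left.mpr (inf_eq_right.mp h1)] at h
          exact Or.inl h
      · rintro (rfl | ⟨-, h⟩)
        · exact sup_eq_left.mpr hSY'
        · exact h
    have hnot : Y' ∉ Finset.univ.filter fun Y : Submodule R U => Y ⊓ S = ⊥ ∧ Y ⊔ S = Y' := by
      simp only [Finset.mem_filter, Finset.mem_univ, true_and, not_and]
      intro h
      rw [inf_eq_right.mpr hSY'] at h
      exact absurd h hS.1
    rw [hsplit, Finset.sum_insert hnot]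
    have hq : (U ⧸ Y') ≃ₗ[R] ((U ⧸ S) ⧸ Z) :=
      (Submodule.quotEquivOfEq _ _ (by rw [LinearMap.ker_comp, Submodule.ker_mkQ])).trans
        ((Z.mkQ ∘ₗ S.mkQ).quotKerEquivOfSurjective (Z.mkQ_surjective.comp S.mkQ_surjective))
    have hterm : ∀ Y ∈ Finset.univ.filter fun Y : Submodule R U => Y ⊓ S = ⊥ ∧ Y ⊔ S = Y',
        heyTerm K a (mult e hr (U ⧸ Y)) = heyTerm K a (mult e hr ((U ⧸ S) ⧸ Z) + Pi.single i 1) := by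
      intro Y hY
      obtain ⟨hY1, hY2⟩ := (Finset.mem_filter.mp hY).2
      rw [← mult_congr e hr hq, mult_congr e hr (subQuotTopEquiv Y).symm,
        mult_congr e hr (subQuotTopEquiv Y').symm,
        mult_subQuot_add e hr (le_sup_left : Y ≤ Y ⊔ S) le_top, hY2, add_comm]
      congr 2
      have g := subQuotInfEquivSup Y S
      rw [hY1, hY2] at g
      rw [← mult_congr e hr g, mult_congr e hr gS,
        mult_of_equiv_column e hr f]
    -- The exponent `μ_i(Y'/S)` and the factor `q_i ^ μ_i((U/S)/Z)` from `heyTerm_add_single`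
    -- combine to `q_i ^ μ_i(U/S)`, which is independent of `Z`.
    have hcount : Nat.card {Y : Submodule R U // Y ⊓ S = ⊥ ∧ Y ⊔ S = Y'} =
        Nat.card (K i) ^ mult e hr (SubQuot S Y') i := by
      obtain ⟨C, hC⟩ := exists_isCompl (LinearMap.ker (subQuotFactor (bot_le : ⊥ ≤ S) Y'))
      let E := LinearMap.quotKerEquivOfSurjective _ (subQuotFactor_surjective (bot_le : ⊥ ≤ S) Y')
      let s₀ := C.subtype ∘ₗ (Submodule.quotientEquivOfIsCompl _ C hC).toLinearMap ∘ₗ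
        E.symm.toLinearMap
      rw [card_relative_complements bot_le hSY' s₀ ?_, ← card_hom_column hr e,
        card_hom_congr (LinearEquiv.refl R (SubQuot S Y')) (f.trans gS.symm)]
      intro c
      obtain ⟨d, rfl⟩ := E.surjective c
      change subQuotFactor bot_le Y'
        (C.subtype (Submodule.quotientEquivOfIsCompl _ C hC (E.symm (E d)))) = E d
      rw [E.symm_apply_apply]
      exact congrArg E (Submodule.mk_quotientEquivOfIsCompl_apply hC d)
    rw [Finset.sum_congr rfl hterm, Finset.sum_const, ← Fintype.card_subtype,
      ← Nat.card_eq_fintype_card, hcount, mult_congr e hr hq, heyTerm_add_single, nsmul_eq_mul]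
    have hadd : mult e hr (U ⧸ S) i = mult e hr (SubQuot S Y') i + mult e hr ((U ⧸ S) ⧸ Z) i := by
      rw [← mult_congr e hr hq, mult_congr e hr (subQuotTopEquiv S).symm,
        mult_congr e hr (subQuotTopEquiv Y').symm, mult_subQuot_add e hr hSY' le_top]
      rfl
    rw [hadd, pow_add]
    push_cast
    ring

end Hey

open Filter

/-! ### Formal convergence -/

section Topology

open MvPowerSeries MvPowerSeries.WithPiTopology

variable {τ k : Type*} [TopologicalSpace k] [DiscreteTopology k] [Field k]

theorem mvPowerSeries_isTopologicalRing : IsTopologicalRing (MvPowerSeries τ k) :=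
  inferInstance

omit [Field k] in
theorem mvPowerSeries_t3Space : T3Space (MvPowerSeries τ k) :=
  inferInstanceAs (T3Space ((τ →₀ ℕ) → k))

omit [DiscreteTopology k] in
theorem mvPowerSeries_summable {α : Type*} {f : α → MvPowerSeries τ k}
    (h : ∀ d, {x | coeff d (f x) ≠ 0}.Finite) : Summable f :=
  summable_iff_summable_coeff.mpr fun d => summable_of_hasFiniteSupport (h d)

/-- Below degree `n` only the term at `x₀` has coefficients. Taken at the full module, where the
term is `1`, it shows that zeta functions with weights of high order are close to `1`. -/
theorem mvPowerSeries_le_order_sub {α : Type*} {f : α → MvPowerSeries τ k} {s : MvPowerSeries τ k}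
    (hs : HasSum f s) (x₀ : α) {n : ℕ} (h : ∀ x, x ≠ x₀ → (n : ℕ∞) ≤ (f x).order) :
    (n : ℕ∞) ≤ (s - f x₀).order := by
  refine le_order fun d hd => ?_
  have h1 := hasSum_iff_hasSum_coeff.mp hs d
  have h2 : HasSum (fun x => coeff d (f x)) (coeff d (f x₀)) :=
    hasSum_single x₀ fun x hx => coeff_of_lt_order (hd.trans_le (h x hx))
  rw [map_sub, h1.unique h2, sub_self]

omit [DiscreteTopology k] in
theorem mvPowerSeries_multipliable {g : ℕ → MvPowerSeries τ k}
    (h : ∀ n : ℕ, (n : ℕ∞) ≤ (g n - 1).order) : Multipliable g := by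
  have h1 : Multipliable (fun n => 1 + (g n - 1)) := by
    refine multipliable_one_add_of_tendsto_order_atTop_nhds_top ?_
    rw [ENat.tendsto_nhds_top_iff_natCast_lt]
    intro n
    filter_upwards [eventually_gt_atTop n] with m hm
    exact (Nat.cast_lt.mpr hm).trans_le (h m)
  simpa using h1

omit [DiscreteTopology k] in
theorem mvPowerSeries_tendsto_one {g : ℕ → MvPowerSeries τ k}
    (h : ∀ n : ℕ, (n : ℕ∞) ≤ (g n - 1).order) : Tendsto g atTop (nhds 1) := by
  rw [tendsto_iff_coeff_tendsto]
  intro d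
  refine tendsto_const_nhds.congr' ?_
  filter_upwards [eventually_gt_atTop d.degree] with n hn
  have := coeff_of_lt_order (f := g n - 1) (d := d) ((Nat.cast_lt.mpr hn).trans_le (h n))
  rw [map_sub, sub_eq_zero] at this
  exact this.symm

end Topology

/-! ### Specialisation to `Dir R`, with the discrete topology on `ℂ` supplied explicitly in place of
the usual one -/

section Dir

variable {R : Type u} [Ring R]

instance dir_isTopologicalRing : IsTopologicalRing (Dir R) :=
  @mvPowerSeries_isTopologicalRing (SimpleClass R) ℂ ⊥ (@DiscreteTopology.mk _ ⊥ rfl) _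

instance dir_t3Space : T3Space (Dir R) :=
  @mvPowerSeries_t3Space (SimpleClass R) ℂ ⊥ (@DiscreteTopology.mk _ ⊥ rfl)

theorem dir_summable {α : Type*} {f : α → Dir R}
    (h : ∀ d, {x | MvPowerSeries.coeff d (f x) ≠ 0}.Finite) : Summable f :=
  @mvPowerSeries_summable (SimpleClass R) ℂ ⊥ _ α f h

theorem dir_le_order_sub {α : Type*} {f : α → Dir R} {s : Dir R}
    (hs : HasSum f s) (x₀ : α) {n : ℕ} (h : ∀ x, x ≠ x₀ → (n : ℕ∞) ≤ (f x).order) :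
    (n : ℕ∞) ≤ (s - f x₀).order :=
  @mvPowerSeries_le_order_sub (SimpleClass R) ℂ ⊥ (@DiscreteTopology.mk _ ⊥ rfl) _ α f s hs x₀ n h

theorem dir_multipliable {g : ℕ → Dir R} (h : ∀ n : ℕ, (n : ℕ∞) ≤ (g n - 1).order) :
    Multipliable g :=
  @mvPowerSeries_multipliable (SimpleClass R) ℂ ⊥ _ g h

theorem dir_tendsto_one {g : ℕ → Dir R} (h : ∀ n : ℕ, (n : ℕ∞) ≤ (g n - 1).order) :
    Tendsto g atTop (nhds 1) :=
  @mvPowerSeries_tendsto_one (SimpleClass R) ℂ ⊥ _ g h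

end Dir

/-! ### Submodules of finite colength -/

section Colength

variable {R : Type u} [Ring R]

theorem finite_quotient_jacobson (hR : Finite (R ⧸ Ring.jacobson R)) (C : Type v) [AddCommGroup C]
    [Module R C] [Module.Finite R C] : Finite (C ⧸ Ring.jacobson R • (⊤ : Submodule R C)) := by
  obtain ⟨n, f, hf⟩ := Module.Finite.exists_fin' R C
  let N := Ring.jacobson R • (⊤ : Submodule R C)
  refine Finite.of_surjective
    (fun v : Fin n → R ⧸ Ring.jacobson R => N.mkQ (f fun i => (v i).out)) fun y => ?_
  obtain ⟨y, rfl⟩ := N.mkQ_surjective y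
  obtain ⟨x, rfl⟩ := hf y
  refine ⟨fun i => Ideal.Quotient.mk _ (x i), ?_⟩
  refine (Submodule.Quotient.eq _).mpr ?_
  rw [← map_sub, LinearMap.pi_apply_eq_sum_univ f]
  refine Submodule.sum_mem _ fun i _ => Submodule.smul_mem_smul ?_ trivial
  exact Ideal.Quotient.eq.mp (Quotient.out_eq' _)

theorem jacobson_smul_top_le_of_isCoatom {C : Type v} [AddCommGroup C] [Module R C]
    {X : Submodule R C} (hX : IsCoatom X) : Ring.jacobson R • (⊤ : Submodule R C) ≤ X := by
  have := isSimpleModule_iff_isCoatom.mpr hX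
  simpa using jacobson_smul_top_le_ker X.mkQ

theorem eq_top_of_sup_jacobson {C : Type v} [AddCommGroup C] [Module R C] [Module.Finite R C]
    {X : Submodule R C} (h : X ⊔ Ring.jacobson R • ⊤ = ⊤) : X = ⊤ := by
  by_contra hX
  obtain ⟨Y, hY, hXY⟩ := (eq_top_or_exists_le_coatom X).resolve_left hX
  exact hY.1 (top_le_iff.mp (h ▸ sup_le hXY (jacobson_smul_top_le_of_isCoatom hY)))

/-- Products of left generators of the radical with generators of `C` suffice: in `a • (b • c)` the
scalar `a b` is again in the two-sided radical. -/
theorem jacobson_smul_top_fg (hJ : (Ring.jacobson R).FG) (C : Type v) [AddCommGroup C] [Module R C]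
    [Module.Finite R C] : (Ring.jacobson R • (⊤ : Submodule R C)).FG := by
  classical
  obtain ⟨t, ht⟩ := hJ
  obtain ⟨s, hs⟩ := (Module.Finite.fg_top : (⊤ : Submodule R C).FG)
  refine ⟨Finset.image₂ (fun a c => a • c) t s, le_antisymm ?_ ?_⟩
  · rw [Submodule.span_le]
    intro x hx
    obtain ⟨a, ha, c, -, rfl⟩ := Finset.mem_image₂.mp hx
    exact Submodule.smul_mem_smul (ht ▸ Submodule.subset_span ha) trivial
  · refine Submodule.smul_le.mpr fun a ha c hc => ?_
    rw [← hs] at hc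
    induction hc using Submodule.span_induction generalizing a with
    | zero => rw [smul_zero]; exact Submodule.zero_mem _
    | add x y _ _ hx hy => rw [smul_add]; exact Submodule.add_mem _ (hx a ha) (hy a ha)
    | smul b x _ hx => rw [← mul_smul]; exact hx _ (Ideal.mul_mem_right _ _ ha)
    | mem c hc =>
      rw [← ht] at ha
      induction ha using Submodule.span_induction with
      | zero => rw [zero_smul]; exact Submodule.zero_mem _
      | add x y _ _ hx hy => rw [add_smul]; exact Submodule.add_mem _ hx hy
      | smul b x _ hx => rw [smul_assoc]; exact Submodule.smul_mem _ _ hx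
      | mem a ha => exact Submodule.subset_span (Finset.mem_image₂_of_mem ha hc)

/-- `X` contains `J C`, which is finitely generated, and `X / J C` is finite. -/
theorem finite_of_isCoatom (hR : Finite (R ⧸ Ring.jacobson R)) (hJ : (Ring.jacobson R).FG)
    {C : Type v} [AddCommGroup C] [Module R C] [Module.Finite R C] {X : Submodule R C}
    (hX : IsCoatom X) : Module.Finite R X := by
  rw [Module.Finite.iff_fg]
  have hJX := jacobson_smul_top_le_of_isCoatom hX
  have := finite_quotient_jacobson hR C
  refine Submodule.fg_of_fg_map_of_fg_inf_ker (Ring.jacobson R • (⊤ : Submodule R C)).mkQ ?_ ?_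
  · exact Submodule.FG.of_finite
  · rw [Submodule.ker_mkQ, inf_eq_right.mpr hJX]
    exact jacobson_smul_top_fg hJ C

theorem finite_coatoms (hR : Finite (R ⧸ Ring.jacobson R)) (C : Type v) [AddCommGroup C]
    [Module R C] [Module.Finite R C] : {X : Submodule R C | IsCoatom X}.Finite := by
  have := finite_quotient_jacobson hR C
  refine (Set.finite_range (Submodule.comap (Ring.jacobson R • (⊤ : Submodule R C)).mkQ)).subset ?_
  intro X hX
  refine ⟨X.map (Ring.jacobson R • (⊤ : Submodule R C)).mkQ, ?_⟩
  rw [Submodule.comap_map_mkQ, sup_eq_right.mpr (jacobson_smul_top_le_of_isCoatom hX)]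

variable {ι : Type v} [Fintype ι] {K : ι → Type w} [∀ i, Field (K i)] [∀ i, Finite (K i)]
  {r : ι → ℕ} (hr : ∀ i, 0 < r i)
  (e : (R ⧸ Ring.jacobson R) ≃+* ((i : ι) → Matrix (Fin (r i)) (Fin (r i)) (K i)))

include hr e in
theorem finiteColength_iff {C : Type*} [AddCommGroup C] [Module R C] {X : Submodule R C} :
    FiniteColength X ↔ Finite (C ⧸ X) :=
  ⟨finite_of_isFiniteLength e hr, fun _ => isFiniteLength_of_finite _⟩

omit [Fintype ι] [∀ i, Finite (K i)] in
theorem mult_quotient_add {C : Type*} [AddCommGroup C] [Module R C] {X Y : Submodule R C}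
    (h : X ≤ Y) [Finite (C ⧸ X)] :
    mult e hr (C ⧸ X) = mult e hr (SubQuot X Y) + mult e hr (C ⧸ Y) := by
  have : Finite (SubQuot X ⊤) := Finite.of_equiv _ (subQuotTopEquiv X).symm.toEquiv
  have : Finite (SubQuot Y ⊤) := Finite.of_surjective _ (subQuotFactor_surjective h ⊤)
  rw [← mult_congr e hr (subQuotTopEquiv X), ← mult_congr e hr (subQuotTopEquiv Y),
    mult_subQuot_add e hr h le_top]

theorem finite_subQuot_of_le {C : Type*} [AddCommGroup C] [Module R C] {X : Submodule R C}
    (Y : Submodule R C) [Finite (C ⧸ X)] : Finite (SubQuot X Y) :=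
  have : Finite (SubQuot X ⊤) := Finite.of_equiv _ (subQuotTopEquiv X).symm.toEquiv
  Finite.of_injective _ (subQuotInclusion_injective X (le_top : Y ≤ ⊤))

theorem finite_quotient_trans {C : Type*} [AddCommGroup C] [Module R C] {X Y : Submodule R C}
    (h : X ≤ Y) [Finite (SubQuot X Y)] [Finite (C ⧸ Y)] : Finite (C ⧸ X) :=
  have : Finite (SubQuot Y ⊤) := Finite.of_equiv _ (subQuotTopEquiv Y).symm.toEquiv
  have : Finite (SubQuot X ⊤) := finite_subQuot_trans h le_top
  Finite.of_equiv _ (subQuotTopEquiv X).toEquiv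

theorem finite_quotient_of_le {C : Type*} [AddCommGroup C] [Module R C] {X Y : Submodule R C}
    (h : X ≤ Y) [Finite (C ⧸ X)] : Finite (C ⧸ Y) :=
  Finite.of_surjective _ (Submodule.factor_surjective h)

-- A proper submodule lies in one of finitely many maximal ones. These are again finitely generated
-- and the length drops by one, so induction applies. This finiteness is behind all formal sums over
-- submodules.
omit [∀ i, Finite (K i)] in
theorem finite_bounded_colength (hR : Finite (R ⧸ Ring.jacobson R)) (hJ : (Ring.jacobson R).FG)
    (n : ℕ) (C : Type*) [AddCommGroup C] [Module R C] [Module.Finite R C] :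
    {X : Submodule R C | Finite (C ⧸ X) ∧ ∑ i, mult e hr (C ⧸ X) i ≤ n}.Finite := by
  classical
  induction n generalizing C with
  | zero =>
    refine (Set.finite_singleton ⊤).subset ?_
    rintro X ⟨hX, h0⟩
    have h1 : mult e hr (C ⧸ X) = 0 := by
      ext i
      exact Finset.sum_eq_zero_iff.mp (Nat.le_zero.mp h0) i (Finset.mem_univ i)
    rw [mult_eq_zero_iff, Submodule.Quotient.subsingleton_iff] at h1
    exact h1
  | succ n ih =>
    have hfin : (⋃ Y ∈ {Y : Submodule R C | IsCoatom Y}, (Submodule.map Y.subtype) ''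
        {X : Submodule R Y | Finite (Y ⧸ X) ∧ ∑ i, mult e hr (Y ⧸ X) i ≤ n}).Finite :=
      (finite_coatoms hR C).biUnion fun Y hY => by
        have := finite_of_isCoatom hR hJ hY
        exact (ih Y).image _
    refine (hfin.insert ⊤).subset ?_
    rintro X ⟨hX, hn⟩
    rcases eq_top_or_exists_le_coatom X with h | ⟨Y, hY, hXY⟩
    · exact Or.inl h
    · refine Or.inr (Set.mem_biUnion hY ⟨X.comap Y.subtype, ⟨?_, ?_⟩, ?_⟩)
      · exact finite_subQuot_of_le Y
      · have := isSimpleModule_iff_isCoatom.mpr hY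
        obtain ⟨i, ⟨f⟩⟩ := exists_column_equiv e (S := C ⧸ Y) hr
        rw [mult_quotient_add hr e hXY, mult_of_equiv_column e hr f] at hn
        simp only [Pi.add_apply, Finset.sum_add_distrib] at hn
        rw [Finset.sum_pi_single' i 1, if_pos (Finset.mem_univ i)] at hn
        exact Nat.le_of_succ_le_succ hn
      · rw [Submodule.map_comap_subtype, inf_eq_right.mpr hXY]

end Colength

/-! ### Weighted zeta functions -/

section Weights

variable {ι : Type v} [Fintype ι] {D : Type*} [CommRing D]

/-- The monomial `∏ i, a i ^ c i`. -/
def wpow (a : ι → D) (c : ι → ℕ) : D := ∏ i, a i ^ c i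

theorem wpow_add (a : ι → D) (c d : ι → ℕ) : wpow a (c + d) = wpow a c * wpow a d := by
  simp [wpow, pow_add, Finset.prod_mul_distrib]

theorem wpow_zero (a : ι → D) : wpow a 0 = 1 := by simp [wpow]

theorem mul_wpow (a b : ι → D) (c : ι → ℕ) : wpow (a * b) c = wpow a c * wpow b c := by
  simp [wpow, mul_pow, Finset.prod_mul_distrib]

theorem one_wpow (c : ι → ℕ) : wpow (1 : ι → D) c = 1 := by simp [wpow]

theorem wpow_comp_perm (a : ι → D) {c d : ι → ℕ} {σ : Equiv.Perm ι} (h : ∀ i, d (σ i) = c i) :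
    wpow a d = wpow (a ∘ σ) c := by
  rw [wpow, wpow, ← Equiv.prod_comp σ]
  simp [h]

theorem heyTerm_eq (K : ι → Type w) (a : ι → D) (c : ι → ℕ) :
    heyTerm K a c = wpow a c * heyTerm K 1 c := by
  simp only [heyTerm, wpow, ← Finset.prod_mul_distrib]
  refine Finset.prod_congr rfl fun i _ => ?_
  rw [neg_pow]
  simp
  ring

theorem le_order_wpow {τ : Type*} {a : ι → MvPowerSeries τ ℂ} {n : ℕ}
    (ha : ∀ i, (n : ℕ∞) ≤ (a i).order) (c : ι → ℕ) :
    ((n * ∑ i, c i : ℕ) : ℕ∞) ≤ (wpow a c).order := by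
  refine le_trans ?_ (MvPowerSeries.le_order_prod _ _)
  rw [Finset.mul_sum]
  push_cast
  refine Finset.sum_le_sum fun i _ => ?_
  refine le_trans ?_ (MvPowerSeries.le_order_pow _)
  rw [nsmul_eq_mul, mul_comm]
  gcongr
  exact ha i

end Weights

/-! ### Weighted zeta functions and Hey's formula -/

section Zeta

variable {R : Type u} [Ring R]
variable {ι : Type v} [Fintype ι] {K : ι → Type w} [∀ i, Field (K i)] [∀ i, Finite (K i)]
  {r : ι → ℕ} (hr : ∀ i, 0 < r i)
  (e : (R ⧸ Ring.jacobson R) ≃+* ((i : ι) → Matrix (Fin (r i)) (Fin (r i)) (K i)))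

/-- The term `a ^ [C / X]` of the weighted zeta function. -/
noncomputable def wTerm (a : ι → Dir R) (C : Type*) [AddCommGroup C] [Module R C]
    (X : {X : Submodule R C // FiniteColength X}) : Dir R :=
  wpow a (mult e hr (C ⧸ X.1))

/-- The zeta function of `C` with weights `a`. -/
noncomputable def wZeta (a : ι → Dir R) (C : Type*) [AddCommGroup C] [Module R C] : Dir R :=
  ∑' X, wTerm hr e a C X

/-- The factor `b` is arbitrary: the order of the first factor is already at least the length of `C
/ X`, and each length occurs finitely often. -/
theorem summable_wTerm_mul (hR : Finite (R ⧸ Ring.jacobson R)) (hJ : (Ring.jacobson R).FG)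
    {a : ι → Dir R} (ha : ∀ i, 1 ≤ (a i).order) (C : Type*) [AddCommGroup C] [Module R C]
    [Module.Finite R C] (b : {X : Submodule R C // FiniteColength X} → Dir R) :
    Summable fun X => wTerm hr e a C X * b X := by
  refine dir_summable fun d => ?_
  refine Set.Finite.of_finite_image (f := Subtype.val) ?_ Subtype.val_injective.injOn
  refine (finite_bounded_colength hr e hR hJ d.degree C).subset ?_
  rintro _ ⟨X, hX, rfl⟩
  refine ⟨(finiteColength_iff hr e).mp X.2, ?_⟩
  by_contra h
  refine hX (MvPowerSeries.coeff_of_lt_order (lt_of_lt_of_le ?_ MvPowerSeries.le_order_mul))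
  refine lt_of_lt_of_le ?_ (le_add_right (le_order_wpow (n := 1) (by simpa using ha) _))
  rw [one_mul]
  exact_mod_cast not_le.mp h

theorem hasSum_wTerm (hR : Finite (R ⧸ Ring.jacobson R)) (hJ : (Ring.jacobson R).FG)
    {a : ι → Dir R} (ha : ∀ i, 1 ≤ (a i).order) (C : Type*) [AddCommGroup C] [Module R C]
    [Module.Finite R C] : HasSum (wTerm hr e a C) (wZeta hr e a C) := by
  have := summable_wTerm_mul hr e hR hJ ha C 1
  simp only [Pi.one_apply, mul_one] at this
  exact this.hasSum

theorem hasSum_wTerm_congr {a : ι → Dir R} {C C' : Type*} [AddCommGroup C] [Module R C]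
    [AddCommGroup C'] [Module R C'] (f : C ≃ₗ[R] C') {z : Dir R}
    (h : HasSum (wTerm hr e a C) z) : HasSum (wTerm hr e a C') z := by
  have hq : ∀ X : Submodule R C, Nonempty ((C ⧸ X) ≃ₗ[R] (C' ⧸ Submodule.orderIsoMapComap f X)) :=
    fun X => ⟨Submodule.Quotient.equiv _ _ f rfl⟩
  let E : {X : Submodule R C // FiniteColength X} ≃ {X : Submodule R C' // FiniteColength X} :=
    (Submodule.orderIsoMapComap f).toEquiv.subtypeEquiv fun X =>
      ⟨(hq X).some.isFiniteLength, (hq X).some.symm.isFiniteLength⟩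
  rw [← E.hasSum_iff]
  convert! h using 1
  ext1 X
  have := (finiteColength_iff hr e).mp X.2
  exact congrArg (wpow a) (mult_congr e hr (hq X.1).some).symm

theorem le_order_wZeta_sub_one (hR : Finite (R ⧸ Ring.jacobson R)) (hJ : (Ring.jacobson R).FG)
    {a : ι → Dir R} {n : ℕ} (hn : 1 ≤ n) (ha : ∀ i, (n : ℕ∞) ≤ (a i).order) (C : Type*)
    [AddCommGroup C] [Module R C] [Module.Finite R C] :
    (n : ℕ∞) ≤ (wZeta hr e a C - 1).order := by
  have ha' : ∀ i, 1 ≤ (a i).order := fun i => le_trans (by exact_mod_cast hn) (ha i)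
  let x₀ : {X : Submodule R C // FiniteColength X} := ⟨⊤, .of_subsingleton⟩
  have h1 : wTerm hr e a C x₀ = 1 := by
    rw [wTerm, mult_of_subsingleton, wpow_zero]
  rw [← h1]
  refine dir_le_order_sub (hasSum_wTerm hr e hR hJ ha' C) x₀ fun X hX => ?_
  have := (finiteColength_iff hr e).mp X.2
  refine le_trans ?_ (le_order_wpow ha _)
  have h2 : ∑ i, mult e hr (C ⧸ X.1) i ≠ 0 := fun h => hX (Subtype.ext (by
    rw [← Submodule.Quotient.subsingleton_iff, ← mult_eq_zero_iff e hr]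
    ext i
    exact Finset.sum_eq_zero_iff.mp h i (Finset.mem_univ i)))
  exact_mod_cast Nat.le_mul_of_pos_right n (Nat.pos_of_ne_zero h2)

/-- For `X ≤ Y` the class of `C / X` is that of `Y / X` plus that of `C / Y`. -/
theorem hasSum_indicator_below {a : ι → Dir R} {C : Type*} [AddCommGroup C] [Module R C]
    {Y : Submodule R C} (hY : FiniteColength Y) {z : Dir R} (h : HasSum (wTerm hr e a Y) z) :
    HasSum ({X : {X : Submodule R C // FiniteColength X} | X.1 ≤ Y}.indicator (wTerm hr e a C))
      (wpow a (mult e hr (C ⧸ Y)) * z) := by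
  have hYf := (finiteColength_iff hr e).mp hY
  have hmap : ∀ X : Submodule R Y, (X.map Y.subtype).comap Y.subtype = X := fun X =>
    Submodule.comap_map_eq_of_injective Y.injective_subtype X
  let E : {X : Submodule R Y // FiniteColength X} ≃
      {X : {X : Submodule R C // FiniteColength X} // X.1 ≤ Y} :=
    { toFun := fun X => ⟨⟨X.1.map Y.subtype, by
        have h1 : Finite (SubQuot (X.1.map Y.subtype) Y) := by
          rw [SubQuot, hmap]
          exact (finiteColength_iff hr e).mp X.2
        have := finite_quotient_trans (Submodule.map_subtype_le Y X.1)
        exact (finiteColength_iff hr e).mpr this⟩, Submodule.map_subtype_le _ _⟩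
      invFun := fun X => ⟨X.1.1.comap Y.subtype, by
        have := (finiteColength_iff hr e).mp X.1.2
        exact (finiteColength_iff hr e).mpr (finite_subQuot_of_le Y)⟩
      left_inv := fun X => Subtype.ext (hmap _)
      right_inv := fun X => Subtype.ext (Subtype.ext (by
        change Submodule.map _ (Submodule.comap _ _) = _
        rw [Submodule.map_comap_subtype, inf_eq_right.mpr X.2])) }
  rw [← hasSum_subtype_iff_indicator]
  change HasSum (fun X : {X : {X : Submodule R C // FiniteColength X} // X.1 ≤ Y} =>
    wTerm hr e a C X.1) _
  rw [← E.symm.hasSum_iff] at h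
  convert! h.mul_left (wpow a (mult e hr (C ⧸ Y))) using 1
  ext1 X
  have := (finiteColength_iff hr e).mp X.1.2
  rw [wTerm, mult_quotient_add hr e X.2, wpow_add, mul_comm]
  rfl

-- Möbius inversion: this is `sum_heyTerm` at `a = 1` for `C / (X + JC)`. The product has a zero
-- factor at `j = 0` unless `X + JC = C`, that is, `X = C` by Nakayama.
open Classical in
theorem sum_heyTerm_above {C : Type*} [AddCommGroup C] [Module R C] [Module.Finite R C]
    {N : Submodule R C} (hN : N = Ring.jacobson R • ⊤) [IsSemisimpleModule R (C ⧸ N)]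
    [Finite (C ⧸ N)] [Fintype (Submodule R (C ⧸ N))] (D : Type*) [CommRing D]
    (X : Submodule R C) :
    ∑ Z : Submodule R (C ⧸ N),
      (if X ≤ Z.comap N.mkQ then heyTerm K (1 : ι → D) (mult e hr ((C ⧸ N) ⧸ Z)) else 0) =
      if X = ⊤ then 1 else 0 := by
  let T := X.map N.mkQ
  have : Fintype (Submodule R ((C ⧸ N) ⧸ T)) := Fintype.ofFinite _
  have hq : ∀ Z : Submodule R ((C ⧸ N) ⧸ T),
      Nonempty (((C ⧸ N) ⧸ Z.comap T.mkQ) ≃ₗ[R] (((C ⧸ N) ⧸ T) ⧸ Z)) := fun Z =>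
    ⟨(Submodule.quotEquivOfEq _ _ (by rw [LinearMap.ker_comp, Submodule.ker_mkQ])).trans
        ((Z.mkQ ∘ₗ T.mkQ).quotKerEquivOfSurjective (Z.mkQ_surjective.comp T.mkQ_surjective))⟩
  rw [← Finset.sum_filter]
  have h1 : ∑ Z ∈ Finset.univ.filter (fun Z : Submodule R (C ⧸ N) => X ≤ Z.comap N.mkQ),
      heyTerm K (1 : ι → D) (mult e hr (_ ⧸ Z)) =
      ∑ Z : Submodule R ((C ⧸ N) ⧸ T), heyTerm K (1 : ι → D) (mult e hr (_ ⧸ Z)) := by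
    symm
    refine Finset.sum_bij (fun Z _ => Z.comap T.mkQ) ?_ ?_ ?_ ?_
    · intro Z _
      rw [Finset.mem_filter, ← Submodule.map_le_iff_le_comap]
      refine ⟨Finset.mem_univ _, ?_⟩
      exact (Submodule.ker_mkQ T).symm.le.trans (LinearMap.ker_le_comap _)
    · intro Z _ Z' _ h
      exact Submodule.comap_injective_of_surjective T.mkQ_surjective h
    · intro Z hZ
      rw [Finset.mem_filter, ← Submodule.map_le_iff_le_comap] at hZ
      refine ⟨Z.map T.mkQ, Finset.mem_univ _, ?_⟩
      rw [Submodule.comap_map_mkQ, sup_eq_right.mpr hZ.2]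
    · intro Z _
      rw [mult_congr e hr (hq Z).some]
  rw [h1, sum_heyTerm hr e]
  split_ifs with hX
  · have : Subsingleton ((C ⧸ N) ⧸ T) := by
      rw [Submodule.Quotient.subsingleton_iff]
      change X.map N.mkQ = ⊤
      rw [hX, Submodule.map_top, Submodule.range_mkQ]
    rw [mult_of_subsingleton]
    simp
  · have h2 : ¬ Subsingleton ((C ⧸ N) ⧸ T) := by
      rw [Submodule.Quotient.subsingleton_iff]
      intro h
      apply hX
      apply eq_top_of_sup_jacobson
      have h3 := congrArg (Submodule.comap N.mkQ) h
      rwa [Submodule.comap_map_mkQ, Submodule.comap_top, sup_comm, hN] at h3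
    obtain ⟨i, hi⟩ := Function.ne_iff.mp fun h0 => h2 ((mult_eq_zero_iff e hr).mp h0)
    refine Finset.prod_eq_zero (Finset.mem_univ i) ?_
    refine Finset.prod_eq_zero (Finset.mem_range.mpr (Nat.pos_of_ne_zero hi)) ?_
    simp

/-- The zeta function of a module all of whose submodules of finite colength are isomorphic. -/
theorem wZeta_mul_prod (hR : Finite (R ⧸ Ring.jacobson R)) (hJ : (Ring.jacobson R).FG)
    {a : ι → Dir R} (ha : ∀ i, 1 ≤ (a i).order) (C : Type*) [AddCommGroup C] [Module R C]
    [Module.Finite R C] {N : Submodule R C} (hN : N = Ring.jacobson R • ⊤)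
    [IsSemisimpleModule R (C ⧸ N)]
    (hiso : ∀ X : Submodule R C, FiniteColength X → Nonempty (C ≃ₗ[R] X)) :
    wZeta hr e a C * ∏ i, ∏ j ∈ Finset.range (mult e hr (C ⧸ N) i),
        (1 - (Nat.card (K i) : Dir R) ^ j * a i) = 1 := by
  classical
  have : Finite (C ⧸ N) := hN ▸ finite_quotient_jacobson hR C
  have : Fintype (Submodule R (C ⧸ N)) := Fintype.ofFinite _
  have hq : ∀ Z : Submodule R (C ⧸ N), Nonempty ((C ⧸ Z.comap N.mkQ) ≃ₗ[R] ((C ⧸ N) ⧸ Z)) :=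
    fun Z => ⟨(Submodule.quotEquivOfEq _ _ (by rw [LinearMap.ker_comp, Submodule.ker_mkQ])).trans
      ((Z.mkQ ∘ₗ N.mkQ).quotKerEquivOfSurjective (Z.mkQ_surjective.comp N.mkQ_surjective))⟩
  have hfc : ∀ Z : Submodule R (C ⧸ N), FiniteColength (Z.comap N.mkQ) := fun Z =>
    (finiteColength_iff hr e).mpr (Finite.of_equiv _ (hq Z).some.symm.toEquiv)
  -- A double sum over `X ≤ Y` with `JC ≤ Y` is evaluated in two ways. For fixed `Y`, the preimage
  -- of `Z`, the isomorphism `Y ≃ C` reduces the sum over `X` to the zeta function of `C`.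
  have hZ : ∀ Z : Submodule R (C ⧸ N), HasSum
      (fun X : {X : Submodule R C // FiniteColength X} => wTerm hr e a C X *
        if X.1 ≤ Z.comap N.mkQ then heyTerm K (1 : ι → Dir R) (mult e hr (_ ⧸ Z)) else 0)
      (wZeta hr e a C * heyTerm K a (mult e hr (_ ⧸ Z))) := by
    intro Z
    have := (finiteColength_iff hr e).mp (hfc Z)
    have h1 := (hasSum_indicator_below hr e (hfc Z) (hasSum_wTerm_congr hr e
      (hiso _ (hfc Z)).some (hasSum_wTerm hr e hR hJ ha C))).mul_right
      (heyTerm K (1 : ι → Dir R) (mult e hr (_ ⧸ Z)))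
    rw [heyTerm_eq K a, ← mult_congr e hr (hq Z).some]
    rw [← mult_congr e hr (hq Z).some] at h1
    convert! h1 using 1
    · ext1 X
      by_cases hX : X.1 ≤ Z.comap N.mkQ
      · rw [if_pos hX, Set.indicator_of_mem (show X ∈ {X | X.1 ≤ Z.comap N.mkQ} from hX)]
      · rw [if_neg hX, Set.indicator_of_notMem (show X ∉ {X | X.1 ≤ Z.comap N.mkQ} from hX)]
        simp
    · ring
  have hsum := hasSum_sum fun Z (_ : Z ∈ (Finset.univ : Finset (Submodule R (C ⧸ N)))) => hZ Z
  rw [← Finset.mul_sum, sum_heyTerm hr e] at hsum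
  -- For fixed `X` the Möbius values cancel unless `X = C`, so the other evaluation is `1`.
  refine hsum.unique ?_
  have htop : FiniteColength (⊤ : Submodule R C) := IsFiniteLength.of_subsingleton
  convert! hasSum_ite_eq (⟨⊤, htop⟩ : {X : Submodule R C // FiniteColength X})
    (1 : Dir R) using 1
  ext1 X
  rw [← Finset.mul_sum, sum_heyTerm_above hr e hN]
  by_cases hX : X.1 = ⊤
  · have hX' : X = ⟨⊤, htop⟩ := Subtype.ext hX
    have : Subsingleton (C ⧸ X.1) := (Submodule.Quotient.subsingleton_iff).mpr hX
    rw [if_pos hX, if_pos hX', wTerm, mult_of_subsingleton, wpow_zero, one_mul]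
  · have hX' : X ≠ ⟨⊤, htop⟩ := fun h => hX (congrArg Subtype.val h)
    rw [if_neg hX, if_neg hX', mul_zero]

end Zeta

/-! ### Submodules of a subquotient -/

section Lift

variable {R : Type u} [Ring R] {A : Type v} [AddCommGroup A] [Module R A] {K W : Submodule R A}

/-- The submodule of `A` between `K` and `W` that corresponds to a submodule of `W / K`. -/
def liftSub (Z : Submodule R (SubQuot K W)) : Submodule R A :=
  (Z.comap (Submodule.mkQ _)).map W.subtype

theorem liftSub_le (Z : Submodule R (SubQuot K W)) : liftSub Z ≤ W := Submodule.map_subtype_le _ _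

theorem comap_liftSub (Z : Submodule R (SubQuot K W)) :
    (liftSub Z).comap W.subtype = Z.comap (Submodule.mkQ _) :=
  Submodule.comap_map_eq_of_injective W.injective_subtype _

theorem le_liftSub (h : K ≤ W) (Z : Submodule R (SubQuot K W)) : K ≤ liftSub Z := by
  intro x hx
  refine ⟨⟨x, h hx⟩, ?_, rfl⟩
  have : (Submodule.mkQ (K.comap W.subtype)) ⟨x, h hx⟩ = 0 := (subQuot_mk_eq_zero _).mpr hx
  change Submodule.mkQ (K.comap W.subtype) ⟨x, h hx⟩ ∈ Z
  rw [this]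
  exact Z.zero_mem

theorem liftSub_injective : Function.Injective (liftSub : Submodule R (SubQuot K W) → _) :=
  fun Z Z' h => Submodule.comap_injective_of_surjective (Submodule.mkQ_surjective _)
    (by rw [← comap_liftSub, ← comap_liftSub, h])

theorem exists_liftSub_eq {Y : Submodule R A} (hK : K ≤ Y) (hW : Y ≤ W) :
    ∃ Z : Submodule R (SubQuot K W), liftSub Z = Y := by
  refine ⟨(Y.comap W.subtype).map (Submodule.mkQ _), ?_⟩
  rw [liftSub, Submodule.comap_map_mkQ, sup_eq_right.mpr (Submodule.comap_mono hK),
    Submodule.map_comap_subtype, inf_eq_right.mpr hW]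

theorem nonempty_quotient_liftSub_equiv (Z : Submodule R (SubQuot K W)) :
    Nonempty (SubQuot (liftSub Z) W ≃ₗ[R] (SubQuot K W ⧸ Z)) :=
  ⟨(Submodule.quotEquivOfEq _ _ (by
      rw [comap_liftSub, LinearMap.ker_comp, Submodule.ker_mkQ])).trans
    ((Z.mkQ ∘ₗ Submodule.mkQ (K.comap W.subtype)).quotKerEquivOfSurjective
      (Z.mkQ_surjective.comp (Submodule.mkQ_surjective _)))⟩

theorem nonempty_liftSub_equiv (Z : Submodule R (SubQuot K W)) :
    Nonempty (SubQuot K (liftSub Z) ≃ₗ[R] Z) := by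
  have hmem : ∀ x : liftSub Z, subQuotInclusion K (liftSub_le Z) (Submodule.Quotient.mk x) ∈ Z := by
    rintro ⟨_, ⟨x, hx, rfl⟩⟩
    exact hx
  let f : SubQuot K (liftSub Z) →ₗ[R] Z :=
    (subQuotInclusion K (liftSub_le Z)).codRestrict Z fun x => by
      obtain ⟨x, rfl⟩ := Submodule.Quotient.mk_surjective _ x
      exact hmem x
  refine ⟨LinearEquiv.ofBijective f ⟨?_, ?_⟩⟩
  · exact (LinearMap.injective_codRestrict_iff _).mpr (subQuotInclusion_injective K (liftSub_le Z))
  · rintro ⟨z, hz⟩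
    obtain ⟨x, rfl⟩ := Submodule.Quotient.mk_surjective _ z
    exact ⟨Submodule.Quotient.mk ⟨x.1, ⟨x, hz, rfl⟩⟩, rfl⟩

/-- If all submodules of finite colength of `N` are isomorphic to `N`, then so are those of any
module isomorphic to `N`. -/
theorem nonempty_equiv_of_equiv {N C : Type*} [AddCommGroup N] [Module R N] [AddCommGroup C]
    [Module R C] (hiso : ∀ X : Submodule R N, FiniteColength X → Nonempty (N ≃ₗ[R] X))
    (f : C ≃ₗ[R] N) {Z : Submodule R C} (hZ : FiniteColength Z) : Nonempty (N ≃ₗ[R] Z) := by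
  have h1 : FiniteColength (Z.map f.toLinearMap) :=
    (Submodule.Quotient.equiv Z _ f rfl).isFiniteLength hZ
  exact ⟨(hiso _ h1).some.trans (f.submoduleMap Z).symm⟩

end Lift

/-! ### The recursion -/

section Recursion

variable {R : Type u} [Ring R]
variable {ι : Type v} [Fintype ι] {K : ι → Type w} [∀ i, Field (K i)] [∀ i, Finite (K i)]
  {r : ι → ℕ} (hr : ∀ i, 0 < r i)
  (e : (R ⧸ Ring.jacobson R) ≃+* ((i : ι) → Matrix (Fin (r i)) (Fin (r i)) (K i)))
variable {I : Ideal R} [I.IsTwoSided] {M : Type u} [AddCommGroup M] [Module R M]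

-- `W / (W ∩ IM)` is the image of `W` in `M / IM`, a submodule of finite colength there.
omit [I.IsTwoSided] in
include hr e in
theorem nonempty_subQuot_equiv
    (hiso : ∀ X : Submodule R (M ⧸ I • (⊤ : Submodule R M)), FiniteColength X →
      Nonempty ((M ⧸ I • (⊤ : Submodule R M)) ≃ₗ[R] X))
    {W : Submodule R M} (hW : FiniteColength W) :
    Nonempty (SubQuot (W ⊓ I • ⊤) W ≃ₗ[R] (M ⧸ I • (⊤ : Submodule R M))) := by
  let T := I • (⊤ : Submodule R M)
  let f : W →ₗ[R] (M ⧸ T) := T.mkQ ∘ₗ W.subtype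
  have hk : (W ⊓ T).comap W.subtype = LinearMap.ker f := by
    rw [LinearMap.ker_comp, Submodule.ker_mkQ, Submodule.comap_inf, Submodule.comap_subtype_self,
      top_inf_eq]
  have := (finiteColength_iff hr e).mp hW
  have hfin : FiniteColength (LinearMap.range f) := by
    have hle : W ≤ (LinearMap.range f).comap T.mkQ := fun x hx => ⟨⟨x, hx⟩, rfl⟩
    refine (finiteColength_iff hr e).mpr
      (Finite.of_surjective (Submodule.mapQ W (LinearMap.range f) T.mkQ hle) ?_)
    intro y
    obtain ⟨y, rfl⟩ := Submodule.mkQ_surjective _ y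
    obtain ⟨y, rfl⟩ := Submodule.mkQ_surjective _ y
    exact ⟨Submodule.Quotient.mk y, rfl⟩
  exact ⟨((Submodule.quotEquivOfEq _ _ hk).trans f.quotKerEquivRange).trans (hiso _ hfin).some.symm⟩

omit [I.IsTwoSided] in
theorem smul_top_le_ker {C : Type*} [AddCommGroup C] [Module R C]
    (hC : ∀ x ∈ I, ∀ c : C, x • c = 0) (f : M →ₗ[R] C) :
    I • (⊤ : Submodule R M) ≤ LinearMap.ker f := by
  refine Submodule.smul_le.mpr fun x hx y _ => ?_
  rw [LinearMap.mem_ker, map_smul, hC x hx]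

omit [I.IsTwoSided] in
theorem smul_subQuot_eq_zero {W Y : Submodule R M} (hY : Y ≤ W) {x : R} (hx : x ∈ I)
    (c : SubQuot (I • W) Y) : x • c = 0 := by
  obtain ⟨c, rfl⟩ := Submodule.Quotient.mk_surjective _ c
  exact (subQuot_mk_eq_zero _).mpr (Submodule.smul_mem_smul hx (hY c.2))

omit [I.IsTwoSided] in
/-- The number of submodules `X` with `X ⊓ K = I • W` and `X ⊔ K = Y`, where `K = W ⊓ I • M`. -/
theorem card_fibre [Module.Projective R M] {W Y : Submodule R M} (hKY : W ⊓ I • ⊤ ≤ Y) (hYW : Y ≤ W)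
    (φ : SubQuot (W ⊓ I • ⊤) Y ≃ₗ[R] (M ⧸ I • (⊤ : Submodule R M))) :
    Nat.card {X : Submodule R M // X ⊓ (W ⊓ I • ⊤) = I • W ∧ X ⊔ (W ⊓ I • ⊤) = Y} =
      Nat.card (M →ₗ[R] SubQuot (I • W) (W ⊓ I • ⊤)) := by
  have hIK : I • W ≤ W ⊓ I • ⊤ := le_inf Submodule.smul_le_right (Submodule.smul_mono le_rfl le_top)
  -- A section over `Y / K ≃ M / IM` is obtained by lifting from `M`. The lift descends to `M / IM`
  -- because `I` kills `Y / IW`, as `Y ≤ W`.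
  obtain ⟨g, hg⟩ := Module.projective_lifting_property (subQuotFactor hIK Y)
    (φ.symm.toLinearMap ∘ₗ Submodule.mkQ _) (subQuotFactor_surjective hIK Y)
  have hgk : I • (⊤ : Submodule R M) ≤ LinearMap.ker g :=
    smul_top_le_ker (fun x hx c => smul_subQuot_eq_zero hYW hx c) g
  let s₀ := (Submodule.liftQ _ g hgk) ∘ₗ φ.toLinearMap
  have hs₀ : ∀ c, subQuotFactor hIK Y (s₀ c) = c := by
    intro c
    obtain ⟨c, rfl⟩ := φ.symm.surjective c
    obtain ⟨x, rfl⟩ := Submodule.mkQ_surjective _ c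
    have h1 : s₀ (φ.symm (Submodule.mkQ _ x)) = g x := by
      change Submodule.liftQ _ g hgk (φ (φ.symm _)) = g x
      rw [LinearEquiv.apply_symm_apply]
      rfl
    rw [h1]
    exact LinearMap.congr_fun hg x
  rw [card_relative_complements hIK hKY s₀ hs₀, card_hom_congr φ (LinearEquiv.refl R _),
    card_hom_quotient]
  exact smul_top_le_ker fun x hx c => smul_subQuot_eq_zero inf_le_left hx c

variable (hI : IsInvertibleIdeal I)
variable {σ : Equiv.Perm ι}
  (hσ : ∀ i, Nonempty (IdealTensor I (ColumnModule e i) ≃ₗ[R] ColumnModule e (σ i)))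

include hI hσ in
theorem mult_smul_subQuot [Module.Projective R M] {W : Submodule R M} [Finite (M ⧸ W)] :
    Finite (SubQuot (I • W) (I • ⊤)) ∧
      ∀ i, mult e hr (SubQuot (I • W) (I • ⊤)) (σ i) = mult e hr (M ⧸ W) i := by
  let f := (idealTensorCongr I (subQuotTopEquiv W).symm).trans
    (idealTensorSubQuot I W ⊤ le_top (idealMul_injective hI _))
  have h := mult_idealTensor hr e hI hσ (M ⧸ W)
  have := h.1
  exact ⟨Finite.of_equiv _ f.toEquiv, fun i => by rw [← h.2, mult_congr e hr f]⟩

omit [Fintype ι] [∀ i, Finite (K i)] [I.IsTwoSided] in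
/-- The multiplicities in `M / X` for `X ⊓ K = I • W` and `X ⊔ K = Y ≤ W`,
where `K = W ⊓ I • M`. -/
theorem mult_fibre {W Y X : Submodule R M} [Finite (M ⧸ W)]
    [Finite (SubQuot (I • W) (I • (⊤ : Submodule R M)))] [Finite (SubQuot Y W)] (hYW : Y ≤ W)
    (hX : X ⊓ (W ⊓ I • ⊤) = I • W) (hX' : X ⊔ (W ⊓ I • ⊤) = Y) :
    Finite (M ⧸ X) ∧
    mult e hr (M ⧸ X) = mult e hr (SubQuot (I • W) (W ⊓ I • ⊤)) + (mult e hr (SubQuot Y W) +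
      mult e hr (M ⧸ W)) ∧
    mult e hr (M ⧸ (X ⊔ I • ⊤)) = mult e hr (SubQuot Y W) + mult e hr (M ⧸ (W ⊔ I • ⊤)) := by
  have hXY : X ≤ Y := hX' ▸ le_sup_left
  have h1 : SubQuot (I • W) (W ⊓ I • ⊤) ≃ₗ[R] SubQuot X Y := by
    have := subQuotInfEquivSup X (W ⊓ I • ⊤)
    rwa [hX, hX'] at this
  have : Finite (SubQuot (I • W) (W ⊓ I • ⊤)) :=
    Finite.of_injective _ (subQuotInclusion_injective (I • W) (inf_le_right : W ⊓ I • ⊤ ≤ _))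
  have : Finite (SubQuot X Y) := Finite.of_equiv _ h1.toEquiv
  have : Finite (M ⧸ Y) := finite_quotient_trans hYW
  have : Finite (M ⧸ X) := finite_quotient_trans hXY
  refine ⟨this, ?_, ?_⟩
  · rw [mult_quotient_add hr e hXY, mult_quotient_add hr e hYW, mult_congr e hr h1]
  · have h2 : SubQuot Y W ≃ₗ[R] SubQuot (X ⊔ I • ⊤) (W ⊔ I • ⊤) := by
      have := subQuotInfEquivSup (X ⊔ I • ⊤) W
      rwa [sup_inf_assoc_of_le _ (hXY.trans hYW), inf_comm (I • ⊤), hX', sup_right_comm,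
        sup_eq_right.mpr (hXY.trans hYW)] at this
    have : Finite (M ⧸ (X ⊔ I • ⊤)) := finite_quotient_of_le le_sup_left
    rw [mult_quotient_add hr e (sup_le_sup_right (hXY.trans hYW) (I • ⊤)), mult_congr e hr h2]

-- Both sides equal `[K/IW] + [IM/K] + [M/(W + IM)]` for `K = W ∩ IM`, by `IM/K ≃ (W + IM)/W`. The
-- identity removes `[K/IW]` from the recursion.
omit [Fintype ι] [∀ i, Finite (K i)] [I.IsTwoSided] in
theorem mult_inf_add {W : Submodule R M} [Finite (M ⧸ W)]
    [Finite (SubQuot (I • W) (I • (⊤ : Submodule R M)))] :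
    mult e hr (SubQuot (I • W) (W ⊓ I • ⊤)) + mult e hr (M ⧸ W) =
      mult e hr (SubQuot (I • W) (I • ⊤)) + mult e hr (M ⧸ (W ⊔ I • ⊤)) := by
  have hIK : I • W ≤ W ⊓ I • ⊤ := le_inf Submodule.smul_le_right (Submodule.smul_mono le_rfl le_top)
  have : Finite (SubQuot (W ⊓ I • ⊤) (I • (⊤ : Submodule R M))) :=
    Finite.of_surjective _ (subQuotFactor_surjective hIK _)
  rw [mult_subQuot_add e hr hIK inf_le_right, mult_congr e hr (subQuotInfEquivSup W (I • ⊤)),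
    mult_quotient_add hr e (le_sup_left : W ≤ W ⊔ I • ⊤), add_assoc]

end Recursion

/-- The inner index type varies with `a`, but the inner sum does not, so it factors out. -/
theorem hasSum_of_sigma_mul {R : Type u} [Ring R] {α : Type*} {β : α → Type*}
    {f : (a : α) → β a → Dir R} {g : α → Dir R} {s z : Dir R}
    (h : HasSum (fun p : Σ a, β a => f p.1 p.2 * g p.1) s) (hf : ∀ a, HasSum (f a) z) :
    HasSum (fun a => z * g a) s :=
  h.sigma fun a => (hf a).mul_right (g a)

/-! ### Peeling off one layer -/

section PairZeta

variable {R : Type u} [Ring R]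
variable {ι : Type v} [Fintype ι] {K : ι → Type w} [∀ i, Field (K i)] [∀ i, Finite (K i)]
  {r : ι → ℕ} (hr : ∀ i, 0 < r i)
  (e : (R ⧸ Ring.jacobson R) ≃+* ((i : ι) → Matrix (Fin (r i)) (Fin (r i)) (K i)))
variable (I : Ideal R) (M : Type u) [AddCommGroup M] [Module R M]

/-- The term `a ^ [M / X] * b ^ [M / (X + I • M)]`. -/
noncomputable def pairTerm (a b : ι → Dir R) (X : {X : Submodule R M // FiniteColength X}) :
    Dir R :=
  wTerm hr e a M X * wpow b (mult e hr (M ⧸ (X.1 ⊔ I • ⊤)))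

/-- The sum of `a ^ [M / X] * b ^ [M / (X + I • M)]` over all `X` of finite colength. -/
noncomputable def pairZeta (a b : ι → Dir R) : Dir R := ∑' X, pairTerm hr e I M a b X

theorem hasSum_pairTerm (hR : Finite (R ⧸ Ring.jacobson R)) (hJ : (Ring.jacobson R).FG)
    [Module.Finite R M] {a : ι → Dir R} (ha : ∀ i, 1 ≤ (a i).order) (b : ι → Dir R) :
    HasSum (pairTerm hr e I M a b) (pairZeta hr e I M a b) :=
  (summable_wTerm_mul hr e hR hJ ha M _).hasSum

omit [∀ i, Finite (K i)] in
theorem pairZeta_one (a : ι → Dir R) : pairZeta hr e I M a 1 = wZeta hr e a M := by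
  simp only [pairZeta, wZeta, pairTerm, one_wpow, mul_one]

/-- The bound uses only `b`: for `X ≠ M`, Nakayama and `I ≤ J` give `X + IM ≠ M`, so `b` occurs with
positive exponent. -/
theorem le_order_pairZeta_sub_one (hR : Finite (R ⧸ Ring.jacobson R))
    (hJ : (Ring.jacobson R).FG) [Module.Finite R M] (hIJ : I ≤ Ring.jacobson R) {a b : ι → Dir R}
    (ha : ∀ i, 1 ≤ (a i).order) {n : ℕ} (hb : ∀ i, (n : ℕ∞) ≤ (b i).order) :
    (n : ℕ∞) ≤ (pairZeta hr e I M a b - 1).order := by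
  let x₀ : {X : Submodule R M // FiniteColength X} := ⟨⊤, .of_subsingleton⟩
  have h1 : pairTerm hr e I M a b x₀ = 1 := by
    have : Subsingleton (M ⧸ ((⊤ : Submodule R M) ⊔ I • ⊤)) := by
      rw [Submodule.Quotient.subsingleton_iff, top_sup_eq]
    rw [pairTerm, wTerm, mult_of_subsingleton, wpow_zero, one_mul, mult_of_subsingleton, wpow_zero]
  rw [← h1]
  refine dir_le_order_sub (hasSum_pairTerm hr e I M hR hJ ha b) x₀ fun X hX => ?_
  have := (finiteColength_iff hr e).mp X.2
  have : Finite (M ⧸ (X.1 ⊔ I • ⊤)) := finite_quotient_of_le le_sup_left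
  refine le_trans ?_ MvPowerSeries.le_order_mul
  refine le_add_left (le_trans ?_ (le_order_wpow hb _))
  have h2 : ∑ i, mult e hr (M ⧸ (X.1 ⊔ I • ⊤)) i ≠ 0 := fun h => hX (Subtype.ext (by
    refine eq_top_of_sup_jacobson (top_le_iff.mp ?_)
    have h3 : mult e hr (M ⧸ (X.1 ⊔ I • ⊤)) = 0 := by
      ext i
      exact Finset.sum_eq_zero_iff.mp h i (Finset.mem_univ i)
    rw [mult_eq_zero_iff, Submodule.Quotient.subsingleton_iff] at h3
    exact h3.symm.trans_le (sup_le_sup_left (Submodule.smul_mono hIJ le_rfl) _)))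
  exact_mod_cast Nat.le_mul_of_pos_right n (Nat.pos_of_ne_zero h2)

variable [I.IsTwoSided] [Module.Projective R M] [Module.Finite R M]

-- All `X` in a fibre contribute the same monomial, and there are `h^[K/IW]` of them for `K = W ∩
-- IM`. The resulting `(ha)^[K/IW]` is rewritten in terms of `M / W` and `M / (W + IM)`.
omit [Module.Finite R M] in
theorem hasSum_fibre {h h' : ι → Dir R} (hh' : h' * h = 1)
    (hcard : ∀ (B : Type u) [AddCommGroup B] [Module R B] [Finite B],
      (Nat.card (M →ₗ[R] B) : Dir R) = wpow h (mult e hr B)) (hI : IsInvertibleIdeal I)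
    {σ : Equiv.Perm ι}
    (hσ : ∀ i, Nonempty (IdealTensor I (ColumnModule e i) ≃ₗ[R] ColumnModule e (σ i)))
    (a b : ι → Dir R) (W : Submodule R M) [Finite (M ⧸ W)]
    (Z : Submodule R (SubQuot (W ⊓ I • ⊤) W)) (hZ : FiniteColength Z)
    (φ : (M ⧸ I • (⊤ : Submodule R M)) ≃ₗ[R] Z) :
    HasSum (fun X : {X : Submodule R M // X ⊓ (W ⊓ I • ⊤) = I • W ∧ X ⊔ (W ⊓ I • ⊤) = liftSub Z} =>
      wpow a (mult e hr (M ⧸ X.1)) * wpow b (mult e hr (M ⧸ (X.1 ⊔ I • ⊤))))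
    (wpow (a * b) (mult e hr (_ ⧸ Z)) * (wpow (h' * (h * a) ∘ σ) (mult e hr (M ⧸ W)) *
      wpow (h * a * b) (mult e hr (M ⧸ (W ⊔ I • ⊤))))) := by
  obtain ⟨hf1, hf2⟩ := mult_smul_subQuot hr e hI hσ (W := W)
  have : Finite (SubQuot (I • W) (W ⊓ I • ⊤)) :=
    Finite.of_injective _ (subQuotInclusion_injective (I • W) (inf_le_right : W ⊓ I • ⊤ ≤ _))
  have hKW : W ⊓ I • ⊤ ≤ W := inf_le_left
  have hQ := (finiteColength_iff hr e).mp hZ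
  obtain ⟨g⟩ := nonempty_quotient_liftSub_equiv Z
  have hfQ : Finite (SubQuot (liftSub Z) W) := Finite.of_equiv _ g.symm.toEquiv
  obtain ⟨g'⟩ := nonempty_liftSub_equiv Z
  have hc := card_fibre (le_liftSub hKW Z) (liftSub_le Z) (g'.trans φ.symm)
  -- The cardinality is a power of the invertible weights `h`, so `Nat.card` is not zero and the
  -- fibre is finite.
  have : Finite {X : Submodule R M // X ⊓ (W ⊓ I • ⊤) = I • W ∧ X ⊔ (W ⊓ I • ⊤) = liftSub Z} := by
    refine Nat.finite_of_card_ne_zero ?_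
    rw [hc]
    intro h0
    have h1 := hcard (SubQuot (I • W) (W ⊓ I • ⊤))
    rw [h0, Nat.cast_zero] at h1
    have h2 := mul_wpow h' h (mult e hr (SubQuot (I • W) (W ⊓ I • ⊤)))
    rw [hh', one_wpow, ← h1, mul_zero] at h2
    exact one_ne_zero h2
  have := Fintype.ofFinite
    {X : Submodule R M // X ⊓ (W ⊓ I • ⊤) = I • W ∧ X ⊔ (W ⊓ I • ⊤) = liftSub Z}
  convert! hasSum_fintype _ using 1
  have hterm : ∀ X : {X : Submodule R M // X ⊓ (W ⊓ I • ⊤) = I • W ∧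
      X ⊔ (W ⊓ I • ⊤) = liftSub Z},
      wpow a (mult e hr (M ⧸ X.1)) * wpow b (mult e hr (M ⧸ (X.1 ⊔ I • ⊤))) =
      wpow a (mult e hr (SubQuot (I • W) (W ⊓ I • ⊤)) + (mult e hr (_ ⧸ Z) + mult e hr (M ⧸ W))) *
        wpow b (mult e hr (_ ⧸ Z) + mult e hr (M ⧸ (W ⊔ I • ⊤))) := by
    intro X
    obtain ⟨-, h1, h2⟩ := mult_fibre hr e (liftSub_le Z) X.2.1 X.2.2
    rw [h1, h2, mult_congr e hr g]
  rw [Finset.sum_congr rfl fun X _ => hterm X, Finset.sum_const, Finset.card_univ,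
    ← Nat.card_eq_fintype_card, hc, nsmul_eq_mul, hcard]
  have h1 := congrArg (wpow (h * a)) (mult_inf_add hr e (I := I) (W := W))
  have h2 : wpow (h * a) (mult e hr (SubQuot (I • W) (I • ⊤))) =
      wpow ((h * a) ∘ σ) (mult e hr (M ⧸ W)) := wpow_comp_perm _ hf2
  have h3 := congrArg (fun x => wpow x (mult e hr (M ⧸ W))) hh'
  simp only [wpow_add, mul_wpow, one_wpow, h2] at h1 h3 ⊢
  set y := mult e hr (SubQuot (W ⊓ I • ⊤) W ⧸ Z)
  set c := mult e hr (SubQuot (I • W) (W ⊓ I • ⊤))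
  set d := mult e hr (M ⧸ W)
  set t := mult e hr (M ⧸ (W ⊔ I • ⊤))
  linear_combination (-(wpow a y * wpow b y * wpow b t * wpow h' d)) * h1 +
    (wpow a y * wpow b y * wpow b t * wpow h c * wpow a c * wpow a d) * h3

/-- Pairs of a submodule `W` of finite colength of `M` and a submodule of finite colength of
`W / (W ⊓ I • M)`. -/
abbrev PairIndex : Type u :=
  Σ W : {W : Submodule R M // FiniteColength W},
    {Z : Submodule R (SubQuot (W.1 ⊓ I • ⊤) W.1) // FiniteColength Z}

variable {M} {I} in
/-- The submodules `X` of `M` attached to a pair. -/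
abbrev PairFibre (p : PairIndex I M) : Type u :=
  {X : Submodule R M // X ⊓ (p.1.1 ⊓ I • ⊤) = I • p.1.1 ∧ X ⊔ (p.1.1 ⊓ I • ⊤) = liftSub p.2.1}

-- `X` determines `W` by `IW = X ∩ IM` and then `Z` as the image of `X` in `W / (W ∩ IM)`. Reading
-- the sum over `X` along this bijection gives the recursion.
omit [Module.Finite R M] in
include hr in
theorem exists_pairFibre_equiv (hI : IsInvertibleIdeal I) {σ : Equiv.Perm ι}
    (hσ : ∀ i, Nonempty (IdealTensor I (ColumnModule e i) ≃ₗ[R] ColumnModule e (σ i))) :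
    ∃ E : (Σ p : PairIndex I M, PairFibre p) ≃ {X : Submodule R M // FiniteColength X},
      ∀ x, (E x).1 = x.2.1 := by
  have hfc : ∀ (p : PairIndex I M) (X : PairFibre p), FiniteColength X.1 := by
    intro p X
    have := (finiteColength_iff hr e).mp p.1.2
    obtain ⟨hf1, -⟩ := mult_smul_subQuot hr e hI hσ (W := p.1.1)
    have hQ := (finiteColength_iff hr e).mp p.2.2
    obtain ⟨g⟩ := nonempty_quotient_liftSub_equiv p.2.1
    have hfQ : Finite (SubQuot (liftSub p.2.1) p.1.1) := Finite.of_equiv _ g.symm.toEquiv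
    exact (finiteColength_iff hr e).mpr (mult_fibre hr e (liftSub_le p.2.1) X.2.1 X.2.2).1
  let E : (Σ p : PairIndex I M, PairFibre p) → {X : Submodule R M // FiniteColength X} := fun x => ⟨x.2.1, hfc x.1 x.2⟩
  have hE : Function.Bijective E := by
    constructor
    · have hW : ∀ (p : PairIndex I M) (X : PairFibre p), I • p.1.1 = X.1 ⊓ I • ⊤ := by
        intro p X
        have hle : X.1 ≤ p.1.1 := (le_sup_left.trans X.2.2.le).trans (liftSub_le _)
        refine X.2.1.symm.trans ?_
        rw [← inf_assoc, inf_eq_left.mpr hle]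
      rintro ⟨⟨W, Z⟩, X⟩ ⟨⟨W', Z'⟩, X'⟩ hXX
      have hXX' : X.1 = X'.1 := congrArg Subtype.val hXX
      have h1 : I • W.1 = I • W'.1 := by rw [hW ⟨W, Z⟩ X, hW ⟨W', Z'⟩ X', hXX']
      obtain rfl : W = W' := Subtype.ext (le_antisymm ((smul_le_smul_iff hI).mp h1.le)
        ((smul_le_smul_iff hI).mp h1.ge))
      obtain rfl : Z = Z' := Subtype.ext (liftSub_injective (by
        rw [← X.2.2, ← X'.2.2, hXX']))
      obtain rfl : X = X' := Subtype.ext hXX'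
      rfl
    · intro X
      have := (finiteColength_iff hr e).mp X.2
      obtain ⟨W, hW⟩ := exists_smul_eq hI (inf_le_right : X.1 ⊓ I • ⊤ ≤ I • ⊤)
      have hXW : X.1 ≤ W := (smul_le_smul_iff hI).mp (hW.symm ▸
        le_inf Submodule.smul_le_right (Submodule.smul_mono le_rfl le_top))
      have hWf := finite_quotient_of_le hXW
      obtain ⟨Z, hZ⟩ := exists_liftSub_eq (K := W ⊓ I • ⊤) (W := W) (Y := X.1 ⊔ W ⊓ I • ⊤)
        le_sup_right (sup_le hXW inf_le_left)
      have : Finite (M ⧸ (X.1 ⊔ W ⊓ I • ⊤)) := finite_quotient_of_le le_sup_left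
      have hZf : FiniteColength Z := by
        obtain ⟨g⟩ := nonempty_quotient_liftSub_equiv Z
        rw [hZ] at g
        have := finite_subQuot_of_le (X := X.1 ⊔ W ⊓ I • ⊤) W
        exact (finiteColength_iff hr e).mpr (Finite.of_equiv _ g.toEquiv)
      refine ⟨⟨⟨⟨W, (finiteColength_iff hr e).mpr hWf⟩, ⟨Z, hZf⟩⟩, ⟨X.1, ?_, hZ.symm⟩⟩, rfl⟩
      change X.1 ⊓ (W ⊓ I • ⊤) = I • W
      rw [hW, ← inf_assoc, inf_eq_left.mpr hXW]
  exact ⟨Equiv.ofBijective E hE, fun _ => rfl⟩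

theorem hasSum_pairIndex (hR : Finite (R ⧸ Ring.jacobson R)) (hJ : (Ring.jacobson R).FG)
    {h h' : ι → Dir R} (hh' : h' * h = 1)
    (hcard : ∀ (B : Type u) [AddCommGroup B] [Module R B] [Finite B],
      (Nat.card (M →ₗ[R] B) : Dir R) = wpow h (mult e hr B)) (hI : IsInvertibleIdeal I)
    {σ : Equiv.Perm ι}
    (hσ : ∀ i, Nonempty (IdealTensor I (ColumnModule e i) ≃ₗ[R] ColumnModule e (σ i)))
    (hiso : ∀ X : Submodule R (M ⧸ I • (⊤ : Submodule R M)), FiniteColength X →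
      Nonempty ((M ⧸ I • (⊤ : Submodule R M)) ≃ₗ[R] X))
    {a : ι → Dir R} (ha : ∀ i, 1 ≤ (a i).order) (b : ι → Dir R) :
    HasSum (fun p : PairIndex I M => wTerm hr e (a * b) _ p.2 *
      pairTerm hr e I M (h' * (h * a) ∘ σ) (h * a * b) p.1) (pairZeta hr e I M a b) := by
  obtain ⟨E, hE⟩ := exists_pairFibre_equiv hr e I M hI hσ
  let term : Submodule R M → Dir R := fun X =>
    wpow a (mult e hr (M ⧸ X)) * wpow b (mult e hr (M ⧸ (X ⊔ I • ⊤)))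
  have h0 : HasSum (fun x => term (E x).1) (pairZeta hr e I M a b) :=
    E.hasSum_iff.mpr (hasSum_pairTerm hr e I M hR hJ ha b)
  simp only [hE] at h0
  have key : ∀ p : PairIndex I M, HasSum (fun X : PairFibre p => term X.1)
      (wTerm hr e (a * b) _ p.2 * pairTerm hr e I M (h' * (h * a) ∘ σ) (h * a * b) p.1) := by
    intro p
    have := (finiteColength_iff hr e).mp p.1.2
    obtain ⟨f⟩ := nonempty_subQuot_equiv hr e hiso p.1.2
    obtain ⟨g⟩ := nonempty_equiv_of_equiv hiso f p.2.2
    exact hasSum_fibre hr e I M hh' hcard hI hσ a b p.1.1 p.2.1 p.2.2 g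
  exact h0.sigma key

/-- Peeling off one factor `Z(M / IM)`. -/
theorem pairZeta_eq_mul (hR : Finite (R ⧸ Ring.jacobson R)) (hJ : (Ring.jacobson R).FG)
    {h h' : ι → Dir R} (hh' : h' * h = 1)
    (hcard : ∀ (B : Type u) [AddCommGroup B] [Module R B] [Finite B],
      (Nat.card (M →ₗ[R] B) : Dir R) = wpow h (mult e hr B)) (hI : IsInvertibleIdeal I)
    {σ : Equiv.Perm ι}
    (hσ : ∀ i, Nonempty (IdealTensor I (ColumnModule e i) ≃ₗ[R] ColumnModule e (σ i)))
    (hiso : ∀ X : Submodule R (M ⧸ I • (⊤ : Submodule R M)), FiniteColength X →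
      Nonempty ((M ⧸ I • (⊤ : Submodule R M)) ≃ₗ[R] X))
    {a : ι → Dir R} (ha : ∀ i, 1 ≤ (a i).order) (b : ι → Dir R) :
    pairZeta hr e I M a b = wZeta hr e (a * b) (M ⧸ I • (⊤ : Submodule R M)) *
      pairZeta hr e I M (h' * (h * a) ∘ σ) (h * a * b) := by
  have hord : ∀ x y : Dir R, 1 ≤ x.order → 1 ≤ (x * y).order := fun x y hx =>
    (le_add_right hx).trans MvPowerSeries.le_order_mul
  have ha' : ∀ i, 1 ≤ ((h' * (h * a) ∘ σ) i).order := fun i => by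
    change 1 ≤ (h' i * (h (σ i) * a (σ i))).order
    rw [← mul_assoc, mul_comm]
    exact hord _ _ (ha _)
  have hab : ∀ i, 1 ≤ ((a * b) i).order := fun i => hord _ _ (ha _)
  have h1 := hasSum_pairIndex hr e I M hR hJ hh' hcard hI hσ hiso ha b
  have h2 := (hasSum_pairTerm hr e I M hR hJ ha' (h * a * b)).mul_left
    (wZeta hr e (a * b) (M ⧸ I • (⊤ : Submodule R M)))
  have h3 : ∀ W : {W : Submodule R M // FiniteColength W},
      HasSum (wTerm hr e (a * b) (SubQuot (W.1 ⊓ I • ⊤) W.1))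
        (wZeta hr e (a * b) (M ⧸ I • (⊤ : Submodule R M))) := by
    intro W
    obtain ⟨f⟩ := nonempty_subQuot_equiv hr e hiso W.2
    exact hasSum_wTerm_congr hr e f.symm (hasSum_wTerm hr e hR hJ hab _)
  -- Every `W / (W ∩ IM)` is isomorphic to `M / IM`, so the inner zeta function does not depend on
  -- `W`.
  have h4 := hasSum_of_sigma_mul
    (β := fun W : {W : Submodule R M // FiniteColength W} =>
      {Z : Submodule R (SubQuot (W.1 ⊓ I • ⊤) W.1) // FiniteColength Z})
    (f := fun W => wTerm hr e (a * b) (SubQuot (W.1 ⊓ I • ⊤) W.1))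
    (g := pairTerm hr e I M (h' * (h * a) ∘ σ) (h * a * b)) h1 h3
  exact HasSum.unique h4 h2

end PairZeta

/-! ### The infinite product -/

theorem wpow_prod {ι : Type v} [Fintype ι] {D : Type*} [CommRing D] {α : Type*} (s : Finset α)
    (f : α → ι → D) (c : ι → ℕ) : wpow (∏ k ∈ s, f k) c = ∏ k ∈ s, wpow (f k) c := by
  classical
  induction s using Finset.induction_on with
  | empty => simp [one_wpow]
  | insert k s hk ih => rw [Finset.prod_insert hk, Finset.prod_insert hk, mul_wpow, ih]

theorem smul_quotient_smul_top_eq_zero {R : Type u} [Ring R] {I : Ideal R} {M : Type v}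
    [AddCommGroup M] [Module R M] {x : R} (hx : x ∈ I) (y : M ⧸ I • (⊤ : Submodule R M)) :
    x • y = 0 := by
  obtain ⟨y, rfl⟩ := Submodule.Quotient.mk_surjective _ y
  exact (Submodule.Quotient.mk_eq_zero _).mpr (Submodule.smul_mem_smul hx trivial)

theorem smul_subquotient_eq_zero {R : Type u} [Ring R] {N : Type v} [AddCommGroup N] [Module R N]
    {x : R} (hx : ∀ y : N, x • y = 0) {Y : Submodule R N} {X : Submodule R Y} (b : Y ⧸ X) :
    x • b = 0 := by
  obtain ⟨b, rfl⟩ := Submodule.Quotient.mk_surjective _ b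
  rw [← Submodule.Quotient.mk_smul, show x • b = 0 from Subtype.ext (hx b),
    Submodule.Quotient.mk_zero]

section Final

variable {R : Type u} [Ring R]
variable {ι : Type v} [Fintype ι] {K : ι → Type w} [∀ i, Field (K i)] [∀ i, Finite (K i)]
  {r : ι → ℕ} (hr : ∀ i, 0 < r i)
  (e : (R ⧸ Ring.jacobson R) ≃+* ((i : ι) → Matrix (Fin (r i)) (Fin (r i)) (K i)))
variable (I : Ideal R) (M : Type u) [AddCommGroup M] [Module R M]

/-- The weights `h' i * ∏ k ≤ n, x (σ ^ k i)`. -/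
noncomputable def weight (h' x : ι → Dir R) (σ : Equiv.Perm ι) (n : ℕ) : ι → Dir R :=
  h' * ∏ k ∈ Finset.range (n + 1), x ∘ (σ ^ k : Equiv.Perm ι)

omit [Fintype ι] in
theorem le_order_prod_comp {x : ι → Dir R} (hx : ∀ i, 1 ≤ (x i).order) (σ : Equiv.Perm ι) (n : ℕ)
    (i : ι) : (n : ℕ∞) ≤
      ((∏ k ∈ Finset.range n, x ∘ (σ ^ k : Equiv.Perm ι) : ι → Dir R) i).order := by
  rw [Finset.prod_apply]
  refine le_trans ?_ (MvPowerSeries.le_order_prod _ _)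
  calc (n : ℕ∞) = ∑ k ∈ Finset.range n, 1 := by simp
    _ ≤ _ := Finset.sum_le_sum fun k _ => hx _

omit [Fintype ι] in
theorem le_order_weight {x : ι → Dir R} (hx : ∀ i, 1 ≤ (x i).order) (h' : ι → Dir R)
    (σ : Equiv.Perm ι) (n : ℕ) (i : ι) : ((n + 1 : ℕ) : ℕ∞) ≤ (weight h' x σ n i).order :=
  (le_add_left (le_order_prod_comp hx σ (n + 1) i)).trans MvPowerSeries.le_order_mul

variable [I.IsTwoSided] [Module.Projective R M]

/-- The zeta function of `M` is the product of the zeta functions of `M / IM` for the successive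
weights. -/
theorem hasProd_wZeta [Module.Finite R M] (hR : Finite (R ⧸ Ring.jacobson R))
    (hJ : (Ring.jacobson R).FG) {h h' : ι → Dir R} (hh' : h' * h = 1)
    (hcard : ∀ (B : Type u) [AddCommGroup B] [Module R B] [Finite B],
      (Nat.card (M →ₗ[R] B) : Dir R) = wpow h (mult e hr B)) (hI : IsInvertibleIdeal I)
    (hIJ : I ≤ Ring.jacobson R) {σ : Equiv.Perm ι}
    (hσ : ∀ i, Nonempty (IdealTensor I (ColumnModule e i) ≃ₗ[R] ColumnModule e (σ i)))
    (hiso : ∀ X : Submodule R (M ⧸ I • (⊤ : Submodule R M)), FiniteColength X →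
      Nonempty ((M ⧸ I • (⊤ : Submodule R M)) ≃ₗ[R] X))
    {a : ι → Dir R} (ha : ∀ i, 1 ≤ (a i).order) :
    HasProd (fun n => wZeta hr e (weight h' (h * a) σ n) (M ⧸ I • (⊤ : Submodule R M)))
      (wZeta hr e a M) := by
  let x : ι → Dir R := h * a
  have hord : ∀ x y : Dir R, 1 ≤ x.order → 1 ≤ (y * x).order := fun x y hx =>
    (le_add_left hx).trans MvPowerSeries.le_order_mul
  have hx : ∀ i, 1 ≤ (x i).order := fun i => hord _ _ (ha i)
  -- `A n` and `B n` solve the recursion `(a, b) ↦ (h' (ha)∘σ, hab)` started at `(a, 1)`; the factor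
  -- split off at stage `n` has weights `A n * B n`.
  let A : ℕ → ι → Dir R := fun n => h' * x ∘ (σ ^ n : Equiv.Perm ι)
  let B : ℕ → ι → Dir R := fun n => ∏ k ∈ Finset.range n, x ∘ (σ ^ k : Equiv.Perm ι)
  have hA : ∀ n i, 1 ≤ (A n i).order := fun n i => hord _ _ (hx _)
  have hhA : ∀ n, h * A n = x ∘ (σ ^ n : Equiv.Perm ι) := fun n => by
    rw [← mul_assoc, mul_comm h, hh', one_mul]
  have hAB : ∀ n, A n * B n = weight h' x σ n := fun n => by
    rw [weight, Finset.prod_range_succ, mul_assoc, mul_comm (x ∘ _)]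
  have hAs : ∀ n, h' * (h * A n) ∘ σ = A (n + 1) := fun n => by
    rw [hhA, Function.comp_assoc]
    change h' * _ = h' * _
    rw [pow_succ, Equiv.Perm.coe_mul]
  have hBs : ∀ n, h * A n * B n = B (n + 1) := fun n => by
    rw [hhA, mul_comm]
    exact (Finset.prod_range_succ _ n).symm
  have hpart : ∀ n, wZeta hr e a M = (∏ k ∈ Finset.range n,
      wZeta hr e (weight h' x σ k) (M ⧸ I • (⊤ : Submodule R M))) *
        pairZeta hr e I M (A n) (B n) := by
    intro n
    induction n with
    | zero =>
      have hA0 : A 0 = a := by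
        change h' * (h * a) ∘ (σ ^ 0 : Equiv.Perm ι) = a
        rw [pow_zero, Equiv.Perm.coe_one, Function.comp_id, ← mul_assoc, hh', one_mul]
      have hB0 : B 0 = 1 := Finset.prod_range_zero _
      rw [Finset.prod_range_zero, one_mul, hA0, hB0, pairZeta_one]
    | succ n ih =>
      rw [ih, pairZeta_eq_mul hr e I M hR hJ hh' hcard hI hσ hiso (hA n) (B n), hAs, hBs, hAB,
        Finset.prod_range_succ, mul_assoc]
  have hmul : Multipliable fun n =>
      wZeta hr e (weight h' x σ n) (M ⧸ I • (⊤ : Submodule R M)) := by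
    refine dir_multipliable fun n => le_trans (Nat.cast_le.mpr n.le_succ) ?_
    exact le_order_wZeta_sub_one hr e hR hJ (Nat.le_add_left 1 n) (le_order_weight hx h' σ n) _
  -- `B n` is a product of `n` weights of positive order, so the remainder tends to `1`.
  have hone : Tendsto (fun n => pairZeta hr e I M (A n) (B n)) atTop (nhds 1) :=
    dir_tendsto_one fun n => le_order_pairZeta_sub_one hr e I M hR hJ hIJ (hA n)
      (le_order_prod_comp hx σ n)
  have hlim := hmul.hasProd.tendsto_prod_nat.mul hone
  simp only [← hpart, mul_one] at hlim
  rw [tendsto_nhds_unique tendsto_const_nhds hlim]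
  exact hmul.hasProd

-- Every `P k` is isomorphic to `M / IM`, and `I` kills `I ^ k ⊗ B`, so the homomorphism counts are
-- those of `M`. The class of `I ^ k ⊗ B` is that of `B` permuted by `σ ^ k`. The leading inverse
-- cardinality supplies `h'`.
omit [Module.Projective R M] in
theorem bracket_eq_wpow {h h' : ι → Dir R} (hh' : h' * h = 1)
    (hcard : ∀ (B : Type u) [AddCommGroup B] [Module R B] [Finite B],
      (Nat.card (M →ₗ[R] B) : Dir R) = wpow h (mult e hr B)) (hI : IsInvertibleIdeal I)
    {σ : Equiv.Perm ι}
    (hσ : ∀ i, Nonempty (IdealTensor I (ColumnModule e i) ≃ₗ[R] ColumnModule e (σ i)))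
    {N : Type u} [AddCommGroup N] [Module R N] {P : ℕ → Submodule R N}
    (hP : ∀ j, Nonempty ((M ⧸ I • (⊤ : Submodule R M)) ≃ₗ[R] P j)) (j : ℕ) (B : Type u)
    [AddCommGroup B] [Module R B] [Finite B] (hB : ∀ x ∈ I, ∀ b : B, x • b = 0) :
    bracket I P j B = wpow (weight h' (h * zVar e) σ j) (mult e hr B) := by
  have hhom : ∀ (k : ℕ) (C : Type u) [AddCommGroup C] [Module R C] [Finite C],
      (∀ x ∈ I, ∀ c : C, x • c = 0) →
        MvPowerSeries.C (Nat.card (P k →ₗ[R] C) : ℂ) = wpow h (mult e hr C) := by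
    intro k C _ _ _ hC
    rw [← hcard, map_natCast, card_hom_congr (hP k).some.symm (LinearEquiv.refl R C),
      card_hom_quotient _ (smul_top_le_ker hC)]
  have hinv : MvPowerSeries.C ((Nat.card (P j →ₗ[R] B) : ℂ)⁻¹) = wpow h' (mult e hr B) := by
    have h1 := hhom j B hB
    have h2 : wpow h' (mult e hr B) * wpow h (mult e hr B) = 1 := by
      rw [← mul_wpow, hh', one_wpow]
    have h3 : (Nat.card (P j →ₗ[R] B) : ℂ) ≠ 0 := by
      intro h0
      rw [← h1, h0, map_zero, mul_zero] at h2
      exact zero_ne_one h2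
    refine (left_inv_eq_right_inv h2 ?_).symm
    rw [← h1, ← map_mul, mul_inv_cancel₀ h3, map_one]
  rw [bracket, hinv, weight, mul_wpow, wpow_prod]
  congr 1
  refine Finset.prod_congr rfl fun k _ => ?_
  obtain ⟨hf, hm⟩ := mult_pow_idealTensor hr e hI hσ B k
  rw [hhom _ _ fun x hx t => smul_pow_idealTensor_eq_zero hB k hx t, dirClass_eq_prod e hr,
    ← wpow_comp_perm _ hm, mul_wpow]
  rfl

theorem hasProlif [Module.Finite R M] (hR : Finite (R ⧸ Ring.jacobson R))
    (hJ : (Ring.jacobson R).FG) {h h' : ι → Dir R} (hh' : h' * h = 1)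
    (hcard : ∀ (B : Type u) [AddCommGroup B] [Module R B] [Finite B],
      (Nat.card (M →ₗ[R] B) : Dir R) = wpow h (mult e hr B)) (hI : IsInvertibleIdeal I)
    (hIJ : I ≤ Ring.jacobson R) {σ : Equiv.Perm ι}
    (hσ : ∀ i, Nonempty (IdealTensor I (ColumnModule e i) ≃ₗ[R] ColumnModule e (σ i)))
    (hiso : ∀ X : Submodule R (M ⧸ I • (⊤ : Submodule R M)), FiniteColength X →
      Nonempty ((M ⧸ I • (⊤ : Submodule R M)) ≃ₗ[R] X)) (hz : ∀ i, 1 ≤ (zVar e i).order) :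
    HasProlif I (M ⧸ I • (⊤ : Submodule R M)) (wZeta hr e (zVar e) M) := by
  let N := M ⧸ I • (⊤ : Submodule R M)
  have hw : ∀ j i, 1 ≤ (weight h' (h * zVar e) σ j i).order := fun j i =>
    le_trans (by exact_mod_cast Nat.le_add_left 1 j)
      (le_order_weight (fun i => (le_add_left (hz i)).trans MvPowerSeries.le_order_mul) h' σ j i)
  -- Every chain yields the same factors, those of `hasProd_wZeta`. The outer sum therefore has just
  -- one term, the class of the constant chain `Y₀`.
  refine ⟨fun _ => wZeta hr e (zVar e) M, fun Y => ⟨_, fun j => ?_,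
    hasProd_wZeta hr e I M hR hJ hh' hcard hI hIJ hσ hiso hz⟩, ?_⟩
  · have hY : ∀ k, Nonempty (N ≃ₗ[R] Y.Y k) := fun k => hiso _ (Y.finiteColength k)
    let E : {X : Submodule R (Y.Y (j + 1)) // FiniteColength X} ≃
        {X : Submodule R (Y.Y (j + 1)) // FiniteColength X ∧ Nonempty (X ≃ₗ[R] Y.Y j)} :=
      Equiv.subtypeEquivRight fun X => ⟨fun hX => ⟨hX,
        ⟨(nonempty_equiv_of_equiv hiso (hY (j + 1)).some.symm hX).some.symm.trans (hY j).some⟩⟩,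
        And.left⟩
    rw [← E.hasSum_iff]
    have h1 := hasSum_wTerm_congr hr e (hY (j + 1)).some (hasSum_wTerm hr e hR hJ (hw j) N)
    convert! h1 using 1
    ext1 X
    have : Finite (Y.Y (j + 1) ⧸ (E X).1) := (finiteColength_iff hr e).mp X.2
    refine bracket_eq_wpow hr e I M hh' hcard hI hσ hY j _ fun x hx b => ?_
    exact smul_subquotient_eq_zero (smul_quotient_smul_top_eq_zero hx) b
  · let Y₀ : ColengthChain R N :=
      ⟨fun _ => ⊤, monotone_const, fun _ => .of_subsingleton, 0, fun _ _ => rfl⟩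
    have huniq : ∀ p : ChainClass R N, p = Quotient.mk (chainSetoid R N) Y₀ := by
      intro p
      induction p using Quotient.inductionOn with
      | h Y =>
        refine Quotient.sound fun j => ?_
        exact ⟨(hiso _ (Y.finiteColength j)).some.symm.trans (hiso _ (Y₀.finiteColength j)).some⟩
    exact hasSum_single (Quotient.mk (chainSetoid R N) Y₀) fun p hp => absurd (huniq p) hp

omit [I.IsTwoSided] [Module.Projective R M] in
/-- The zeta function of `M / IM`. -/
theorem wZeta_eq_prod_inv [Module.Finite R M] (hR : Finite (R ⧸ Ring.jacobson R))
    (hJ : (Ring.jacobson R).FG) (hIJ : I ≤ Ring.jacobson R)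
    [IsSemisimpleModule R (M ⧸ Ring.jacobson R • (⊤ : Submodule R M))]
    (hiso : ∀ X : Submodule R (M ⧸ I • (⊤ : Submodule R M)), FiniteColength X →
      Nonempty ((M ⧸ I • (⊤ : Submodule R M)) ≃ₗ[R] X))
    {a : ι → Dir R} (ha : ∀ i, 1 ≤ (a i).order) :
    wZeta hr e a (M ⧸ I • (⊤ : Submodule R M)) = ∏ i, ∏ j ∈ Finset.range
      (mult e hr (M ⧸ Ring.jacobson R • (⊤ : Submodule R M)) i),
        (1 - (Nat.card (K i) : Dir R) ^ j * a i)⁻¹ := by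
  have hle : I • (⊤ : Submodule R M) ≤ Ring.jacobson R • ⊤ := Submodule.smul_mono hIJ le_rfl
  let f := Submodule.quotientQuotientEquivQuotient _ _ hle
  -- As `I ≤ J`, the top of `M / IM` is that of `M`, so Hey's formula involves the same
  -- multiplicities.
  have hN : (Ring.jacobson R • (⊤ : Submodule R M)).map (I • (⊤ : Submodule R M)).mkQ =
      Ring.jacobson R • ⊤ := by
    rw [Submodule.map_smul'', Submodule.map_top, Submodule.range_mkQ]
  have := IsSemisimpleModule.congr f
  have := finite_quotient_jacobson hR M
  have h1 := wZeta_mul_prod hr e hR hJ ha _ hN hiso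
  rw [← mult_congr e hr f.symm] at h1
  refine left_inv_eq_right_inv h1 ?_
  rw [← Finset.prod_mul_distrib]
  refine Finset.prod_eq_one fun i _ => ?_
  rw [← Finset.prod_mul_distrib]
  refine Finset.prod_eq_one fun j _ => MvPowerSeries.mul_inv_cancel _ ?_
  rw [map_sub, map_mul, MvPowerSeries.one_le_order_iff_constCoeff_eq_zero.mp (ha i)]
  simp

omit [Fintype ι] [∀ i, Finite (K i)] in
include hr in
theorem one_le_order_zVar (i : ι) : 1 ≤ (zVar e i).order := by
  rw [zVar, dirClass, grothClass_simple (column_isSimpleModule e hr i),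
    MvPowerSeries.order_monomial_of_ne_zero one_ne_zero]
  simp

end Final
end LiftedHey

open LiftedHey in
theorem mainTheorem2 {R : Type u} [Ring R]
    (hR : Finite (R ⧸ Ring.jacobson R)) (hJ : (Ring.jacobson R).FG)
    {M : Type u} [AddCommGroup M] [Module R M] [Module.Finite R M] [Module.Projective R M]
    (I : Ideal R) [I.IsTwoSided] (hI : LiftedHey.IsInvertibleIdeal I)
    (hIJ : I ≤ Ring.jacobson R)
    (hiso : ∀ X Y : Submodule R (M ⧸ I • (⊤ : Submodule R M)),
      LiftedHey.FiniteColength X → LiftedHey.FiniteColength Y → Nonempty (X ≃ₗ[R] Y))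
    {ι : Type v} [Fintype ι] {K : ι → Type w} [∀ i, Field (K i)] [∀ i, Finite (K i)]
    {r : ι → ℕ} (hr : ∀ i, 0 < r i) (m : ι → ℕ)
    (e : (R ⧸ Ring.jacobson R) ≃+* ((i : ι) → Matrix (Fin (r i)) (Fin (r i)) (K i)))
    (hM : Nonempty ((M ⧸ Ring.jacobson R • (⊤ : Submodule R M)) ≃ₗ[R]
      ((i : ι) → Fin (m i) → LiftedHey.ColumnModule e i))) :
    ∃ σ : Equiv.Perm ι,
      (∀ i, Nonempty (LiftedHey.IdealTensor I (LiftedHey.ColumnModule e i) ≃ₗ[R]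
        LiftedHey.ColumnModule e (σ i))) ∧
      Summable (LiftedHey.zetaTerm R M) ∧
      LiftedHey.HasProlif I (M ⧸ I • (⊤ : Submodule R M)) (LiftedHey.brZeta R M) ∧
      HasProd (fun n : ℕ => ∏ i, ∏ j ∈ Finset.range (m i),
        (1 - MvPowerSeries.C ((Nat.card (K i) : ℂ) ^ ((j : ℤ) - (m i : ℤ))) *
          ∏ k ∈ Finset.range (n + 1), LiftedHey.wVar e ((σ ^ k) i) m)⁻¹)
        (LiftedHey.brZeta R M) := by
  obtain ⟨σ, hσ⟩ := exists_perm hr e hI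
  have hcol := fun i => column_isSimpleModule e hr i
  have hcolf := fun i => column_finite e i
  obtain ⟨f⟩ := hM
  have hss : IsSemisimpleModule R (M ⧸ Ring.jacobson R • (⊤ : Submodule R M)) := .congr f
  have hfin := finite_quotient_jacobson hR M
  have hm : mult e hr (M ⧸ Ring.jacobson R • (⊤ : Submodule R M)) = m :=
    (mult_congr e hr f).trans (mult_pi_column hr e m)
  -- `h` records the homomorphism counts out of `M`, with `h i * zVar e i` equal to `wVar e i m`;
  -- its inverse `h'` exists since `q_i ≠ 0`.
  let h : ι → Dir R := fun i => MvPowerSeries.C ((Nat.card (K i) : ℂ) ^ m i)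
  let h' : ι → Dir R := fun i => MvPowerSeries.C (((Nat.card (K i) : ℂ) ^ m i)⁻¹)
  have hq : ∀ i, (Nat.card (K i) : ℂ) ≠ 0 := fun i => Nat.cast_ne_zero.mpr Nat.card_pos.ne'
  have hh' : h' * h = 1 := by
    ext1 i
    change h' i * h i = 1
    simp only [h, h']
    rw [← map_mul, inv_mul_cancel₀ (pow_ne_zero _ (hq i)), map_one]
  have hcard : ∀ (B : Type u) [AddCommGroup B] [Module R B] [Finite B],
      (Nat.card (M →ₗ[R] B) : Dir R) = wpow h (mult e hr B) := by
    intro B _ _ _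
    rw [card_hom_projective hr e B, hm]
    simp [wpow, h]
  have hiso' : ∀ X : Submodule R (M ⧸ I • (⊤ : Submodule R M)), FiniteColength X →
      Nonempty ((M ⧸ I • (⊤ : Submodule R M)) ≃ₗ[R] X) := fun X hX =>
    ⟨Submodule.topEquiv.symm.trans (hiso ⊤ X .of_subsingleton hX).some⟩
  have hz := one_le_order_zVar hr e
  have hterm : zetaTerm R M = wTerm hr e (zVar e) M := by
    ext1 X
    exact dirClass_eq_prod e hr _
  have hZ : brZeta R M = wZeta hr e (zVar e) M := by rw [brZeta, hterm, wZeta]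
  refine ⟨σ, hσ, ?_, ?_, ?_⟩
  · rw [hterm]
    exact (hasSum_wTerm hr e hR hJ hz M).summable
  · rw [hZ]
    exact hasProlif hr e I M hR hJ hh' hcard hI hIJ hσ hiso' hz
  · rw [hZ]
    convert! hasProd_wZeta hr e I M hR hJ hh' hcard hI hIJ hσ hiso' hz using 1
    ext1 n
    have hw : ∀ i, 1 ≤ (weight h' (h * zVar e) σ n i).order := fun i =>
      le_trans (by exact_mod_cast Nat.le_add_left 1 n) (le_order_weight
        (fun i => (le_add_left (hz i)).trans MvPowerSeries.le_order_mul) h' σ n i)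
    rw [wZeta_eq_prod_inv hr e I M hR hJ hIJ hiso' hw, hm]
    refine Finset.prod_congr rfl fun i _ => Finset.prod_congr rfl fun j _ => ?_
    congr 2
    have h1 : weight h' (h * zVar e) σ n i =
        h' i * ∏ k ∈ Finset.range (n + 1), wVar e ((σ ^ k) i) m := by
      rw [weight, Pi.mul_apply, Finset.prod_apply]
      rfl
    have h2 : (Nat.card (K i) : Dir R) = MvPowerSeries.C (Nat.card (K i) : ℂ) := by
      rw [map_natCast]
    -- The exponent `j - m i` combines `q_i ^ j` from Hey's formula with the factor `h' i` of the
    -- weight.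
    rw [h1, ← mul_assoc, h2, ← map_pow, zpow_sub₀ (hq i), zpow_natCast, zpow_natCast,
      div_eq_mul_inv, map_mul]
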